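/- Let $M$ be a compact complex manifold of dimension $m$, let $\mathcal X$ be a complex manifold of dimension $m+n$, let $\pi:\mathcal X\to M$ be a proper surjective holomorphic submersion, and let $L\to\mathcal X$ be a holomorphic line bundle. A smooth Hermitian metric on $L$ is denoted by its local weights $\phi$ (so $|s|^2=e^{-\phi}$ for a local holomorphic frame $s$), and $c_1(L,\phi)=\frac{\sqrt{-1}}{2\pi}\partial\bar\partial\phi$ is its first Chern form. For $0\le k\le m$ the $k$-th $S$-form of $(L,\phi)$ is the form on $M$ obtained by integration along the fibres of $\pi$, $$S_k(L,\phi)=\pi_*\big(c_1(L,\phi)^{n+k}\big)=\int_{\mathcal X/M}\Big(\frac{\sqrt{-1}}{2\pi}\partial\bar\partial\phi\Big)^{n+k},$$ and the $k$-th $S$-class of $L$ is $S_k(L)=\pi_*\big(c_1(L)^{n+k}\big)$, regarded in the de Rham cohomology group $H^{2k}(M,\mathbb C)$. A smooth form $\Phi$ of type $(k,k)$ on a complex manifold is called positive if at every point $$(-\sqrt{-1})^{k^2}\,\Phi(v_1,\dots,v_k,\bar v_1,\dots,\bar v_k)>0$$ for all linearly independent tangent vectors $v_1,\dots,v_k$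 of type $(1,0)$. 1. If $\phi$ is a smooth metric on $L$ with $\sqrt{-1}\partial\bar\partial\phi>0$ on $\mathcal X$, then for every $0\le k\le m$ the form $S_k(L,\phi)$ is a (smooth) positive $(k,k)$-form on $M$; it is closed and represents the class $S_k(L)$. 2. If $L$ is ample (that is, for some $N\ge1$ finitely many holomorphic sections of $L^{\otimes N}$ without common zeros define an embedding of $\mathcal X$ into a projective space), then for every $0\le k\le m$ the class $S_k(L)$ is represented by a closed positive $(k,k)$-form on $M$. -/

import Mathlib

open scoped Manifold ContDiff TensorProduct Topology

namespace CplxFib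

noncomputable section

/-! ### Multilinear algebra: wedge products, contraction, complexification

`E` is a complex vector space; `E [⋀^Fin p]→L[ℝ] ℂ` is the space of complex-valued real-alternating
`p`-forms on `E`. -/

section Algebra

variable {E : Type*} [NormedAddCommGroup E] [NormedSpace ℂ E]

/-- The multilinear map `(v₁, …, v_{p+q}) ↦ α (v₁, …, v_p) * β (v_{p+1}, …, v_{p+q})`. -/
def tensorForm {p q : ℕ} (α : E [⋀^Fin p]→L[ℝ] ℂ) (β : E [⋀^Fin q]→L[ℝ] ℂ) :
    ContinuousMultilinearMap ℝ (fun _ : Fin (p + q) => E) ℂ where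
  toMultilinearMap :=
    ((LinearMap.mul' ℝ ℂ).compMultilinearMap
      (MultilinearMap.domCoprod α.toAlternatingMap.toMultilinearMap
        β.toAlternatingMap.toMultilinearMap)).domDomCongr finSumFinEquiv
  cont := by
    change Continuous fun v : Fin (p + q) → E =>
      α (fun i => v (finSumFinEquiv (Sum.inl i))) * β (fun i => v (finSumFinEquiv (Sum.inr i)))
    exact (α.cont.comp (by fun_prop)).mul (β.cont.comp (by fun_prop))

/-- The wedge product
`(α ∧ β) (v) = 1 / (p! q!) ∑_σ sign σ · α (v_{σ 1}, …, v_{σ p}) β (v_{σ (p+1)}, …, v_{σ (p+q)})`. -/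
def wedge {p q : ℕ} (α : E [⋀^Fin p]→L[ℝ] ℂ) (β : E [⋀^Fin q]→L[ℝ] ℂ) :
    E [⋀^Fin (p + q)]→L[ℝ] ℂ :=
  ((p.factorial * q.factorial : ℝ)⁻¹) • ContinuousMultilinearMap.alternatization (tensorForm α β)

/-- The wedge power `γ ∧ ⋯ ∧ γ` (`N` factors) of a 2-form. -/
def wedgePow (γ : E [⋀^Fin 2]→L[ℝ] ℂ) : (N : ℕ) → E [⋀^Fin (2 * N)]→L[ℝ] ℂ
  | 0 => ContinuousAlternatingMap.constOfIsEmpty ℝ E (Fin 0) (1 : ℂ)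
  | N + 1 => wedge (wedgePow γ N) γ

/-- Transport of an alternating map along an equality of degrees. -/
def castDegree {p q : ℕ} (h : p = q) (α : E [⋀^Fin p]→L[ℝ] ℂ) : E [⋀^Fin q]→L[ℝ] ℂ where
  toMultilinearMap := (α.toAlternatingMap.domDomCongr (finCongr h)).toMultilinearMap
  cont := by
    change Continuous fun v : Fin q → E => α (fun i => v (finCongr h i))
    exact α.cont.comp (by fun_prop)
  map_eq_zero_of_eq' := (α.toAlternatingMap.domDomCongr (finCongr h)).map_eq_zero_of_eq'

/-- Contraction of an alternating map with `f₁, …, f_q` in the first `q` slots: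
`(w₁, …, w_r) ↦ β (f₁, …, f_q, w₁, …, w_r)`. -/
def contract {r : ℕ} : (q : ℕ) → (Fin q → E) → E [⋀^Fin (r + q)]→L[ℝ] ℂ → E [⋀^Fin r]→L[ℝ] ℂ
  | 0, _, β => β
  | q + 1, f, β => contract q (fun j => f j.succ)
      (ContinuousAlternatingMap.curryLeft (n := r + q) β (f 0))

/-- The complex-multilinear extension of a real-multilinear form to the complexification `E ⊗_ℝ ℂ`,
where the pair `(a, b)` stands for the complexified vector `a + √-1 b`. -/
def complexEval {p : ℕ} (Φ : E [⋀^Fin p]→L[ℝ] ℂ) (ξ : Fin p → E × E) : ℂ :=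
  ∑ s : Finset (Fin p), Complex.I ^ s.card * Φ (fun j => if j ∈ s then (ξ j).2 else (ξ j).1)

/-- The `(1,0)`-vector `(u - √-1 J u) / 2`, where `J` is multiplication by `i` on `E`. The map
`u ↦ vec10 u` is the standard complex-linear isomorphism of `E` onto the space of
`(1,0)`-vectors. -/
def vec10 (u : E) : E × E := ((1 / 2 : ℂ) • u, (-(Complex.I / 2)) • u)

/-- The `(0,1)`-vector `(u + √-1 J u) / 2`, the complex conjugate of `vec10 u`. -/
def vec01 (u : E) : E × E := ((1 / 2 : ℂ) • u, (Complex.I / 2) • u)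

/-- `Φ` is of type `(p, q)`: it is a `(p + q)`-form whose complex-multilinear extension vanishes on
tuples of `(1,0)`- and `(0,1)`-vectors in which the number of `(1,0)`-vectors is not `p`. -/
def IsType (p q : ℕ) {r : ℕ} (Φ : E [⋀^Fin r]→L[ℝ] ℂ) : Prop :=
  r = p + q ∧ ∀ (u : Fin r → E) (T : Finset (Fin r)), T.card ≠ p →
    complexEval Φ (fun j => if j ∈ T then vec10 (u j) else vec01 (u j)) = 0

/-- The tuple `(v₁, …, v_k, v̄₁, …, v̄_k)` where `v_j` is the `(1,0)`-vector `vec10 (u j)`. -/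
def conjFrame {k : ℕ} (u : Fin k → E) : Fin (2 * k) → E × E := fun j =>
  if h : j.1 < k then vec10 (u ⟨j.1, h⟩) else vec01 (u ⟨j.1 - k, by omega⟩)

/-- Pointwise positivity: `(-√-1)^{k²} Φ (v₁, …, v_k, v̄₁, …, v̄_k)` is a positive real number for
all linearly independent `(1,0)`-vectors `v₁, …, v_k`. -/
def IsPositiveAt (k : ℕ) (Φ : E [⋀^Fin (2 * k)]→L[ℝ] ℂ) : Prop :=
  ∀ u : Fin k → E, LinearIndependent ℂ u →
    0 < ((-Complex.I) ^ (k ^ 2) * complexEval Φ (conjFrame u)).re ∧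
    ((-Complex.I) ^ (k ^ 2) * complexEval Φ (conjFrame u)).im = 0

end Algebra

/-! ### Differential forms on a complex manifold -/

section Forms

variable {E : Type*} [NormedAddCommGroup E] [NormedSpace ℂ E]
  {F : Type*} [NormedAddCommGroup F] [NormedSpace ℂ F]
  {X : Type*} [TopologicalSpace X] [ChartedSpace E X]

variable (E X) in
/-- A (not necessarily continuous) complex-valued differential `p`-form on the manifold `X` modelled
on `E`. As in Mathlib, the tangent space of `X` at `x` is `E`, a vector being identified with its
coordinates in the preferred chart `chartAt E x`. -/
abbrev DForm (p : ℕ) : Type _ := X → E [⋀^Fin p]→L[ℝ] ℂ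

/-- The coordinate expression `(e⁻¹)^* θ` of a form in a (generalized) chart `e : X → F`. -/
def inChart {p : ℕ} (θ : DForm E X p) (e : OpenPartialHomeomorph X F) (y : F) :
    F [⋀^Fin p]→L[ℝ] ℂ :=
  (θ (e.symm y)).compContinuousLinearMap
    (fderiv ℝ (fun z => chartAt E (e.symm y) (e.symm z)) y)

/-- Smoothness (real `C^∞`) of a form. -/
def IsSmoothForm {p : ℕ} (θ : DForm E X p) : Prop :=
  ∀ e ∈ atlas E X, ContDiffOn ℝ ∞ (inChart θ e) e.target

/-- `dη = θ`. -/
def IsExtDeriv {p : ℕ} (η : DForm E X p) (θ : DForm E X (p + 1)) : Prop :=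
  ∀ e ∈ atlas E X, ∀ y ∈ e.target, extDeriv (inChart η e) y = inChart θ e y

/-- `dθ = 0`. -/
def IsClosedForm {p : ℕ} (θ : DForm E X p) : Prop :=
  ∀ e ∈ atlas E X, ∀ y ∈ e.target, extDeriv (inChart θ e) y = 0

/-- `θ = dη` for some smooth `η`; a form of degree zero is exact only if it is zero. -/
def IsExactForm : {p : ℕ} → DForm E X p → Prop
  | 0, θ => θ = 0
  | p + 1, θ => ∃ η : DForm E X p, IsSmoothForm η ∧ IsExtDeriv η θ

/-- A positive `(k,k)`-form: smooth, of type `(k,k)`, and pointwise positive. -/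
def IsPositiveForm (k : ℕ) (Φ : DForm E X (2 * k)) : Prop :=
  IsSmoothForm Φ ∧ ∀ x, IsType k k (Φ x) ∧ IsPositiveAt k (Φ x)

/-- `∂̄ f = (df + √-1 df ∘ J) / 2` for a function `f` on `E`, as a 1-form. -/
def dbar (f : E → ℂ) (y : E) : E [⋀^Fin 1]→L[ℝ] ℂ :=
  ContinuousAlternatingMap.ofSubsingleton ℝ E ℂ (0 : Fin 1)
    ((1 / 2 : ℂ) • (fderiv ℝ f y + Complex.I • (fderiv ℝ f y).comp
      ((Complex.I • ContinuousLinearMap.id ℂ E).restrictScalars ℝ)))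

/-- `∂∂̄ f`, which equals `d(∂̄ f)` because `∂̄∂̄ f = 0`. -/
def ddbar (f : E → ℂ) (y : E) : E [⋀^Fin 2]→L[ℝ] ℂ := extDeriv (dbar f) y

end Forms

/-! ### Holomorphic line bundles, smooth metrics, ampleness -/

section LineBundle

variable {E : Type*} [NormedAddCommGroup E] [NormedSpace ℂ E]
  {X : Type*} [TopologicalSpace X] [ChartedSpace E X]
  {L : X → Type*} [∀ x, AddCommGroup (L x)] [∀ x, Module ℂ (L x)]
  [∀ x, TopologicalSpace (L x)] [TopologicalSpace (Bundle.TotalSpace ℂ L)]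
  [FiberBundle ℂ L] [VectorBundle ℂ ℂ L]

variable (E L) in
/-- A smooth (Hermitian) metric `φ` on a complex line bundle, given by the squared norm
`normSq x ξ = |ξ|²_φ` on each fibre. The local weight of the metric is `-log |s|²_φ` for a local
frame `s`, so that `|s|²_φ = e^{-φ}`. -/
structure SmoothMetric where
  normSq : ∀ x, L x → ℝ
  normSq_smul : ∀ x (c : ℂ) (ξ : L x), normSq x (c • ξ) = ‖c‖ ^ 2 * normSq x ξ
  normSq_pos : ∀ x (ξ : L x), ξ ≠ 0 → 0 < normSq x ξ
  smooth : ∀ (e : Bundle.Trivialization ℂ (Bundle.TotalSpace.proj : Bundle.TotalSpace ℂ L → X))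
    [MemTrivializationAtlas e],
    ContMDiffOn 𝓘(ℝ, E) 𝓘(ℝ, ℝ) ∞ (fun x => normSq x (e.symm x 1)) e.baseSet

/-- The weight `φ = -log |s|²_φ` of a metric with respect to the frame `s` of a trivialization. -/
def SmoothMetric.weight (φ : SmoothMetric E L)
    (e : Bundle.Trivialization ℂ (Bundle.TotalSpace.proj : Bundle.TotalSpace ℂ L → X)) (x : X) : ℝ :=
  -Real.log (φ.normSq x (e.symm x 1))

/-- The global 2-form `√-1 ∂∂̄φ` on `X`; at `x` it is computed from the local weight in the preferred
trivialization of `L` at `x` and in the preferred chart of `X` at `x`. -/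
def SmoothMetric.curvature (φ : SmoothMetric E L) : DForm E X 2 := fun x =>
  Complex.I • ddbar (fun z : E =>
    ((φ.weight (FiberBundle.trivializationAt ℂ L x) ((chartAt E x).symm z) : ℝ) : ℂ)) (chartAt E x x)

/-- `√-1 ∂∂̄φ > 0`. -/
def SmoothMetric.IsPositive (φ : SmoothMetric E L) : Prop :=
  ∀ x, IsPositiveAt 1 (φ.curvature x)

/-- The first Chern form `c₁(L, φ) = (√-1 / 2π) ∂∂̄φ`. -/
def SmoothMetric.chernForm (φ : SmoothMetric E L) : DForm E X 2 := fun x =>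
  ((2 * Real.pi)⁻¹ : ℝ) • φ.curvature x

variable (E L) in
/-- `γ` is a smooth closed form in the de Rham class of `c₁(L)`: it is cohomologous to the first
Chern form of every smooth metric on `L`. -/
def RepresentsC1 (γ : DForm E X 2) : Prop :=
  IsSmoothForm γ ∧ IsClosedForm γ ∧ ∀ φ : SmoothMetric E L, IsExactForm (γ - φ.chernForm)

/-- The coordinate `L_x^{⊗ N} ≅ ℂ` induced by a trivialization of `L`. -/
def powCoord (N : ℕ) (e : Bundle.Trivialization ℂ (Bundle.TotalSpace.proj : Bundle.TotalSpace ℂ L → X))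
    [MemTrivializationAtlas e] (x : X) : (⨂[ℂ]^N (L x)) →ₗ[ℂ] ℂ :=
  PiTensorProduct.lift ((MultilinearMap.mkPiAlgebra ℂ (Fin N) ℂ).compLinearMap
    (fun _ => e.linearMapAt ℂ x))

variable (E) in
/-- Holomorphic sections of `L^{⊗ N}`. -/
def IsHolomorphicSection {N : ℕ} (s : ∀ x, ⨂[ℂ]^N (L x)) : Prop :=
  ∀ (e : Bundle.Trivialization ℂ (Bundle.TotalSpace.proj : Bundle.TotalSpace ℂ L → X)) [MemTrivializationAtlas e],
    ContMDiffOn 𝓘(ℂ, E) 𝓘(ℂ, ℂ) ω (fun x => powCoord N e x (s x)) e.baseSet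

variable (E L) in
/-- Ampleness of a line bundle on a compact complex manifold: for some `N ≥ 1` there are finitely
many holomorphic sections `s₁, …, s_r` of `L^{⊗ N}` without common zero such that
`x ↦ [s₁(x) : ⋯ : s_r(x)]` is an injective immersion (so, `X` being compact, an embedding) into
projective space. -/
def IsAmple : Prop :=
  ∃ N : ℕ, 1 ≤ N ∧ ∃ (r : ℕ) (s : Fin r → ∀ x, ⨂[ℂ]^N (L x)),
    (∀ j, IsHolomorphicSection E (s j)) ∧
    (∀ x, ∃ j, s j x ≠ 0) ∧
    (∀ x x', x ≠ x' → ¬ ∃ c : ℂ, ∀ j,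
      powCoord N (FiberBundle.trivializationAt ℂ L x') x' (s j x') =
        c * powCoord N (FiberBundle.trivializationAt ℂ L x) x (s j x)) ∧
    (∀ x, ∀ u : TangentSpace 𝓘(ℂ, E) x, u ≠ 0 → ¬ ∃ c : ℂ, ∀ j,
      mfderiv 𝓘(ℂ, E) 𝓘(ℂ, ℂ) (fun y => powCoord N (FiberBundle.trivializationAt ℂ L x) y (s j y)) x u =
        c * powCoord N (FiberBundle.trivializationAt ℂ L x) x (s j x))

end LineBundle

/-! ### Integration along the fibres -/

section FiberIntegration

variable {B : Type*} [NormedAddCommGroup B] [NormedSpace ℂ B]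
  {E : Type*} [NormedAddCommGroup E] [NormedSpace ℂ E]
  {M : Type*} [TopologicalSpace M] [ChartedSpace B M]
  {X : Type*} [TopologicalSpace X] [ChartedSpace E X]

variable (E) in
/-- `e` is a biholomorphism of an open subset of `X` onto an open subset of `F`. -/
def IsHolomorphicChart {F : Type*} [NormedAddCommGroup F] [NormedSpace ℂ F]
    (e : OpenPartialHomeomorph X F) : Prop :=
  ContMDiffOn 𝓘(ℂ, E) 𝓘(ℂ, F) ω e e.source ∧ ContMDiffOn 𝓘(ℂ, F) 𝓘(ℂ, E) ω e.symm e.target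

variable (B E) in
/-- Admissible holomorphic coordinates `(z; v)` of `X`, with values in `B × ℂⁿ`, over holomorphic
coordinates `z` of `M`: in these coordinates `π (z; v) = z`. -/
structure IsAdmissible {n : ℕ} (π : X → M) (e : OpenPartialHomeomorph X (B × (Fin n → ℂ)))
    (b : OpenPartialHomeomorph M B) : Prop where
  holo : IsHolomorphicChart E e
  holo_base : IsHolomorphicChart B b
  mapsTo : Set.MapsTo π e.source b.source
  fst_eq : ∀ x ∈ e.source, (e x).1 = b (π x)

variable (B E) in
/-- A finite cover of `X` by admissible charts together with a subordinate smooth partition of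
unity. -/
structure FiberPartition (n : ℕ) (π : X → M) where
  N : ℕ
  chart : Fin N → OpenPartialHomeomorph X (B × (Fin n → ℂ))
  base : Fin N → OpenPartialHomeomorph M B
  admissible : ∀ i, IsAdmissible B E π (chart i) (base i)
  ρ : Fin N → X → ℝ
  smooth : ∀ i, ContMDiff 𝓘(ℝ, E) 𝓘(ℝ, ℝ) ∞ (ρ i)
  nonneg : ∀ i x, 0 ≤ ρ i x
  tsupport_subset : ∀ i, tsupport (ρ i) ⊆ (chart i).source
  sum_eq_one : ∀ x, ∑ i, ρ i x = 1

/-- The frame `∂/∂x₁, ∂/∂y₁, …, ∂/∂x_n, ∂/∂y_n` of the fibre directions of `B × ℂⁿ`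
(`v^j = x_j + √-1 y_j`), positive for the complex orientation of the fibres. -/
def verticalFrame (B : Type*) [NormedAddCommGroup B] (n : ℕ) (j : Fin (2 * n)) :
    B × (Fin n → ℂ) :=
  (0, Pi.single ⟨j.1 / 2, by omega⟩ (if j.1 % 2 = 0 then 1 else Complex.I))

open Classical in
/-- Integration along the fibres, computed with a given partition of unity: the sum over the
admissible charts `(z; v)` of the forms `∫_v ρ β (∂/∂x₁, ∂/∂y₁, …, ∂/∂x_n, ∂/∂y_n, ⋯) dv` in `z`,
where `dv` is Lebesgue measure on `ℂⁿ`. -/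
def FiberPartition.integrate {n : ℕ} {π : X → M} (P : FiberPartition B E n π) {r : ℕ}
    (β : DForm E X (r + 2 * n)) : DForm B M r := fun y =>
  ∑ i, if y ∈ (P.base i).source then
    (∫ v : Fin n → ℂ,
      if (P.base i y, v) ∈ (P.chart i).target then
        P.ρ i ((P.chart i).symm (P.base i y, v)) •
          (contract (2 * n) (verticalFrame B n)
            (inChart β (P.chart i) (P.base i y, v))).compContinuousLinearMap
              ((ContinuousLinearMap.inl ℂ B (Fin n → ℂ)).restrictScalars ℝ)
      else 0).compContinuousLinearMap
        (fderiv ℝ (fun z => P.base i ((chartAt B y).symm z)) (chartAt B y y))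
  else 0

open Classical in
variable (B E) in
/-- Integration along the fibres `π_* β = ∫_{X/M} β` of a proper holomorphic submersion `π : X → M`
with compact base and `n`-dimensional fibres. As usual the value does not depend on the partition
of unity by which it is computed. -/
def fiberIntegral (n : ℕ) (π : X → M) {r : ℕ} (β : DForm E X (r + 2 * n)) : DForm B M r :=
  if h : Nonempty (FiberPartition B E n π) then h.some.integrate β else 0

variable (B E) in
/-- `π_* (γ^{n+k})`, a `2k`-form on `M`, for a 2-form `γ` on `X`. -/
def pushPow (n k : ℕ) (π : X → M) (γ : DForm E X 2) : DForm B M (2 * k) :=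
  fiberIntegral B E n π (r := 2 * k) fun x =>
    castDegree (by omega : 2 * (n + k) = 2 * k + 2 * n) (wedgePow (γ x) (n + k))

variable {L : X → Type*} [∀ x, AddCommGroup (L x)] [∀ x, Module ℂ (L x)]
  [∀ x, TopologicalSpace (L x)] [TopologicalSpace (Bundle.TotalSpace ℂ L)]
  [FiberBundle ℂ L] [VectorBundle ℂ ℂ L]

variable (B) in
/-- The `k`-th `S`-form `S_k(L, φ) = π_* (c₁(L, φ)^{n+k})`. -/
def SForm (n k : ℕ) (π : X → M) (φ : SmoothMetric E L) : DForm B M (2 * k) :=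
  pushPow B E n k π φ.chernForm

variable (B E L) in
/-- The form `Φ` on `M` represents the `k`-th `S`-class `S_k(L) = π_* (c₁(L)^{n+k})` in de Rham
cohomology: it is smooth, closed, and cohomologous to `π_* (γ^{n+k})` for every closed form `γ` in the
class `c₁(L)` (for example for the Chern form of any smooth metric on `L`). -/
def RepresentsSClass (n k : ℕ) (π : X → M) (Φ : DForm B M (2 * k)) : Prop :=
  IsSmoothForm Φ ∧ IsClosedForm Φ ∧
    ∀ γ : DForm E X 2, RepresentsC1 E L γ → IsExactForm (Φ - pushPow B E n k π γ)

end FiberIntegration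

end

end CplxFib

/-! Positivity is linear algebra on tangent spaces. The Chern form ω of a positive metric is real,
invariant under the complex structure J and satisfies ω(u, Ju) > 0 for u ≠ 0, so it is the imaginary
part of a Hermitian inner product. In an orthogonal basis only permutations respecting the pairs (b,
Jb) contribute to ω^N, each with the same positive product; hence ω^N is positive on (u₁, Ju₁, …,
u_N, Ju_N) for independent u's (`wedgePow_pairFrame_pos`). The form π_*(ω^{n+k}), evaluated on k
such pairs of base vectors, is the fibre integral of ω^{n+k} on n vertical and k horizontal pairs.
Surjectivity of π makes every fibre nonempty, so the integral is strictly positive. The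
normalisation (-i)^{k²} is exactly what turns positivity on these real tuples into positivity on (v,
v̄) (`complexEval_conjFrame`), and type (k,k) follows from invariance under rotations by unit
scalars.

Closedness and the cohomology class rest on π_* d = d π_*. On a product this follows by induction on
the contracted vertical vectors: by Cartan's formula, contracting with a constant vertical field
anticommutes with d up to a derivative along that field, whose integral vanishes for compact
support. Globally dβ = ∑ d(ρ_i β), and these summands are not multiples of the ρ_i, so one must know
that the fibre integral does not depend on the admissible chart (`fiberForm_change`); this is the
change of variables formula, a complex-linear map having real determinant |det|². A telescoping sum
shows that powers of cohomologous closed 2-forms are cohomologous, and π_* carries a primitive to a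
primitive. In base degree zero, where exact means zero, the fibre integral of an exact form
vanishes.

For ample L the Fubini–Study metric of sections embedding X by L^N has weight (1/N) log ∑|s_j|². Its
curvature on (u, Ju) is a positive multiple of the Gram determinant of s and ds(u), which strict
Cauchy–Schwarz makes positive because the map to projective space is an immersion
(`fubiniStudy_isPositive`). This reduces the second statement to the first. -/

namespace CplxFib
noncomputable section

/-! ### Signed sums over symmetric groups. -/

section PermSums

/-- Averaging a signed sum over `Perm ι` along sign-preserving translations. -/
theorem sum_sign_sum_sign {ι κ : Type*} [Fintype ι] [DecidableEq ι] [Fintype κ] [DecidableEq κ]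
    {V : Type*} [AddCommGroup V]
    (φ : Equiv.Perm κ → Equiv.Perm ι) (hφ : ∀ τ, Equiv.Perm.sign (φ τ) = Equiv.Perm.sign τ)
    (F : Equiv.Perm ι → V) :
    ∑ σ : Equiv.Perm ι, Equiv.Perm.sign σ • ∑ τ : Equiv.Perm κ, Equiv.Perm.sign τ • F (σ * φ τ) =
      (Fintype.card κ).factorial • ∑ σ : Equiv.Perm ι, Equiv.Perm.sign σ • F σ := by
  simp only [Finset.smul_sum]
  rw [Finset.sum_comm]
  rw [← Fintype.card_perm, ← Finset.card_univ, ← Finset.smul_sum, ← Finset.sum_const]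
  refine Finset.sum_congr rfl fun τ _ => ?_
  -- For fixed τ, the substitution σ ↦ σ · φ τ turns the product of the two signs into the sign of
  -- the new permutation. So all (card κ)! values of τ contribute the same total.
  rw [← Equiv.sum_comp (Equiv.mulRight (φ τ)) (fun σ => Equiv.Perm.sign σ • F σ)]
  refine Finset.sum_congr rfl fun σ _ => ?_
  simp [Equiv.Perm.sign_mul, hφ, smul_smul]

/-- A signed sum over permutations of `Fin (p + 1)`, split by the image of `0`. -/
theorem sum_perm_succ {p : ℕ} {V : Type*} [AddCommGroup V] (F : Equiv.Perm (Fin (p + 1)) → V) :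
    ∑ σ : Equiv.Perm (Fin (p + 1)), F σ = ∑ i : Fin (p + 1), ∑ τ : Equiv.Perm (Fin p),
      F (i.cycleRange.symm * Equiv.Perm.decomposeFin.symm (0, τ)) := by
  suffices h : ∑ x : Fin (p + 1) × Equiv.Perm (Fin p),
      F (x.1.cycleRange.symm * Equiv.Perm.decomposeFin.symm (0, x.2)) =
      ∑ σ : Equiv.Perm (Fin (p + 1)), F σ by
    rw [← h, Fintype.sum_prod_type]
  refine Fintype.sum_bijective (fun x : Fin (p + 1) × Equiv.Perm (Fin p) =>
      x.1.cycleRange.symm * Equiv.Perm.decomposeFin.symm (0, x.2)) ?_ _ _ (fun _ => rfl)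
  -- The index i is recovered as the image of 0, then τ by cancellation; the cardinalities agree
  -- because (p+1) · p! = (p+1)!.
  refine (Fintype.bijective_iff_injective_and_card _).2 ⟨?_, ?_⟩
  · rintro ⟨i, τ⟩ ⟨j, τ'⟩ h
    have h0 : i = j := by
      have := DFunLike.congr_fun h 0
      simpa using this
    subst h0
    have h1 := Equiv.Perm.decomposeFin.symm.injective (mul_left_cancel h)
    exact Prod.ext rfl (Prod.ext_iff.1 h1).2
  · rw [Fintype.card_prod, Fintype.card_perm, Fintype.card_perm, Fintype.card_fin,
      Fintype.card_fin, Nat.factorial_succ]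

theorem decomposeFin_symm_zero_sign {p : ℕ} (τ : Equiv.Perm (Fin p)) :
    Equiv.Perm.sign (Equiv.Perm.decomposeFin.symm ((0 : Fin (p + 1)), τ)) = Equiv.Perm.sign τ := by
  rw [Equiv.Perm.decomposeFin.symm_sign]; simp

/-- Extension of a permutation of `Fin p` to `Fin (p + q)` by the identity on the last `q`. -/
def permExtLeft (p q : ℕ) (τ : Equiv.Perm (Fin p)) : Equiv.Perm (Fin (p + q)) :=
  finSumFinEquiv.permCongr (Equiv.sumCongr τ (Equiv.refl _))

/-- Extension of a permutation of `Fin q` to `Fin (p + q)` by the identity on the first `p`. -/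
def permExtRight (p q : ℕ) (τ : Equiv.Perm (Fin q)) : Equiv.Perm (Fin (p + q)) :=
  finSumFinEquiv.permCongr (Equiv.sumCongr (Equiv.refl _) τ)

theorem permExtLeft_sign {p q : ℕ} (τ : Equiv.Perm (Fin p)) :
    Equiv.Perm.sign (permExtLeft p q τ) = Equiv.Perm.sign τ := by
  rw [permExtLeft, Equiv.Perm.sign_permCongr]
  exact (Equiv.Perm.sign_sumCongr τ 1).trans (by simp)

theorem permExtRight_sign {p q : ℕ} (τ : Equiv.Perm (Fin q)) :
    Equiv.Perm.sign (permExtRight p q τ) = Equiv.Perm.sign τ := by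
  rw [permExtRight, Equiv.Perm.sign_permCongr]
  exact (Equiv.Perm.sign_sumCongr 1 τ).trans (by simp)

@[simp] theorem permExtLeft_castAdd {p q : ℕ} (τ : Equiv.Perm (Fin p)) (i : Fin p) :
    permExtLeft p q τ (Fin.castAdd q i) = Fin.castAdd q (τ i) := by
  simp [permExtLeft, Equiv.permCongr_apply]

@[simp] theorem permExtLeft_natAdd {p q : ℕ} (τ : Equiv.Perm (Fin p)) (i : Fin q) :
    permExtLeft p q τ (Fin.natAdd p i) = Fin.natAdd p i := by
  simp [permExtLeft, Equiv.permCongr_apply]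

@[simp] theorem permExtRight_castAdd {p q : ℕ} (τ : Equiv.Perm (Fin q)) (i : Fin p) :
    permExtRight p q τ (Fin.castAdd q i) = Fin.castAdd q i := by
  simp [permExtRight, Equiv.permCongr_apply]

@[simp] theorem permExtRight_natAdd {p q : ℕ} (τ : Equiv.Perm (Fin q)) (i : Fin q) :
    permExtRight p q τ (Fin.natAdd p i) = Fin.natAdd p (τ i) := by
  simp [permExtRight, Equiv.permCongr_apply]

end PermSums

/-! ### The wedge product as a continuous bilinear map. -/

section Wedge

variable {E : Type*} [NormedAddCommGroup E] [NormedSpace ℂ E]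
  {F : Type*} [NormedAddCommGroup F] [NormedSpace ℂ F]

theorem wedge_apply {p q : ℕ} (α : E [⋀^Fin p]→L[ℝ] ℂ) (β : E [⋀^Fin q]→L[ℝ] ℂ)
    (v : Fin (p + q) → E) : wedge α β v = ((p.factorial * q.factorial : ℝ)⁻¹) •
      ∑ σ : Equiv.Perm (Fin (p + q)), Equiv.Perm.sign σ •
        (α (fun i => v (σ (Fin.castAdd q i))) * β (fun i => v (σ (Fin.natAdd p i)))) := by
  rw [wedge, ContinuousAlternatingMap.smul_apply,
    ContinuousMultilinearMap.alternatization_apply_apply]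
  rfl

theorem wedge_compContinuousLinearMap {p q : ℕ} (α : E [⋀^Fin p]→L[ℝ] ℂ)
    (β : E [⋀^Fin q]→L[ℝ] ℂ) (f : F →L[ℝ] E) :
    (wedge α β).compContinuousLinearMap f =
      wedge (α.compContinuousLinearMap f) (β.compContinuousLinearMap f) := by
  ext v
  simp only [ContinuousAlternatingMap.compContinuousLinearMap_apply, wedge_apply]
  rfl

theorem wedgePow_compContinuousLinearMap (γ : E [⋀^Fin 2]→L[ℝ] ℂ) (f : F →L[ℝ] E) (N : ℕ) :
    (wedgePow γ N).compContinuousLinearMap f = wedgePow (γ.compContinuousLinearMap f) N := by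
  induction N with
  | zero => ext v; rfl
  | succ N ih => rw [wedgePow, wedgePow, ← ih]; exact wedge_compContinuousLinearMap _ _ _

@[simp] theorem castDegree_apply {p q : ℕ} (h : p = q) (α : E [⋀^Fin p]→L[ℝ] ℂ) (v : Fin q → E) :
    castDegree h α v = α (fun i => v (Fin.cast h i)) := rfl

/-- A crude bound, in which each of the (p+q)! permutations contributes at most ‖α‖‖β‖. It serves to
make the wedge product continuous bilinear, so that it can be differentiated. -/
theorem norm_wedge_le {p q : ℕ} (α : E [⋀^Fin p]→L[ℝ] ℂ) (β : E [⋀^Fin q]→L[ℝ] ℂ) :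
    ‖wedge α β‖ ≤ ((p.factorial * q.factorial : ℝ)⁻¹ * (p + q).factorial) * ‖α‖ * ‖β‖ := by
  refine ContinuousAlternatingMap.opNorm_le_bound _ (by positivity) fun v => ?_
  rw [wedge_apply, norm_smul, Real.norm_of_nonneg (by positivity)]
  have : ‖∑ σ : Equiv.Perm (Fin (p + q)), Equiv.Perm.sign σ •
        (α (fun i => v (σ (Fin.castAdd q i))) * β (fun i => v (σ (Fin.natAdd p i))))‖ ≤
      ∑ σ : Equiv.Perm (Fin (p + q)), ‖α‖ * ‖β‖ * ∏ i, ‖v i‖ := by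
    refine norm_sum_le_of_le _ fun σ _ => ?_
    have h1 : ‖Equiv.Perm.sign σ •
        (α (fun i => v (σ (Fin.castAdd q i))) * β (fun i => v (σ (Fin.natAdd p i))))‖ =
        ‖α (fun i => v (σ (Fin.castAdd q i)))‖ * ‖β (fun i => v (σ (Fin.natAdd p i)))‖ := by
      rw [← norm_mul]
      rcases Int.units_eq_one_or (Equiv.Perm.sign σ) with h | h <;> simp [h]
    rw [h1, ← Equiv.prod_comp σ, Fin.prod_univ_add]
    calc _ ≤ (‖α‖ * ∏ i, ‖v (σ (Fin.castAdd q i))‖) * (‖β‖ * ∏ i, ‖v (σ (Fin.natAdd p i))‖) :=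
          mul_le_mul (α.le_opNorm _) (β.le_opNorm _) (norm_nonneg _) (by positivity)
      _ = _ := by ring
  rw [Finset.sum_const, Finset.card_univ, Fintype.card_perm, Fintype.card_fin, nsmul_eq_mul] at this
  calc _ ≤ (p.factorial * q.factorial : ℝ)⁻¹ *
        ((p + q).factorial * (‖α‖ * ‖β‖ * ∏ i, ‖v i‖)) := by gcongr
    _ = _ := by ring

/-- The wedge product as a continuous bilinear map. -/
def wedgeL (p q : ℕ) : (E [⋀^Fin p]→L[ℝ] ℂ) →L[ℝ] (E [⋀^Fin q]→L[ℝ] ℂ) →L[ℝ]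
    E [⋀^Fin (p + q)]→L[ℝ] ℂ :=
  LinearMap.mkContinuous₂
    (LinearMap.mk₂ ℝ wedge
      (fun a b c => by
        ext v
        simp only [wedge_apply, ContinuousAlternatingMap.add_apply, add_mul, smul_add,
          Finset.sum_add_distrib])
      (fun r a b => by
        ext v
        simp only [wedge_apply, ContinuousAlternatingMap.smul_apply, Finset.smul_sum]
        refine Finset.sum_congr rfl fun σ _ => ?_
        rw [smul_mul_assoc, smul_comm r, smul_comm r])
      (fun a b c => by
        ext v
        simp only [wedge_apply, ContinuousAlternatingMap.add_apply, mul_add, smul_add,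
          Finset.sum_add_distrib])
      (fun r a b => by
        ext v
        simp only [wedge_apply, ContinuousAlternatingMap.smul_apply, Finset.smul_sum]
        refine Finset.sum_congr rfl fun σ _ => ?_
        rw [mul_smul_comm, smul_comm r, smul_comm r]))
    ((p.factorial * q.factorial : ℝ)⁻¹ * (p + q).factorial) (fun α β => norm_wedge_le α β)

@[simp] theorem wedgeL_apply {p q : ℕ} (α : E [⋀^Fin p]→L[ℝ] ℂ) (β : E [⋀^Fin q]→L[ℝ] ℂ) :
    wedgeL p q α β = wedge α β := rfl

theorem wedge_sub_left {p q : ℕ} (α α' : E [⋀^Fin p]→L[ℝ] ℂ) (β : E [⋀^Fin q]→L[ℝ] ℂ) :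
    wedge (α - α') β = wedge α β - wedge α' β := by simp [← wedgeL_apply]

theorem wedge_sub_right {p q : ℕ} (α : E [⋀^Fin p]→L[ℝ] ℂ) (β β' : E [⋀^Fin q]→L[ℝ] ℂ) :
    wedge α (β - β') = wedge α β - wedge α β' := by simp [← wedgeL_apply]

open ContinuousAlternatingMap in
/-- `alternatizeUncurryFin` as a signed sum over permutations. -/
theorem factorial_smul_alternatizeUncurryFin {p : ℕ} (A : E →L[ℝ] E [⋀^Fin p]→L[ℝ] ℂ)
    (v : Fin (p + 1) → E) :
    ∑ σ : Equiv.Perm (Fin (p + 1)), Equiv.Perm.sign σ • A (v (σ 0)) (fun i => v (σ i.succ)) =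
      p.factorial • alternatizeUncurryFin A v := by
  -- Sort the permutations by i = σ 0. The cycle `i.cycleRange.symm` sends 0 to i, keeps the order
  -- of the other indices and has sign (-1)^i; the remaining p! permutations τ all contribute
  -- equally by antisymmetry of `A (v i)`.
  rw [sum_perm_succ, alternatizeUncurryFin_apply, Finset.smul_sum]
  refine Finset.sum_congr rfl fun i _ => ?_
  have h : ∀ τ : Equiv.Perm (Fin p),
      Equiv.Perm.sign (i.cycleRange.symm * Equiv.Perm.decomposeFin.symm (0, τ)) •
        A (v ((i.cycleRange.symm * Equiv.Perm.decomposeFin.symm (0, τ)) 0))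
          (fun j => v ((i.cycleRange.symm * Equiv.Perm.decomposeFin.symm (0, τ)) j.succ)) =
      (-1) ^ (i : ℕ) • A (v i) (i.removeNth v) := by
    intro τ
    have h2 : (fun j => v ((i.cycleRange.symm * Equiv.Perm.decomposeFin.symm (0, τ)) j.succ)) =
        (i.removeNth v) ∘ τ := by
      funext j
      simp [Fin.removeNth]
    have h3 : A (v i) ((i.removeNth v) ∘ τ) = Equiv.Perm.sign τ • A (v i) (i.removeNth v) :=
      (A (v i)).toAlternatingMap.map_perm _ _
    rw [h2, Equiv.Perm.sign_mul, decomposeFin_symm_zero_sign, Equiv.Perm.sign_symm,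
      Fin.sign_cycleRange]
    simp only [Equiv.Perm.mul_apply, Equiv.Perm.decomposeFin_symm_apply_zero,
      Fin.cycleRange_symm_zero]
    rw [h3, smul_smul, mul_assoc, Int.units_mul_self, mul_one]
    rcases Nat.even_or_odd (i : ℕ) with hi | hi <;> simp [hi.neg_one_pow]
  rw [Finset.sum_congr rfl fun τ _ => h τ]
  simp [Finset.card_univ, Fintype.card_perm]

end Wedge
-- The Leibniz rule.
section Leibniz

variable {E : Type*} [NormedAddCommGroup E] [NormedSpace ℂ E]

open ContinuousAlternatingMap

/-- Exterior differentiation of the right factor of a wedge product, on the level of algebra. -/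
theorem alternatizeUncurryFin_wedge_right {p q : ℕ} (α : E [⋀^Fin p]→L[ℝ] ℂ)
    (B : E →L[ℝ] E [⋀^Fin q]→L[ℝ] ℂ) :
    alternatizeUncurryFin ((wedgeL p q α).comp B) =
      ((-1 : ℝ) ^ p) • wedge (q := q + 1) α (alternatizeUncurryFin B) := by
  ext v
  -- Up to factorials both sides become one signed sum over the permutations of p+q+1 letters: on
  -- the left the inner sum of the wedge is absorbed, on the right the inner sum of the
  -- alternatization of `B`. Only the position of the differentiating vector differs.
  have hL := factorial_smul_alternatizeUncurryFin ((wedgeL p q α).comp B) v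
  simp only [ContinuousLinearMap.comp_apply, wedgeL_apply, wedge_apply] at hL
  simp only [smul_comm _ ((p.factorial * q.factorial : ℝ)⁻¹), ← Finset.smul_sum] at hL
  have h1 := sum_sign_sum_sign (fun τ : Equiv.Perm (Fin (p + q)) =>
      Equiv.Perm.decomposeFin.symm ((0 : Fin (p + q + 1)), τ)) decomposeFin_symm_zero_sign
      (fun σ => α (fun i => v (σ (Fin.castAdd q i).succ)) *
        B (v (σ 0)) (fun i => v (σ (Fin.natAdd p i).succ)))
  simp only [Equiv.Perm.mul_apply, Equiv.Perm.decomposeFin_symm_apply_zero,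
    Equiv.Perm.decomposeFin_symm_apply_succ, Equiv.swap_self, Equiv.refl_apply] at h1
  rw [h1] at hL
  have hR := wedge_apply α (alternatizeUncurryFin B) v
  have h2 := sum_sign_sum_sign (permExtRight p (q + 1)) permExtRight_sign
      (fun σ => α (fun i => v (σ (Fin.castAdd (q + 1) i))) *
        B (v (σ (Fin.natAdd p 0))) (fun i => v (σ (Fin.natAdd p i.succ))))
  have h3 : ∀ σ : Equiv.Perm (Fin (p + (q + 1))), (q.factorial : ℂ) *
      (alternatizeUncurryFin B (fun i => v (σ (Fin.natAdd p i)))) =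
      ∑ τ : Equiv.Perm (Fin (q + 1)), Equiv.Perm.sign τ •
        B (v (σ (Fin.natAdd p (τ 0)))) (fun i => v (σ (Fin.natAdd p (τ i.succ)))) := by
    intro σ
    have := factorial_smul_alternatizeUncurryFin B (fun i => v (σ (Fin.natAdd p i)))
    rw [nsmul_eq_mul] at this
    exact this.symm
  simp only [Equiv.Perm.mul_apply, permExtRight_castAdd, permExtRight_natAdd] at h2
  have h4 : ∀ σ : Equiv.Perm (Fin (p + (q + 1))), ∑ τ : Equiv.Perm (Fin (q + 1)),
      Equiv.Perm.sign τ • (α (fun i => v (σ (Fin.castAdd (q + 1) i))) *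
        B (v (σ (Fin.natAdd p (τ 0)))) (fun i => v (σ (Fin.natAdd p (τ i.succ))))) =
      (q.factorial : ℂ) * (α (fun i => v (σ (Fin.castAdd (q + 1) i))) *
        (alternatizeUncurryFin B (fun i => v (σ (Fin.natAdd p i))))) := by
    intro σ
    rw [mul_left_comm, h3, Finset.mul_sum]
    exact Finset.sum_congr rfl fun τ _ => (mul_smul_comm _ _ _).symm
  simp only [h4] at h2
  have h5 : ∑ σ : Equiv.Perm (Fin (p + q + 1)), Equiv.Perm.sign σ •
      (α (fun i => v (σ (Fin.castAdd q i).succ)) *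
        B (v (σ 0)) (fun i => v (σ (Fin.natAdd p i).succ))) =
      ((-1 : ℝ) ^ p) • ∑ σ : Equiv.Perm (Fin (p + (q + 1))), Equiv.Perm.sign σ •
      (α (fun i => v (σ (Fin.castAdd (q + 1) i))) *
        B (v (σ (Fin.natAdd p 0))) (fun i => v (σ (Fin.natAdd p i.succ)))) := by
    -- The differentiating vector comes first on the left and behind the p arguments of α on the
    -- right. The cycle ρ relating the two orders has sign (-1)^p.
    set ρ : Equiv.Perm (Fin (p + q + 1)) := (Fin.natAdd p (0 : Fin (q + 1))).cycleRange.symm with hρ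
    rw [← Equiv.sum_comp (Equiv.mulRight ρ), Finset.smul_sum]
    refine Finset.sum_congr rfl fun σ _ => ?_
    have hs : Equiv.Perm.sign ρ = (-1) ^ p := by
      rw [hρ, Equiv.Perm.sign_symm, Fin.sign_cycleRange]; simp
    have e0 : ρ 0 = Fin.natAdd p (0 : Fin (q + 1)) := Fin.cycleRange_symm_zero _
    have e1 : ∀ i : Fin p, ρ (Fin.castAdd q i).succ = Fin.castAdd (q + 1) i := fun i => by
      refine (Fin.cycleRange_symm_succ _ _).trans ?_
      rw [Fin.succAbove_of_castSucc_lt]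
      · rfl
      · simp [Fin.lt_def]
    have e2 : ∀ i : Fin q, ρ (Fin.natAdd p i).succ = Fin.natAdd p i.succ := fun i => by
      refine (Fin.cycleRange_symm_succ _ _).trans ?_
      rw [Fin.succAbove_of_le_castSucc]
      · rfl
      · simp [Fin.le_def]
    simp only [Equiv.coe_mulRight, Equiv.Perm.mul_apply, Equiv.Perm.sign_mul, hs, e0, e1, e2]
    rcases Nat.even_or_odd p with hi | hi <;> simp [hi.neg_one_pow]
  rw [h5] at hL
  rw [ContinuousAlternatingMap.smul_apply, hR]
  set S := ∑ σ : Equiv.Perm (Fin (p + (q + 1))), Equiv.Perm.sign σ •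
      (α (fun i => v (σ (Fin.castAdd (q + 1) i))) *
        B (v (σ (Fin.natAdd p 0))) (fun i => v (σ (Fin.natAdd p i.succ))))
  set T := ∑ σ : Equiv.Perm (Fin (p + (q + 1))), Equiv.Perm.sign σ •
      (α (fun i => v (σ (Fin.castAdd (q + 1) i))) *
        (alternatizeUncurryFin B) (fun i => v (σ (Fin.natAdd p i)))) with hT
  have h6 : (q.factorial : ℂ) * T = ((q + 1).factorial : ℂ) * S := by
    rw [Fintype.card_fin] at h2
    rw [hT, Finset.mul_sum, ← nsmul_eq_mul, ← h2]
    exact Finset.sum_congr rfl fun τ _ => (mul_smul_comm _ _ _)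
  have hpq : ((p + q).factorial : ℂ) ≠ 0 := by exact_mod_cast Nat.factorial_ne_zero _
  have hq : (q.factorial : ℂ) ≠ 0 := by exact_mod_cast Nat.factorial_ne_zero _
  have hq1 : ((q + 1).factorial : ℂ) ≠ 0 := by exact_mod_cast Nat.factorial_ne_zero _
  have hp : (p.factorial : ℂ) ≠ 0 := by exact_mod_cast Nat.factorial_ne_zero _
  rw [Fintype.card_fin] at hL
  simp only [nsmul_eq_mul, Complex.real_smul] at hL ⊢
  apply mul_left_cancel₀ hpq
  rw [← hL]
  push_cast
  have h7 : T = ((q + 1).factorial : ℂ) * S / q.factorial := by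
    rw [← h6]; field_simp
  rw [h7]
  field_simp

/-- Exterior differentiation of the left factor of a wedge product, on the level of algebra. -/
theorem alternatizeUncurryFin_wedge_left {p q : ℕ} (h : p + 1 + q = p + q + 1)
    (A : E →L[ℝ] E [⋀^Fin p]→L[ℝ] ℂ) (β : E [⋀^Fin q]→L[ℝ] ℂ) :
    alternatizeUncurryFin (((wedgeL p q).flip β).comp A) =
      castDegree h (wedge (alternatizeUncurryFin A) β) := by
  ext v
  have hL := factorial_smul_alternatizeUncurryFin (((wedgeL p q).flip β).comp A) v
  simp only [ContinuousLinearMap.comp_apply, ContinuousLinearMap.flip_apply, wedgeL_apply,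
    wedge_apply] at hL
  simp only [smul_comm _ ((p.factorial * q.factorial : ℝ)⁻¹), ← Finset.smul_sum] at hL
  have h1 := sum_sign_sum_sign (fun τ : Equiv.Perm (Fin (p + q)) =>
      Equiv.Perm.decomposeFin.symm ((0 : Fin (p + q + 1)), τ)) decomposeFin_symm_zero_sign
      (fun σ => A (v (σ 0)) (fun i => v (σ (Fin.castAdd q i).succ)) *
        β (fun i => v (σ (Fin.natAdd p i).succ)))
  simp only [Equiv.Perm.mul_apply, Equiv.Perm.decomposeFin_symm_apply_zero,
    Equiv.Perm.decomposeFin_symm_apply_succ, Equiv.swap_self, Equiv.refl_apply] at h1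
  rw [h1] at hL
  set w : Fin (p + 1 + q) → E := fun i => v (Fin.cast h i) with hw
  have hR := wedge_apply (alternatizeUncurryFin A) β w
  have h2 := sum_sign_sum_sign (permExtLeft (p + 1) q) permExtLeft_sign
      (fun σ => A (w (σ (Fin.castAdd q 0))) (fun i => w (σ (Fin.castAdd q i.succ))) *
        β (fun i => w (σ (Fin.natAdd (p + 1) i))))
  have h3 : ∀ σ : Equiv.Perm (Fin (p + 1 + q)), (p.factorial : ℂ) *
      (alternatizeUncurryFin A (fun i => w (σ (Fin.castAdd q i)))) =
      ∑ τ : Equiv.Perm (Fin (p + 1)), Equiv.Perm.sign τ •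
        A (w (σ (Fin.castAdd q (τ 0)))) (fun i => w (σ (Fin.castAdd q (τ i.succ)))) := by
    intro σ
    have := factorial_smul_alternatizeUncurryFin A (fun i => w (σ (Fin.castAdd q i)))
    rw [nsmul_eq_mul] at this
    exact this.symm
  simp only [Equiv.Perm.mul_apply, permExtLeft_castAdd, permExtLeft_natAdd] at h2
  have h4 : ∀ σ : Equiv.Perm (Fin (p + 1 + q)), ∑ τ : Equiv.Perm (Fin (p + 1)),
      Equiv.Perm.sign τ • (A (w (σ (Fin.castAdd q (τ 0))))
        (fun i => w (σ (Fin.castAdd q (τ i.succ)))) *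
          β (fun i => w (σ (Fin.natAdd (p + 1) i)))) =
      (p.factorial : ℂ) * ((alternatizeUncurryFin A (fun i => w (σ (Fin.castAdd q i)))) *
        β (fun i => w (σ (Fin.natAdd (p + 1) i)))) := by
    intro σ
    rw [← mul_assoc, h3, Finset.sum_mul]
    exact Finset.sum_congr rfl fun τ _ => (smul_mul_assoc _ _ _).symm
  simp only [h4] at h2
  have h5 : ∑ σ : Equiv.Perm (Fin (p + q + 1)), Equiv.Perm.sign σ •
      (A (v (σ 0)) (fun i => v (σ (Fin.castAdd q i).succ)) *
        β (fun i => v (σ (Fin.natAdd p i).succ))) =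
      ∑ σ : Equiv.Perm (Fin (p + 1 + q)), Equiv.Perm.sign σ •
      (A (w (σ (Fin.castAdd q 0))) (fun i => w (σ (Fin.castAdd q i.succ))) *
        β (fun i => w (σ (Fin.natAdd (p + 1) i)))) := by
    -- Here the differentiating vector is first on both sides: the index type is merely relabelled
    -- and no sign arises.
    rw [← Equiv.sum_comp (finCongr h).permCongr]
    refine Finset.sum_congr rfl fun σ _ => ?_
    rw [Equiv.Perm.sign_permCongr]
    have e0 : (finCongr h).symm 0 = Fin.castAdd q (0 : Fin (p + 1)) := by ext; simp
    have e1 : ∀ i : Fin p, (finCongr h).symm (Fin.castAdd q i).succ = Fin.castAdd q i.succ :=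
      fun i => by ext; simp
    have e2 : ∀ i : Fin q, (finCongr h).symm (Fin.natAdd p i).succ = Fin.natAdd (p + 1) i :=
      fun i => by ext; simp; omega
    simp only [Equiv.permCongr_apply, e0, e1, e2]
    rfl
  rw [h5] at hL
  rw [castDegree_apply, hR]
  set S := ∑ σ : Equiv.Perm (Fin (p + 1 + q)), Equiv.Perm.sign σ •
      (A (w (σ (Fin.castAdd q 0))) (fun i => w (σ (Fin.castAdd q i.succ))) *
        β (fun i => w (σ (Fin.natAdd (p + 1) i))))
  set T := ∑ σ : Equiv.Perm (Fin (p + 1 + q)), Equiv.Perm.sign σ •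
      ((alternatizeUncurryFin A) (fun i => w (σ (Fin.castAdd q i))) *
        β (fun i => w (σ (Fin.natAdd (p + 1) i)))) with hT
  have h6 : (p.factorial : ℂ) * T = ((p + 1).factorial : ℂ) * S := by
    rw [Fintype.card_fin] at h2
    rw [hT, Finset.mul_sum, ← nsmul_eq_mul, ← h2]
    exact Finset.sum_congr rfl fun τ _ => (mul_smul_comm _ _ _)
  have hpq : ((p + q).factorial : ℂ) ≠ 0 := by exact_mod_cast Nat.factorial_ne_zero _
  have hq : (q.factorial : ℂ) ≠ 0 := by exact_mod_cast Nat.factorial_ne_zero _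
  have hp1 : ((p + 1).factorial : ℂ) ≠ 0 := by exact_mod_cast Nat.factorial_ne_zero _
  have hp : (p.factorial : ℂ) ≠ 0 := by exact_mod_cast Nat.factorial_ne_zero _
  rw [Fintype.card_fin] at hL
  simp only [nsmul_eq_mul, Complex.real_smul] at hL ⊢
  apply mul_left_cancel₀ hpq
  rw [← hL]
  push_cast
  have h7 : T = ((p + 1).factorial : ℂ) * S / p.factorial := by
    rw [← h6]; field_simp
  rw [h7]
  field_simp

/-- The Leibniz rule for the wedge product. -/
theorem extDeriv_wedge {p q : ℕ} (h : p + 1 + q = p + q + 1) {a : E → E [⋀^Fin p]→L[ℝ] ℂ}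
    {b : E → E [⋀^Fin q]→L[ℝ] ℂ} {x : E} (ha : DifferentiableAt ℝ a x)
    (hb : DifferentiableAt ℝ b x) :
    extDeriv (fun y => wedge (a y) (b y)) x =
      castDegree h (wedge (extDeriv a x) (b x)) +
        ((-1 : ℝ) ^ p) • wedge (q := q + 1) (a x) (extDeriv b x) := by
  have hd := (wedgeL (E := E) p q).hasFDerivAt_of_bilinear ha.hasFDerivAt hb.hasFDerivAt
  rw [extDeriv, show fderiv ℝ (fun y => wedge (a y) (b y)) x = _ from hd.fderiv, extDeriv, extDeriv,
    ← alternatizeUncurryFin_wedge_right, ← alternatizeUncurryFin_wedge_left,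
    alternatizeUncurryFin_add]
  exact add_comm _ _

end Leibniz

/-! ### Powers of 2-forms as sums over pairings. -/

section Pairs

/-- The enumeration `(i, j) ↦ 2 i + j` of `Fin N × Fin 2` by `Fin (2 N)`. -/
def pairIdx (N : ℕ) : Fin N × Fin 2 ≃ Fin (2 * N) :=
  finProdFinEquiv.trans (finCongr (mul_comm N 2))

@[simp] theorem pairIdx_val {N : ℕ} (x : Fin N × Fin 2) :
    (pairIdx N x : ℕ) = x.2.1 + 2 * x.1.1 := rfl

variable {E : Type*} [NormedAddCommGroup E] [NormedSpace ℂ E]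
  {F : Type*} [NormedAddCommGroup F] [NormedSpace ℂ F]

/-- The tuple `u₁, √-1 u₁, …, u_N, √-1 u_N`. -/
def pairFrame {N : ℕ} (u : Fin N → E) (j : Fin (2 * N)) : E :=
  (if j.1 % 2 = 0 then (1 : ℂ) else Complex.I) • u ⟨j.1 / 2, by omega⟩

theorem pairFrame_pairIdx {N : ℕ} (u : Fin N → E) (i : Fin N) (j : Fin 2) :
    pairFrame u (pairIdx N (i, j)) = (![1, Complex.I] j) • u i := by
  have h1 : ((pairIdx N (i, j) : Fin (2 * N)) : ℕ) / 2 = i := by simp; omega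
  have h2 : ((pairIdx N (i, j) : Fin (2 * N)) : ℕ) % 2 = j := by simp; omega
  rw [pairFrame]
  simp only [h1, h2]
  fin_cases j <;> simp

theorem pairFrame_map {N : ℕ} (f : E →L[ℂ] F) (u : Fin N → E) (j : Fin (2 * N)) :
    pairFrame (fun i => f (u i)) j = f (pairFrame u j) := by
  simp only [pairFrame, map_smul]

theorem verticalFrame_eq (B : Type*) [NormedAddCommGroup B] [NormedSpace ℂ B] (n : ℕ)
    (j : Fin (2 * n)) : verticalFrame B n j =
      ContinuousLinearMap.inr ℂ B (Fin n → ℂ) (pairFrame (fun i => Pi.single i (1 : ℂ)) j) := by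
  rw [verticalFrame, pairFrame]
  refine Prod.ext (by simp) ?_
  simp only [ContinuousLinearMap.inr_apply]
  rw [← Pi.single_smul']
  simp

/-- Closed formula for the wedge powers of a 2-form. -/
theorem wedgePow_apply (γ : E [⋀^Fin 2]→L[ℝ] ℂ) (N : ℕ) (x : Fin (2 * N) → E) :
    wedgePow γ N x = ((2 : ℂ) ^ N)⁻¹ * ∑ σ : Equiv.Perm (Fin (2 * N)), Equiv.Perm.sign σ •
      ∏ i : Fin N, γ (fun j => x (σ (pairIdx N (i, j)))) := by
  induction N with
  | zero =>
    have : Subsingleton (Equiv.Perm (Fin (2 * 0))) := by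
      rw [mul_zero]; infer_instance
    rw [Fintype.sum_subsingleton _ 1]
    simp [wedgePow]
  | succ N ih =>
    rw [wedgePow]
    refine (wedge_apply (p := 2 * N) (q := 2) (wedgePow γ N) γ x).trans ?_
    -- The inner sum from the induction hypothesis is absorbed at the price of (2N)!, which cancels
    -- against the normalisation of the wedge; the 2! of the last factor supplies the new power of
    -- 2.
    have h1 := sum_sign_sum_sign (permExtLeft (2 * N) 2) permExtLeft_sign
      (fun σ => (∏ i : Fin N, γ (fun j => x (σ (Fin.castAdd 2 (pairIdx N (i, j)))))) *
        γ (fun j => x (σ (Fin.natAdd (2 * N) j))))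
    simp only [Equiv.Perm.mul_apply, permExtLeft_castAdd, permExtLeft_natAdd] at h1
    have h2 : ∀ σ : Equiv.Perm (Fin (2 * N + 2)),
        wedgePow γ N (fun i => x (σ (Fin.castAdd 2 i))) * γ (fun i => x (σ (Fin.natAdd (2 * N) i)))
        = ((2 : ℂ) ^ N)⁻¹ * ∑ τ : Equiv.Perm (Fin (2 * N)), Equiv.Perm.sign τ •
          ((∏ i : Fin N, γ (fun j => x (σ (Fin.castAdd 2 (τ (pairIdx N (i, j))))))) *
        γ (fun j => x (σ (Fin.natAdd (2 * N) j)))) := by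
      intro σ
      rw [ih, mul_assoc, Finset.sum_mul]
      congr 1
      exact Finset.sum_congr rfl fun τ _ => smul_mul_assoc _ _ _
    have h2' : ∑ σ : Equiv.Perm (Fin (2 * N + 2)), Equiv.Perm.sign σ •
        (wedgePow γ N (fun i => x (σ (Fin.castAdd 2 i))) *
          γ (fun i => x (σ (Fin.natAdd (2 * N) i)))) = ((2 : ℂ) ^ N)⁻¹ *
        ∑ σ : Equiv.Perm (Fin (2 * N + 2)), Equiv.Perm.sign σ •
          ∑ τ : Equiv.Perm (Fin (2 * N)), Equiv.Perm.sign τ •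
          ((∏ i : Fin N, γ (fun j => x (σ (Fin.castAdd 2 (τ (pairIdx N (i, j))))))) *
        γ (fun j => x (σ (Fin.natAdd (2 * N) j)))) := by
      rw [Finset.mul_sum]
      refine Finset.sum_congr rfl fun σ _ => ?_
      rw [h2 σ]
      exact (mul_smul_comm _ _ _).symm
    rw [h2', h1]
    have h3 : ∀ σ : Equiv.Perm (Fin (2 * (N + 1))),
        ∏ i : Fin (N + 1), γ (fun j => x (σ (pairIdx (N + 1) (i, j)))) =
        (∏ i : Fin N, γ (fun j => x (σ (Fin.castAdd 2 (pairIdx N (i, j)))))) *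
        γ (fun j => x (σ (Fin.natAdd (2 * N) j))) := by
      intro σ
      rw [Fin.prod_univ_castSucc]
      congr 1
      congr 1
      funext j
      congr 2
      ext
      simp [add_comm]
    simp only [h3]
    rw [Fintype.card_fin, Complex.real_smul, nsmul_eq_mul]
    have hN : ((2 * N).factorial : ℂ) ≠ 0 := by exact_mod_cast Nat.factorial_ne_zero _
    push_cast [Nat.factorial_two]
    rw [pow_succ, mul_inv, mul_inv]
    set S := ∑ σ : Equiv.Perm (Fin (2 * (N + 1))), Equiv.Perm.sign σ •
      ((∏ i : Fin N, γ (fun j => x (σ (Fin.castAdd 2 (pairIdx N (i, j)))))) *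
        γ (fun j => x (σ (Fin.natAdd (2 * N) j))))
    change _ * (_ * (_ * S)) = _
    field_simp

/-- If a 2-form pairs the vectors of a tuple nontrivially only within its consecutive pairs, the
corresponding value of its wedge power is a positive multiple of the product of these pairings. -/
theorem wedgePow_apply_of_orthogonal (γ : E [⋀^Fin 2]→L[ℝ] ℂ) {N : ℕ} (x : Fin N × Fin 2 → E)
    (hx : ∀ a b, a.1 ≠ b.1 → γ ![x a, x b] = 0) :
    ∃ r : ℝ, 0 < r ∧ wedgePow γ N (fun j => x ((pairIdx N).symm j)) =
      r * ∏ i : Fin N, γ (fun j => x (i, j)) := by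
  classical
  rw [wedgePow_apply]
  set c := ∏ i : Fin N, γ (fun j => x (i, j)) with hc
  set T : Equiv.Perm (Fin (2 * N)) → ℂ := fun σ => Equiv.Perm.sign σ •
    ∏ i : Fin N, γ (fun j => x ((pairIdx N).symm (σ (pairIdx N (i, j))))) with hT
  -- A term vanishes unless σ maps every pair onto a pair; the surviving terms will all turn out to
  -- be equal, signs included.
  have key : ∀ σ, T σ = 0 ∨ T σ = c := by
    intro σ
    by_cases h : ∃ i, ((pairIdx N).symm (σ (pairIdx N (i, 0)))).1 ≠
        ((pairIdx N).symm (σ (pairIdx N (i, 1)))).1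
    · left
      obtain ⟨i, hi⟩ := h
      have : γ (fun j => x ((pairIdx N).symm (σ (pairIdx N (i, j))))) = 0 := by
        rw [← hx _ _ hi]
        congr 1
        funext j
        fin_cases j <;> rfl
      simp only [hT]
      rw [Finset.prod_eq_zero (Finset.mem_univ i) this, smul_zero]
    · right
      push Not at h
      set σ' : Equiv.Perm (Fin N × Fin 2) := (pairIdx N).symm.permCongr σ with hσ'
      have hσa : ∀ a, (pairIdx N).symm (σ (pairIdx N a)) = σ' a := fun a => by
        simp [hσ', Equiv.permCongr_apply]
      set τ : Fin N → Fin N := fun i => (σ' (i, 0)).1 with hτ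
      have h1 : ∀ i j, (σ' (i, j)).1 = τ i := by
        intro i j
        fin_cases j
        · rfl
        · simpa [hτ, hσa] using (h i).symm
      have hsurj : Function.Surjective τ := by
        intro i
        obtain ⟨⟨i', j'⟩, h'⟩ := σ'.surjective (i, 0)
        exact ⟨i', by rw [← h1 i' j', h']⟩
      have hbij : Function.Bijective τ := Finite.surjective_iff_bijective.1 hsurj
      have hinj : ∀ i, Function.Injective (fun j => (σ' (i, j)).2) := by
        intro i j j' hj
        have := σ'.injective (Prod.ext ((h1 i j).trans (h1 i j').symm) hj)
        exact (Prod.ext_iff.1 this).2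
      set s : Fin N → Equiv.Perm (Fin 2) := fun i =>
        Equiv.ofBijective _ (Finite.injective_iff_bijective.1 (hinj i)) with hs
      set τ' : Equiv.Perm (Fin N) := Equiv.ofBijective τ hbij with hτ'
      have hfac : σ' = (Equiv.prodCongrLeft (fun _ : Fin 2 => τ')) * (Equiv.prodCongrRight s) := by
        refine Equiv.ext fun a => ?_
        obtain ⟨i, j⟩ := a
        refine Prod.ext (h1 i j) rfl
      -- The permutation τ' of the pairs moves both members of each pair, so its sign enters
      -- squared. Only the flips within pairs remain, and they cancel against the antisymmetry of γ
      -- used in `hval`.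
      have hsign : Equiv.Perm.sign σ = ∏ i, Equiv.Perm.sign (s i) := by
        have e1 : Equiv.Perm.sign σ' = Equiv.Perm.sign σ := Equiv.Perm.sign_permCongr _ _
        rw [← e1, hfac, Equiv.Perm.sign_mul, Equiv.Perm.sign_prodCongrLeft,
          Equiv.Perm.sign_prodCongrRight, Fin.prod_univ_two, Int.units_mul_self, one_mul]
      have hval : ∀ i, γ (fun j => x ((pairIdx N).symm (σ (pairIdx N (i, j))))) =
          Equiv.Perm.sign (s i) • γ (fun j => x (τ' i, j)) := by
        intro i
        refine Eq.trans (congrArg γ (funext fun j => ?_))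
          (γ.toAlternatingMap.map_perm (fun j => x (τ' i, j)) (s i))
        rw [hσa]
        exact congrArg x (Prod.ext (h1 i j) rfl)
      simp only [hT, hval]
      have : ∏ i, Equiv.Perm.sign (s i) • γ (fun j => x (τ' i, j)) =
          (∏ i, Equiv.Perm.sign (s i)) • ∏ i, γ (fun j => x (τ' i, j)) := by
        simp only [Units.smul_def, zsmul_eq_mul, Finset.prod_mul_distrib]
        push_cast
        rfl
      rw [this, hsign, smul_smul, Int.units_mul_self, one_smul,
        Equiv.prod_comp τ' (fun i => γ (fun j => x (i, j)))]
  have hone : T 1 = c := by simp [hT, hc]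
  have hsum : ∑ σ, T σ = ((Finset.univ.filter (fun σ => T σ = c)).card : ℂ) * c := by
    rw [← Finset.sum_filter_add_sum_filter_not Finset.univ (fun σ => T σ = c) T]
    rw [Finset.sum_congr rfl (fun σ hσ => (Finset.mem_filter.1 hσ).2), Finset.sum_const,
      nsmul_eq_mul, Finset.sum_eq_zero, add_zero]
    intro σ hσ
    exact (key σ).resolve_right (Finset.mem_filter.1 hσ).2
  -- The constant counts the permutations whose term is c; the identity is one of them, whence
  -- positivity.
  refine ⟨((2 : ℝ) ^ N)⁻¹ * (Finset.univ.filter (fun σ => T σ = c)).card, ?_, ?_⟩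
  · have : 0 < (Finset.univ.filter (fun σ => T σ = c)).card :=
      Finset.card_pos.2 ⟨1, by simp [hone]⟩
    positivity
  · rw [hsum]; push_cast; ring

end Pairs

/-! ### Determinants and the complex orientation. -/

section Det

/-- The real and imaginary parts of a form of top degree are real multiples of the determinant of a
basis. -/
theorem alternating_apply_comp_det {V : Type*} [AddCommGroup V] [Module ℝ V] {ι : Type*}
    [Fintype ι] [DecidableEq ι] (e : Module.Basis ι ℝ V) (ψ : V [⋀^ι]→ₗ[ℝ] ℂ) (g : V →ₗ[ℝ] V)
    (v : ι → V) : ψ (fun i => g (v i)) = ((LinearMap.det g : ℝ) : ℂ) * ψ v := by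
  have key : ∀ f : V [⋀^ι]→ₗ[ℝ] ℝ, f (fun i => g (v i)) = LinearMap.det g * f v := by
    intro f
    rw [f.eq_smul_basis_det e]
    simp only [AlternatingMap.smul_apply, smul_eq_mul]
    have := e.det_comp g v
    rw [show (fun i => g (v i)) = g ∘ v from rfl, this]
    ring
  apply Complex.ext
  · have := key (Complex.reLm.compAlternatingMap ψ)
    simpa using this
  · have := key (Complex.imLm.compAlternatingMap ψ)
    simpa using this

/-- Complex-linear maps preserve orientation: this one factor is both the scaling of top-degree
forms and the Jacobian in the change of variables along the fibres. -/
theorem det_restrictScalars_complex {V : Type*} [AddCommGroup V] [Module ℂ V]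
    [FiniteDimensional ℂ V] (g : V →ₗ[ℂ] V) :
    LinearMap.det (g.restrictScalars ℝ) = Complex.normSq (LinearMap.det g) := by
  rw [LinearMap.det_restrictScalars, Algebra.norm_complex_apply]

/-- The real basis `∂/∂x₁, ∂/∂y₁, …` of `ℂⁿ`. -/
def frameBasis (n : ℕ) : Module.Basis (Fin (2 * n)) ℝ (Fin n → ℂ) :=
  (Pi.basis fun _ : Fin n => Complex.basisOneI).reindex
    ((Equiv.sigmaEquivProd (Fin n) (Fin 2)).trans (pairIdx n))

theorem frameBasis_apply (n : ℕ) (j : Fin (2 * n)) :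
    frameBasis n j = pairFrame (fun i => Pi.single i (1 : ℂ)) j := by
  obtain ⟨⟨i, k⟩, rfl⟩ := (pairIdx n).surjective j
  rw [pairFrame_pairIdx, frameBasis, Module.Basis.reindex_apply]
  simp only [Equiv.symm_trans_apply, Equiv.symm_apply_apply, Equiv.sigmaEquivProd_symm_apply,
    Pi.basis_apply, Complex.coe_basisOneI]
  rw [← Pi.single_smul', smul_eq_mul, mul_one]

theorem exists_orthogonal_basis {V : Type*} [AddCommGroup V] [Module ℂ V] [FiniteDimensional ℂ V]
    (core : InnerProductSpace.Core ℂ V) {N : ℕ} (hN : Module.finrank ℂ V = N) :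
    ∃ b : Module.Basis (Fin N) ℂ V, ∀ i j, i ≠ j → core.inner (b i) (b j) = 0 := by
  let := core.toNormedAddCommGroup
  let : InnerProductSpace ℂ V := InnerProductSpace.ofCore core.toCore
  let b := (stdOrthonormalBasis ℂ V).reindex (finCongr hN)
  refine ⟨b.toBasis, fun i j hij => ?_⟩
  have := b.orthonormal.2 hij
  simpa using this

end Det

/-! ### Positive (1,1)-forms and Hermitian inner products. -/

section Positivity

variable {E : Type*} [NormedAddCommGroup E] [NormedSpace ℂ E]
  {F : Type*} [NormedAddCommGroup F] [NormedSpace ℂ F]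

/-- A 2-form invariant under multiplication by `√-1` in both arguments. -/
def IsJInvariant (γ : E [⋀^Fin 2]→L[ℝ] ℂ) : Prop :=
  ∀ u v : E, γ ![Complex.I • u, Complex.I • v] = γ ![u, v]

/-- `γ (u, √-1 u)` is real and positive for `u ≠ 0`. -/
def IsTamed (γ : E [⋀^Fin 2]→L[ℝ] ℂ) : Prop :=
  ∀ u : E, u ≠ 0 → ∃ r : ℝ, 0 < r ∧ γ ![u, Complex.I • u] = r

theorem form_two_add_left (γ : E [⋀^Fin 2]→L[ℝ] ℂ) (u u' v : E) :
    γ ![u + u', v] = γ ![u, v] + γ ![u', v] := γ.vecCons_add ![v] u u'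

theorem form_two_smul_left (γ : E [⋀^Fin 2]→L[ℝ] ℂ) (c : ℝ) (u v : E) :
    γ ![c • u, v] = c • γ ![u, v] := γ.vecCons_smul ![v] c u

theorem form_two_swap (γ : E [⋀^Fin 2]→L[ℝ] ℂ) (u v : E) : γ ![u, v] = - γ ![v, u] := by
  have := γ.toAlternatingMap.map_swap ![v, u] (show (0 : Fin 2) ≠ 1 by decide)
  rw [← show γ (![v, u] ∘ Equiv.swap 0 1) = - γ ![v, u] from this]
  congr 1
  funext i
  fin_cases i <;> simp

theorem form_two_add_right (γ : E [⋀^Fin 2]→L[ℝ] ℂ) (u v v' : E) :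
    γ ![u, v + v'] = γ ![u, v] + γ ![u, v'] := by
  rw [form_two_swap, form_two_add_left, form_two_swap γ u v, form_two_swap γ u v']; ring

theorem form_two_smul_right (γ : E [⋀^Fin 2]→L[ℝ] ℂ) (c : ℝ) (u v : E) :
    γ ![u, c • v] = c • γ ![u, v] := by
  rw [form_two_swap, form_two_smul_left, form_two_swap γ u v, smul_neg]

theorem form_two_neg_right (γ : E [⋀^Fin 2]→L[ℝ] ℂ) (u v : E) :
    γ ![u, -v] = - γ ![u, v] := by
  have := form_two_smul_right γ (-1) u v
  simpa using this

theorem form_two_self (γ : E [⋀^Fin 2]→L[ℝ] ℂ) (u : E) : γ ![u, u] = 0 :=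
  γ.map_eq_zero_of_eq ![u, u] (i := 0) (j := 1) rfl (by decide)

theorem IsJInvariant.apply_I_right_comm {γ : E [⋀^Fin 2]→L[ℝ] ℂ} (hJ : IsJInvariant γ) (u v : E) :
    γ ![u, Complex.I • v] = γ ![v, Complex.I • u] := by
  rw [← hJ u (Complex.I • v), smul_smul, Complex.I_mul_I, neg_one_smul, form_two_neg_right,
    form_two_swap, neg_neg]

/-- By invariance γ(x, Jy) is symmetric in x and y, so polarising the real numbers γ(w, Jw) shows
that it is real; and every vector has the form Jy. -/
theorem IsTamed.apply_im {γ : E [⋀^Fin 2]→L[ℝ] ℂ} (hJ : IsJInvariant γ) (ht : IsTamed γ)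
    (u v : E) : (γ ![u, v]).im = 0 := by
  have h0 : ∀ w : E, (γ ![w, Complex.I • w]).im = 0 := by
    intro w
    by_cases hw : w = 0
    · subst hw
      rw [smul_zero, form_two_self]; simp
    · obtain ⟨r, _, hr⟩ := ht w hw
      rw [hr, Complex.ofReal_im]
  have h1 : ∀ x y : E, (γ ![x, Complex.I • y]).im = 0 := by
    intro x y
    have h := h0 (x + y)
    rw [smul_add, form_two_add_left, form_two_add_right, form_two_add_right,
      hJ.apply_I_right_comm y x] at h
    simp only [Complex.add_im, h0] at h
    linarith
  have h2 := h1 u (-(Complex.I • v))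
  rwa [smul_neg, smul_smul, Complex.I_mul_I, neg_one_smul, neg_neg] at h2

theorem IsJInvariant.comp {γ : E [⋀^Fin 2]→L[ℝ] ℂ} (hJ : IsJInvariant γ) (f : F →L[ℝ] E)
    (hf : ∀ u, f (Complex.I • u) = Complex.I • f u) :
    IsJInvariant (γ.compContinuousLinearMap f) := by
  intro u v
  have h : ∀ a b : F, (γ.compContinuousLinearMap f) ![a, b] = γ ![f a, f b] := by
    intro a b
    rw [ContinuousAlternatingMap.compContinuousLinearMap_apply]
    congr 1
    funext i
    fin_cases i <;> rfl
  rw [h, h, hf, hf, hJ]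

theorem IsTamed.comp {γ : E [⋀^Fin 2]→L[ℝ] ℂ} (ht : IsTamed γ) (f : F →L[ℝ] E)
    (hf : ∀ u, f (Complex.I • u) = Complex.I • f u) (hinj : Function.Injective f) :
    IsTamed (γ.compContinuousLinearMap f) := by
  intro u hu
  obtain ⟨r, hr, h⟩ := ht (f u) (fun h => hu (hinj (by rw [h, map_zero])))
  refine ⟨r, hr, ?_⟩
  rw [← h, ContinuousAlternatingMap.compContinuousLinearMap_apply]
  congr 1
  funext i
  fin_cases i
  · rfl
  · exact hf u

theorem smul_eq_re_add_im (c : ℂ) (x : E) : c • x = c.re • x + c.im • (Complex.I • x) := by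
  conv_lhs => rw [← Complex.re_add_im c]
  rw [add_smul, mul_smul, Complex.coe_smul, Complex.coe_smul]

/-- The Hermitian inner product attached to a positive `(1,1)`-form. -/
@[reducible] def hermitianCore {γ : E [⋀^Fin 2]→L[ℝ] ℂ} (hJ : IsJInvariant γ) (ht : IsTamed γ) :
    InnerProductSpace.Core ℂ E where
  -- Conjugate linear in the first argument; since γ is real, it is the imaginary part, and γ(x, Jx)
  -- is the squared length.
  inner x y := γ ![x, Complex.I • y] + Complex.I * γ ![x, y]
  conj_inner_symm x y := by
    have h1 : (starRingEnd ℂ) (γ ![y, Complex.I • x]) = γ ![y, Complex.I • x] :=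
      Complex.conj_eq_iff_im.2 (ht.apply_im hJ _ _)
    have h2 : (starRingEnd ℂ) (γ ![y, x]) = γ ![y, x] :=
      Complex.conj_eq_iff_im.2 (ht.apply_im hJ _ _)
    rw [map_add, map_mul, h1, h2, Complex.conj_I, hJ.apply_I_right_comm y x, form_two_swap γ y x]
    ring
  re_inner_nonneg x := by
    by_cases hx : x = 0
    · subst hx
      rw [smul_zero, form_two_self]; simp
    · obtain ⟨r, hr, h⟩ := ht x hx
      rw [h, form_two_self]
      simpa using hr.le
  add_left x y z := by
    rw [form_two_add_left, form_two_add_left]; ring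
  smul_left x y c := by
    rw [smul_eq_re_add_im c x, form_two_add_left, form_two_add_left, form_two_smul_left,
      form_two_smul_left, form_two_smul_left, form_two_smul_left, hJ x y,
      show γ ![Complex.I • x, y] = - γ ![x, Complex.I • y] by
        rw [form_two_swap, hJ.apply_I_right_comm]]
    apply Complex.ext <;> simp <;> ring
  definite x hx := by
    by_contra h
    obtain ⟨r, hr, h⟩ := ht x h
    rw [h, form_two_self] at hx
    simp at hx
    exact hr.ne' hx

/-- Positivity of the wedge powers of a positive `(1,1)`-form on complex subspaces. -/
theorem wedgePow_pairFrame_pos {γ : E [⋀^Fin 2]→L[ℝ] ℂ} (hJ : IsJInvariant γ) (ht : IsTamed γ)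
    {N : ℕ} (u : Fin N → E) (hu : LinearIndependent ℂ u) :
    ∃ r : ℝ, 0 < r ∧ wedgePow γ N (pairFrame u) = r := by
  -- Pulling back to ℂ^N along the injective map with values u_i on the standard basis preserves
  -- invariance and tameness, and makes ω^N a form of top degree.
  set f : (Fin N → ℂ) →L[ℂ] E := LinearMap.toContinuousLinearMap (Fintype.linearCombination ℂ u)
    with hf
  have hfe : ∀ i, f (Pi.single i 1) = u i := fun i => by
    simp [hf, Fintype.linearCombination_apply_single]
  have hfinj : Function.Injective f := by
    rw [hf, LinearMap.coe_toContinuousLinearMap']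
    exact hu.fintypeLinearCombination_injective
  set fR : (Fin N → ℂ) →L[ℝ] E := f.restrictScalars ℝ
  have hfI : ∀ x, fR (Complex.I • x) = Complex.I • fR x := fun x => f.map_smul _ _
  have hJ' := hJ.comp fR hfI
  have ht' := ht.comp fR hfI hfinj
  set γ' := γ.compContinuousLinearMap fR with hγ'
  -- In a basis orthogonal for the Hermitian product of γ', the real and imaginary parts of
  -- orthogonality say that γ' pairs different complex lines trivially.
  obtain ⟨b, hb⟩ := exists_orthogonal_basis (hermitianCore hJ' ht') (N := N) (by simp)
  have hb0 : ∀ i j, i ≠ j → γ' ![b i, b j] = 0 ∧ γ' ![b i, Complex.I • b j] = 0 := by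
    intro i j hij
    have h : γ' ![b i, Complex.I • b j] + Complex.I * γ' ![b i, b j] = 0 := hb i j hij
    have i1 := ht'.apply_im hJ' (b i) (Complex.I • b j)
    have i2 := ht'.apply_im hJ' (b i) (b j)
    have r1 := congrArg Complex.re h
    have r2 := congrArg Complex.im h
    simp [i1, i2] at r1 r2
    exact ⟨Complex.ext r2 i2, Complex.ext r1 i1⟩
  obtain ⟨r, hr, hval⟩ := wedgePow_apply_of_orthogonal γ' (N := N)
    (fun a => (![1, Complex.I] a.2 : ℂ) • b a.1) (by
      rintro ⟨i, j⟩ ⟨i', j'⟩ hij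
      have hij' : i ≠ i' := hij
      have h1 := (hb0 i i' hij').1
      have h2 := (hb0 i i' hij').2
      have h3 : γ' ![Complex.I • b i, b i'] = 0 := by
        rw [form_two_swap, (hb0 i' i hij'.symm).2, neg_zero]
      have h4 : γ' ![Complex.I • b i, Complex.I • b i'] = 0 := by rw [hJ', h1]
      fin_cases j <;> fin_cases j' <;> simpa)
  have hpf : (fun j => (fun a : Fin N × Fin 2 => (![1, Complex.I] a.2 : ℂ) • b a.1)
      ((pairIdx N).symm j)) = pairFrame b := by
    funext j
    obtain ⟨⟨i, k⟩, rfl⟩ := (pairIdx N).surjective j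
    rw [pairFrame_pairIdx]
    simp
  rw [hpf] at hval
  have hprod : ∃ s : ℝ, 0 < s ∧ ∏ i : Fin N, γ' (fun j => (![1, Complex.I] j : ℂ) • b i) = s := by
    have : ∀ i, ∃ s : ℝ, 0 < s ∧ γ' (fun j => (![1, Complex.I] j : ℂ) • b i) = s := by
      intro i
      obtain ⟨s, hs, h⟩ := ht' (b i) (b.ne_zero i)
      refine ⟨s, hs, ?_⟩
      rw [← h]
      congr 1
      funext j
      fin_cases j <;> simp
    choose s hs h using this
    refine ⟨∏ i, s i, Finset.prod_pos fun i _ => hs i, ?_⟩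
    rw [Finset.prod_congr rfl fun i _ => h i]
    push_cast
    rfl
  obtain ⟨s, hs, hprod⟩ := hprod
  rw [hprod] at hval
  -- The u_i correspond to the standard basis, not to b. In top degree the two values differ by the
  -- real determinant of the complex change of basis g, which is |det g|² > 0.
  set g : (Fin N → ℂ) →ₗ[ℂ] (Fin N → ℂ) :=
    ((Pi.basisFun ℂ (Fin N)).equiv b (Equiv.refl _)).toLinearMap with hg
  have hge : ∀ i, g (Pi.single i 1) = b i := by
    intro i
    have := (Pi.basisFun ℂ (Fin N)).equiv_apply i b (Equiv.refl _)
    simpa [hg] using this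
  have hdet : 0 < Complex.normSq (LinearMap.det g) := by
    rw [Complex.normSq_pos]
    exact (LinearEquiv.isUnit_det' ((Pi.basisFun ℂ (Fin N)).equiv b (Equiv.refl _))).ne_zero
  have hA := alternating_apply_comp_det (frameBasis N)
    (wedgePow γ' N).toAlternatingMap (g.restrictScalars ℝ)
    (pairFrame (fun i => Pi.single i (1 : ℂ)))
  rw [det_restrictScalars_complex] at hA
  have hpg : (fun j => (g.restrictScalars ℝ) (pairFrame (fun i => Pi.single i (1 : ℂ)) j)) =
      pairFrame b := by
    funext j
    have := pairFrame_map (LinearMap.toContinuousLinearMap g) (fun i => Pi.single i (1 : ℂ)) j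
    simp only [LinearMap.coe_toContinuousLinearMap', hge] at this
    exact this.symm
  rw [hpg] at hA
  have hpu : pairFrame u = fun j => fR (pairFrame (fun i => Pi.single i (1 : ℂ)) j) := by
    funext j
    have := pairFrame_map f (fun i => Pi.single i (1 : ℂ)) j
    simp only [hfe] at this
    exact this
  have hfin : wedgePow γ N (pairFrame u) =
      wedgePow γ' N (pairFrame (fun i => Pi.single i (1 : ℂ))) := by
    rw [hpu, hγ', ← wedgePow_compContinuousLinearMap]
    rfl
  have hA' : wedgePow γ' N (pairFrame b) = (Complex.normSq (LinearMap.det g) : ℂ) *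
    wedgePow γ' N (pairFrame (fun i => Pi.single i (1 : ℂ))) := hA
  rw [← hfin] at hA'
  refine ⟨r * s / Complex.normSq (LinearMap.det g), by positivity, ?_⟩
  have hne : (Complex.normSq (LinearMap.det g) : ℂ) ≠ 0 := by exact_mod_cast hdet.ne'
  push_cast
  rw [eq_div_iff hne, mul_comm, ← hA', hval]

end Positivity

/-! ### Contraction with vertical vectors. -/

section Contract

variable {E : Type*} [NormedAddCommGroup E] [NormedSpace ℂ E]
  {B : Type*} [NormedAddCommGroup B] [NormedSpace ℂ B]

theorem contract_apply {r : ℕ} (q : ℕ) (f : Fin q → E) (β : E [⋀^Fin (r + q)]→L[ℝ] ℂ)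
    (w : Fin r → E) :
    contract q f β w = β (fun i => Fin.append f w (Fin.cast (Nat.add_comm r q) i)) := by
  induction q with
  | zero =>
    rw [contract]
    congr 1
    funext i
    have : Fin.cast (Nat.add_comm r 0) i = Fin.natAdd 0 i := by ext; simp
    rw [this, Fin.append_right]
  | succ q ih =>
    rw [contract, ih, ContinuousAlternatingMap.curryLeft_apply_apply]
    congr 1
    funext i
    refine Fin.cases ?_ (fun i => ?_) i
    · exact (Fin.append_left f w 0).symm
    · rw [Matrix.cons_val_succ]
      obtain ⟨j, rfl⟩ : ∃ j : Fin (q + r), i = Fin.cast (Nat.add_comm q r) j :=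
        ⟨Fin.cast (Nat.add_comm r q) i, by ext; simp⟩
      refine Fin.addCases (fun j => ?_) (fun j => ?_) j
      · have : Fin.cast (Nat.add_comm r (q + 1))
          (Fin.succ (Fin.cast (Nat.add_comm q r) (Fin.castAdd r j))) = Fin.castAdd r j.succ := by
          ext; simp
        rw [this, Fin.append_left]
        exact Fin.append_left (fun j => f j.succ) w j
      · have : Fin.cast (Nat.add_comm r (q + 1))
          (Fin.succ (Fin.cast (Nat.add_comm q r) (Fin.natAdd q j))) = Fin.natAdd (q + 1) j := by
          ext; simp; omega
        rw [this, Fin.append_right]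
        exact Fin.append_right (fun j => f j.succ) w j

/-- Contraction as a continuous linear map. -/
def contractL {r : ℕ} : (q : ℕ) → (Fin q → E) →
    (E [⋀^Fin (r + q)]→L[ℝ] ℂ) →L[ℝ] E [⋀^Fin r]→L[ℝ] ℂ
  | 0, _ => ContinuousLinearMap.id ℝ _
  | q + 1, f => (contractL q (fun j => f j.succ)).comp
      ((ContinuousLinearMap.apply ℝ _ (f 0)).comp
        (ContinuousAlternatingMap.curryLeftLI (n := r + q)).toContinuousLinearMap)

@[simp] theorem contractL_apply {r : ℕ} (q : ℕ) (f : Fin q → E) (β : E [⋀^Fin (r + q)]→L[ℝ] ℂ) :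
    contractL q f β = contract q f β := by
  induction q with
  | zero => rfl
  | succ q ih => rw [contract, ← ih]; rfl

/-- The contraction as an alternating map in the contracted vectors. -/
def contractAlt {r q : ℕ} (β : E [⋀^Fin (r + q)]→L[ℝ] ℂ) (w : Fin r → E) :
    E [⋀^Fin q]→ₗ[ℝ] ℂ where
  toFun f := contract q f β w
  map_update_add' := by
    intro inst f i x y
    obtain rfl : inst = instDecidableEqFin q := Subsingleton.elim _ _
    have h : ∀ z, (fun j => Fin.append (Function.update f i z) w (Fin.cast (Nat.add_comm r q) j)) =
        Function.update (fun j => Fin.append f w (Fin.cast (Nat.add_comm r q) j))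
          (Fin.cast (Nat.add_comm q r) (Fin.castAdd r i)) z := by
      intro z
      funext j
      obtain ⟨j, rfl⟩ : ∃ j' : Fin (q + r), j = Fin.cast (Nat.add_comm q r) j' :=
        ⟨Fin.cast (Nat.add_comm r q) j, by ext; simp⟩
      refine Fin.addCases (fun j => ?_) (fun j => ?_) j
      · by_cases hj : j = i
        · subst hj; simp
        · simp [hj]
      · have : Fin.cast (Nat.add_comm q r) (Fin.natAdd q j) ≠
            Fin.cast (Nat.add_comm q r) (Fin.castAdd r i) := by
          intro h; have := congrArg Fin.val h; simp at this; omega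
        rw [Function.update_of_ne this]
        simp
    simp only [contract_apply, h]
    exact β.map_update_add _ _ _ _
  map_update_smul' := by
    intro inst f i c x
    obtain rfl : inst = instDecidableEqFin q := Subsingleton.elim _ _
    have h : ∀ z, (fun j => Fin.append (Function.update f i z) w (Fin.cast (Nat.add_comm r q) j)) =
        Function.update (fun j => Fin.append f w (Fin.cast (Nat.add_comm r q) j))
          (Fin.cast (Nat.add_comm q r) (Fin.castAdd r i)) z := by
      intro z
      funext j
      obtain ⟨j, rfl⟩ : ∃ j' : Fin (q + r), j = Fin.cast (Nat.add_comm q r) j' :=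
        ⟨Fin.cast (Nat.add_comm r q) j, by ext; simp⟩
      refine Fin.addCases (fun j => ?_) (fun j => ?_) j
      · by_cases hj : j = i
        · subst hj; simp
        · simp [hj]
      · have : Fin.cast (Nat.add_comm q r) (Fin.natAdd q j) ≠
            Fin.cast (Nat.add_comm q r) (Fin.castAdd r i) := by
          intro h; have := congrArg Fin.val h; simp at this; omega
        rw [Function.update_of_ne this]
        simp
    simp only [contract_apply, h]
    exact β.map_update_smul _ _ _ _
  map_eq_zero_of_eq' := by
    intro f i j hij hne
    rw [contract_apply]
    refine β.map_eq_zero_of_eq _ (i := Fin.cast (Nat.add_comm q r) (Fin.castAdd r i))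
      (j := Fin.cast (Nat.add_comm q r) (Fin.castAdd r j)) ?_ ?_
    · simpa using hij
    · intro h
      have := congrArg Fin.val h
      exact hne (Fin.ext (by simpa using this))

theorem verticalFrame_eq_inr_frameBasis (n : ℕ) (j : Fin (2 * n)) :
    verticalFrame B n j = (0, frameBasis n j) := by
  rw [verticalFrame_eq, frameBasis_apply]; rfl

/-- Contraction with the image of the vertical frame under a complex linear map of the fibre. -/
theorem contract_vertical_det {n r : ℕ} (A : (Fin n → ℂ) →ₗ[ℂ] (Fin n → ℂ))
    (β : (B × (Fin n → ℂ)) [⋀^Fin (r + 2 * n)]→L[ℝ] ℂ) :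
    contract (2 * n) (fun j => ((0 : B), A (frameBasis n j))) β =
      Complex.normSq (LinearMap.det A) • contract (2 * n) (verticalFrame B n) β := by
  ext w
  have := alternating_apply_comp_det (frameBasis n)
    ((contractAlt β w).compLinearMap (LinearMap.inr ℝ B (Fin n → ℂ))) (A.restrictScalars ℝ)
    (frameBasis n)
  rw [det_restrictScalars_complex] at this
  rw [ContinuousAlternatingMap.smul_apply, Complex.real_smul,
    show verticalFrame B n = fun j => (0, frameBasis n j) from
      funext (verticalFrame_eq_inr_frameBasis n)]
  exact this

/-- A vertical vector is a real combination of frame vectors, and these already occupy the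
contracted slots. By linearity it suffices to insert a frame vector, which produces a repeated
argument. -/
theorem contract_vertical_eq_zero {n r : ℕ} (β : (B × (Fin n → ℂ)) [⋀^Fin (r + 2 * n)]→L[ℝ] ℂ)
    (w : Fin r → B × (Fin n → ℂ)) (i : Fin r) (hi : (w i).1 = 0) :
    contract (2 * n) (verticalFrame B n) β w = 0 := by
  set γ := contract (2 * n) (verticalFrame B n) β with hγ
  set L : (Fin n → ℂ) →ₗ[ℝ] ℂ :=
    (γ.toContinuousLinearMap w i).toLinearMap ∘ₗ LinearMap.inr ℝ B (Fin n → ℂ) with hL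
  have h0 : L = 0 := by
    refine (frameBasis n).ext fun j => ?_
    change γ (Function.update w i (0, frameBasis n j)) = 0
    rw [hγ, contract_apply]
    refine β.map_eq_zero_of_eq _ (i := Fin.cast (Nat.add_comm (2 * n) r) (Fin.castAdd r j))
      (j := Fin.cast (Nat.add_comm (2 * n) r) (Fin.natAdd (2 * n) i)) ?_ ?_
    · simp [verticalFrame_eq_inr_frameBasis]
    · intro h
      have := congrArg Fin.val h
      simp at this
      have := j.2
      omega
  have h1 : γ (Function.update w i (0, (w i).2)) = 0 := DFunLike.congr_fun h0 (w i).2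
  rwa [show ((0 : B), (w i).2) = w i from Prod.ext hi.symm rfl, Function.update_eq_self] at h1

/-- A form contracted with the vertical frame depends only on the horizontal components. -/
theorem contract_vertical_horizontal {n r : ℕ}
    (β : (B × (Fin n → ℂ)) [⋀^Fin (r + 2 * n)]→L[ℝ] ℂ) (w : Fin r → B × (Fin n → ℂ)) :
    contract (2 * n) (verticalFrame B n) β w =
      contract (2 * n) (verticalFrame B n) β (fun i => ((w i).1, 0)) := by
  -- Split every argument into its horizontal and vertical part and expand; each term with a
  -- vertical argument vanishes.
  have h := (contract (2 * n) (verticalFrame B n) β).toMultilinearMap.map_add_univ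
    (fun i => ((w i).1, (0 : Fin n → ℂ))) (fun i => ((0 : B), (w i).2))
  have hw : ((fun i => ((w i).1, (0 : Fin n → ℂ))) + fun i => ((0 : B), (w i).2)) = w := by
    funext i
    exact Prod.ext (by simp) (by simp)
  rw [hw] at h
  refine h.trans ?_
  rw [Finset.sum_eq_single Finset.univ]
  · rw [Finset.piecewise_univ]; rfl
  · intro s _ hs
    obtain ⟨i, hi⟩ : ∃ i, i ∉ s := by
      by_contra hcon
      push Not at hcon
      exact hs (Finset.eq_univ_iff_forall.2 hcon)
    refine contract_vertical_eq_zero β _ i ?_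
    simp [Finset.piecewise, hi]
  · simp

theorem contract_comp {F : Type*} [NormedAddCommGroup F] [NormedSpace ℂ F] {r q : ℕ} (f : Fin q → E)
    (β : F [⋀^Fin (r + q)]→L[ℝ] ℂ) (g : E →L[ℝ] F) :
    contract q f (β.compContinuousLinearMap g) =
      (contract q (fun j => g (f j)) β).compContinuousLinearMap g := by
  ext w
  rw [contract_apply, ContinuousAlternatingMap.compContinuousLinearMap_apply,
    ContinuousAlternatingMap.compContinuousLinearMap_apply, contract_apply]
  congr 1
  funext i
  obtain ⟨i, rfl⟩ : ∃ j' : Fin (q + r), i = Fin.cast (Nat.add_comm q r) j' :=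
        ⟨Fin.cast (Nat.add_comm r q) i, by ext; simp⟩
  refine Fin.addCases (fun j => ?_) (fun j => ?_) i <;> simp

theorem contract_castDegree_succ {r p q : ℕ} (h : p + 1 = r + (q + 1)) (f : Fin (q + 1) → E)
    (β : E [⋀^Fin (p + 1)]→L[ℝ] ℂ) :
    contract (q + 1) f (castDegree h β) =
      contract q (fun j => f j.succ) (castDegree (by omega) (β.curryLeft (f 0))) := by
  obtain rfl : p = r + q := by omega
  rfl

end Contract

/-! ### Complexified vectors, type and positivity. -/

section ComplexEval

variable {E : Type*} [NormedAddCommGroup E] [NormedSpace ℂ E]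

/-- Contraction of a form with a complexified vector. -/
def contractC {r : ℕ} (ξ : E × E) (Φ : E [⋀^Fin (r + 1)]→L[ℝ] ℂ) : E [⋀^Fin r]→L[ℝ] ℂ :=
  Φ.curryLeft ξ.1 + Complex.I • Φ.curryLeft ξ.2

/-- The subsets of `Fin (r + 1)` not containing 0 collect the first component of ξ 0, the others its
second component with a factor i. This allows complexified vectors to be inserted one at a time. -/
theorem complexEval_succ {r : ℕ} (Φ : E [⋀^Fin (r + 1)]→L[ℝ] ℂ) (ξ : Fin (r + 1) → E × E) :
    complexEval Φ ξ = complexEval (contractC (ξ 0) Φ) (fun j => ξ j.succ) := by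
  classical
  have key : ∀ G : Finset (Fin (r + 1)) → ℂ, ∑ s, G s =
      ∑ s : Finset (Fin r), (G (s.map (Fin.succEmb r)) +
        G (insert 0 (s.map (Fin.succEmb r)))) := by
    intro G
    have hinj : ∀ s : Finset (Fin r), (0 : Fin (r + 1)) ∉ s.map (Fin.succEmb r) := by
      intro s hs
      obtain ⟨j, _, hj⟩ := Finset.mem_map.1 hs
      exact Fin.succ_ne_zero j hj
    have huniv : (Finset.univ : Finset (Fin (r + 1))) =
        insert 0 ((Finset.univ : Finset (Fin r)).map (Fin.succEmb r)) := by
      ext i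
      refine Fin.cases ?_ (fun i => ?_) i <;> simp
    rw [← Finset.powerset_univ, huniv, Finset.sum_powerset_insert (hinj _),
      Finset.sum_add_distrib]
    have hp : ∀ H : Finset (Fin (r + 1)) → ℂ,
        ∑ t ∈ ((Finset.univ : Finset (Fin r)).map (Fin.succEmb r)).powerset, H t =
        ∑ s : Finset (Fin r), H (s.map (Fin.succEmb r)) := by
      intro H
      symm
      refine Finset.sum_bij (fun s _ => s.map (Fin.succEmb r)) ?_ ?_ ?_ ?_
      · intro s _
        exact Finset.mem_powerset.2 (Finset.map_subset_map.2 (Finset.subset_univ _))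
      · intro s _ t _ h
        exact Finset.map_injective _ h
      · intro t ht
        obtain ⟨u, _, hu⟩ := Finset.subset_map_iff.1 (Finset.mem_powerset.1 ht)
        exact ⟨u, Finset.mem_univ _, hu.symm⟩
      · intros; rfl
    rw [hp, hp]
  rw [complexEval, key, complexEval]
  refine Finset.sum_congr rfl fun s _ => ?_
  have h0 : (0 : Fin (r + 1)) ∉ s.map (Fin.succEmb r) := by simp
  rw [Finset.card_insert_of_notMem h0, Finset.card_map, pow_succ, mul_assoc, ← mul_add, contractC,
    ContinuousAlternatingMap.add_apply, ContinuousAlternatingMap.smul_apply,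
    ContinuousAlternatingMap.curryLeft_apply_apply,
    ContinuousAlternatingMap.curryLeft_apply_apply, smul_eq_mul]
  congr 3
  · funext i
    refine Fin.cases ?_ (fun i => ?_) i <;> simp
  · congr 2
    funext i
    refine Fin.cases ?_ (fun i => ?_) i <;> simp

theorem complexEval_perm {r : ℕ} (Φ : E [⋀^Fin r]→L[ℝ] ℂ) (ξ : Fin r → E × E)
    (σ : Equiv.Perm (Fin r)) :
    complexEval Φ (ξ ∘ σ) = Equiv.Perm.sign σ • complexEval Φ ξ := by
  rw [complexEval, complexEval, Finset.smul_sum]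
  refine (Finset.sum_congr rfl fun s _ => ?_).trans (Equiv.sum_comp (Equiv.finsetCongr σ) _)
  have h := Φ.toAlternatingMap.map_perm
    (fun j => if j ∈ (Equiv.finsetCongr σ) s then (ξ j).2 else (ξ j).1) σ
  rw [← mul_smul_comm]
  have h2 : Φ (fun j => if j ∈ s then ((ξ ∘ σ) j).2 else ((ξ ∘ σ) j).1) =
      Equiv.Perm.sign σ • Φ (fun j => if j ∈ (Equiv.finsetCongr σ) s then (ξ j).2 else (ξ j).1) := by
    refine Eq.trans (congrArg Φ (funext fun j => ?_)) h
    simp [Equiv.finsetCongr_apply]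
  rw [h2, Equiv.finsetCongr_apply, Finset.card_map]

/-- Complex scalar multiplication on complexified vectors. -/
def cmul (c : ℂ) (ξ : E × E) : E × E := (c.re • ξ.1 - c.im • ξ.2, c.im • ξ.1 + c.re • ξ.2)

theorem contractC_cmul {r : ℕ} (c : ℂ) (ξ : E × E) (Φ : E [⋀^Fin (r + 1)]→L[ℝ] ℂ) :
    contractC (cmul c ξ) Φ = c • contractC ξ Φ := by
  ext v
  simp only [contractC, cmul, map_sub, map_add, map_smul, ContinuousAlternatingMap.add_apply,
    ContinuousAlternatingMap.sub_apply, ContinuousAlternatingMap.smul_apply, smul_eq_mul,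
    Complex.real_smul]
  conv_rhs => rw [← Complex.re_add_im c]
  linear_combination (-(c.im : ℂ) * (Φ.curryLeft ξ.2) v) * Complex.I_sq

theorem complexEval_smul {r : ℕ} (c : ℂ) (Φ : E [⋀^Fin r]→L[ℝ] ℂ) (ξ : Fin r → E × E) :
    complexEval (c • Φ) ξ = c * complexEval Φ ξ := by
  rw [complexEval, complexEval, Finset.mul_sum]
  refine Finset.sum_congr rfl fun s _ => ?_
  rw [ContinuousAlternatingMap.smul_apply, smul_eq_mul]; ring

theorem complexEval_cmul {r : ℕ} (Φ : E [⋀^Fin r]→L[ℝ] ℂ) (c : Fin r → ℂ) (ξ : Fin r → E × E) :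
    complexEval Φ (fun j => cmul (c j) (ξ j)) = (∏ j, c j) * complexEval Φ ξ := by
  induction r with
  | zero =>
    rw [complexEval, complexEval]
    simp only [Finset.univ_eq_empty, Finset.prod_empty, one_mul]
    refine Finset.sum_congr rfl fun s _ => ?_
    congr 2
    exact Subsingleton.elim _ _
  | succ r ih =>
    rw [complexEval_succ, contractC_cmul, complexEval_smul, ih, complexEval_succ Φ ξ,
      Fin.prod_univ_succ, mul_assoc]

/-- Together with `vec01_smul` this detects the type: rotating all real vectors by a unit c
multiplies a value on a (1,0)- and b (0,1)-vectors by c^a c̄^b. -/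
theorem vec10_smul (c : ℂ) (u : E) : vec10 (c • u) = cmul c (vec10 u) := by
  rw [vec10, vec10, cmul]
  have h1 : ∀ (a : ℝ) (d : ℂ), a • (d • u) = ((a : ℂ) * d) • u := fun a d => by
    rw [mul_smul, Complex.coe_smul]
  refine Prod.ext ?_ ?_
  · simp only [h1, smul_smul, ← sub_smul]
    congr 1
    linear_combination (-(1 / 2) : ℂ) * Complex.re_add_im c
  · simp only [h1, smul_smul, ← add_smul]
    congr 1
    linear_combination (Complex.I / 2) * Complex.re_add_im c - ((c.im : ℂ) / 2) * Complex.I_sq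

theorem vec01_smul (c : ℂ) (u : E) : vec01 (c • u) = cmul (starRingEnd ℂ c) (vec01 u) := by
  rw [vec01, vec01, cmul]
  have h1 : ∀ (a : ℝ) (d : ℂ), a • (d • u) = ((a : ℂ) * d) • u := fun a d => by
    rw [mul_smul, Complex.coe_smul]
  refine Prod.ext ?_ ?_
  · simp only [h1, smul_smul, ← sub_smul]
    congr 1
    simp only [Complex.conj_re, Complex.conj_im]
    push_cast
    linear_combination (-(1 / 2) : ℂ) * Complex.re_add_im c
  · simp only [h1, smul_smul, ← add_smul]
    congr 1
    simp only [Complex.conj_re, Complex.conj_im]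
    push_cast
    linear_combination (-(Complex.I / 2)) * Complex.re_add_im c + ((c.im : ℂ) / 2) * Complex.I_sq

/-- A `2k`-form which is invariant under rotations is of type `(k,k)`. -/
theorem isType_of_rotation_invariant {k : ℕ} (Φ : E [⋀^Fin (2 * k)]→L[ℝ] ℂ)
    (h : ∀ c : ℂ, ‖c‖ = 1 → ∀ w, Φ (fun i => c • w i) = Φ w) : IsType k k Φ := by
  refine ⟨two_mul k, fun u T hT => ?_⟩
  set X := complexEval Φ (fun j => if j ∈ T then vec10 (u j) else vec01 (u j)) with hX
  -- Rotation leaves the value X unchanged by hypothesis, but also multiplies it by c^a c̄^{2k-a},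
  -- where a = T.card.
  have key : ∀ c : ℂ, ‖c‖ = 1 → X = (c ^ T.card * (starRingEnd ℂ c) ^ (2 * k - T.card)) * X := by
    intro c hc
    have h1 : complexEval Φ (fun j => if j ∈ T then vec10 (c • u j) else vec01 (c • u j)) = X := by
      rw [hX, complexEval, complexEval]
      refine Finset.sum_congr rfl fun s _ => ?_
      rw [← h c hc (fun j => if j ∈ s then (if j ∈ T then vec10 (u j) else vec01 (u j)).2 else
        (if j ∈ T then vec10 (u j) else vec01 (u j)).1)]
      congr 2
      funext j
      split_ifs <;> simp [vec10, vec01, smul_comm c]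
    have h2 : (fun j => if j ∈ T then vec10 (c • u j) else vec01 (c • u j)) =
        fun j => cmul (if j ∈ T then c else starRingEnd ℂ c)
          (if j ∈ T then vec10 (u j) else vec01 (u j)) := by
      funext j
      split_ifs
      · exact vec10_smul c _
      · exact vec01_smul c _
    rw [h2, complexEval_cmul, ← hX, Finset.prod_ite, Finset.prod_const, Finset.prod_const] at h1
    rw [← h1, h1]
    have e1 : (Finset.univ.filter (fun j => j ∈ T)).card = T.card := by simp
    have e2 : (Finset.univ.filter (fun j => j ∉ T)).card = 2 * k - T.card := by
      have := Finset.card_compl T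
      rw [Fintype.card_fin] at this
      rw [← this]
      congr 1
      ext; simp
    rw [e1, e2] at h1
    exact h1.symm
  have hTk : T.card ≤ 2 * k := by
    have := Finset.card_le_univ T
    simpa using this
  set d : ℝ := (T.card : ℝ) - k with hd
  have hd0 : (2 * d) ≠ 0 := by
    have : (T.card : ℝ) ≠ k := by exact_mod_cast hT
    rw [hd]
    intro h
    apply this
    linarith
  -- Since d = a - k ≠ 0, one can take c = exp(iπ/(2d)). Then c^a c̄^{2k-a} = c^{2d} = -1, so X =
  -- -X.
  set c : ℂ := Complex.exp ((Real.pi / (2 * d) : ℝ) * Complex.I) with hc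
  have hcn : ‖c‖ = 1 := Complex.norm_exp_ofReal_mul_I _
  have hconj : starRingEnd ℂ c = Complex.exp (-((Real.pi / (2 * d) : ℝ) * Complex.I)) := by
    rw [hc, ← Complex.exp_conj, map_mul, Complex.conj_I, Complex.conj_ofReal, mul_neg]
  have hval : c ^ T.card * (starRingEnd ℂ c) ^ (2 * k - T.card) = -1 := by
    rw [hconj, hc, ← Complex.exp_nat_mul, ← Complex.exp_nat_mul, ← Complex.exp_add,
      ← Complex.exp_pi_mul_I]
    congr 1
    rw [Nat.cast_sub hTk]
    push_cast
    have hd' : (2 : ℂ) * (d : ℂ) ≠ 0 := by exact_mod_cast hd0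
    have hd2 : (d : ℂ) = (T.card : ℂ) - k := by rw [hd]; push_cast; ring
    have hd3 : (d : ℂ) ≠ 0 := fun h => hd' (by rw [h, mul_zero])
    field_simp
    rw [hd2]
    ring
  have := key c hcn
  rw [hval] at this
  have h2 : (2 : ℂ) * X = 0 := by linear_combination this
  simpa using h2

theorem pairFrame_cons {k : ℕ} (u : Fin (k + 1) → E) :
    (pairFrame u : Fin (2 * k + 2) → E) = Matrix.vecCons (u 0)
      (Matrix.vecCons (Complex.I • u 0) (pairFrame (fun i => u i.succ))) := by
  funext j
  refine Fin.cases ?_ (fun j => Fin.cases ?_ (fun j => ?_) j) j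
  · simp [pairFrame]
  · change (if (0 + 1) % 2 = 0 then (1 : ℂ) else Complex.I) • u ⟨(0 + 1) / 2, _⟩ = _
    simp
  · simp only [Matrix.cons_val_succ, pairFrame, Fin.val_succ]
    have h1 : (j.1 + 1 + 1) % 2 = j.1 % 2 := by omega
    have h2 : (j.1 + 1 + 1) / 2 = j.1 / 2 + 1 := by omega
    simp only [h1, h2]
    congr 1

theorem curryLeft_curryLeft_swap {r : ℕ} (u v : E) (Φ : E [⋀^Fin (r + 2)]→L[ℝ] ℂ) :
    (Φ.curryLeft u).curryLeft v = -(Φ.curryLeft v).curryLeft u := by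
  have h := Φ.curryLeft_same (u + v)
  have h1 := Φ.curryLeft_same u
  have h2 := Φ.curryLeft_same v
  simp only [map_add, ContinuousAlternatingMap.curryLeft_add, _root_.add_apply] at h
  rw [h1, h2] at h
  rw [eq_neg_iff_add_eq_zero]
  simpa [add_comm] using h

/-- Expand (u - iJu)/2 and (u + iJu)/2: the terms with a repeated vector vanish and the two mixed
ones agree, leaving i/2 times the contraction with u and Ju. -/
theorem contractC_conj_pair {r : ℕ} (u : E) (Φ : E [⋀^Fin (r + 2)]→L[ℝ] ℂ) :
    contractC (vec01 u) (contractC (r := r + 1) (vec10 u) Φ) =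
      (Complex.I / 2) • (Φ.curryLeft u).curryLeft (Complex.I • u) := by
  have e1 : (1 / 2 : ℂ) • u = (1 / 2 : ℝ) • u := by
    rw [← Complex.coe_smul]; push_cast; rfl
  have e2 : (Complex.I / 2) • u = (1 / 2 : ℝ) • (Complex.I • u) := by
    rw [← Complex.coe_smul, smul_smul]; congr 1; push_cast; ring
  have h1 := Φ.curryLeft_same u
  have h2 := Φ.curryLeft_same (Complex.I • u)
  have h3 := curryLeft_curryLeft_swap (Complex.I • u) u Φ
  ext v
  have h1' : (Φ.curryLeft u).curryLeft u v = 0 := by rw [h1]; rfl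
  have h2' : (Φ.curryLeft (Complex.I • u)).curryLeft (Complex.I • u) v = 0 := by rw [h2]; rfl
  have h3' := DFunLike.congr_fun h3 v
  simp only [contractC, vec10, vec01, neg_smul, e1, e2, map_smul, map_neg,
    ContinuousAlternatingMap.curryLeft_add, ContinuousAlternatingMap.curryLeft_smul,
    _root_.add_apply, _root_.smul_apply,
    ContinuousAlternatingMap.add_apply, ContinuousAlternatingMap.smul_apply,
    ContinuousAlternatingMap.neg_apply, ContinuousAlternatingMap.curryLeft_apply_apply,
    Complex.real_smul, smul_eq_mul] at h1' h2' h3' ⊢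
  push_cast
  rw [h1', h2', h3']
  linear_combination (0 : ℂ) * Complex.I_sq

/-- Exhibits v̄₁ standing behind the other k vectors of type (1,0), so that moving it next to v₁
costs the sign (-1)^k. -/
theorem conjFrame_succ {k : ℕ} (u : Fin (k + 1) → E) :
    (conjFrame u : Fin (2 * k + 2) → E × E) = Matrix.vecCons (vec10 (u 0))
      ((⟨k, by omega⟩ : Fin (2 * k + 1)).insertNth (α := fun _ => E × E) (vec01 (u 0))
        (conjFrame (fun i => u i.succ))) := by
  funext j
  refine Fin.cases ?_ (fun j => ?_) j
  · simp [conjFrame]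
  · rw [Matrix.cons_val_succ]
    refine Fin.succAboveCases (⟨k, by omega⟩ : Fin (2 * k + 1)) ?_ (fun i => ?_) j
    · rw [Fin.insertNth_apply_same]
      simp [conjFrame]
    · rw [Fin.insertNth_apply_succAbove]
      by_cases hi : i.1 < k
      · rw [Fin.succAbove_of_castSucc_lt _ _ (by simpa [Fin.lt_def] using hi)]
        simp only [conjFrame, Fin.val_succ, Fin.val_castSucc]
        rw [dif_pos (by omega), dif_pos hi]
        rfl
      · rw [Fin.succAbove_of_le_castSucc _ _ (by simpa [Fin.le_def] using hi)]
        simp only [conjFrame, Fin.val_succ]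
        rw [dif_neg (by omega), dif_neg hi]
        congr 2
        ext
        simp
        omega

/-- The reason for the factor (-i)^{k²}: in the inductive step, bringing v̄₁ next to v₁ gives (-1)^k
and the conjugate pair gives i/2, while (-i)^{(k+1)²} = (-i)^{k²} (-1)^k (-i). What remains is 1/2
for each pair, so positivity may be tested on the real tuples (u₁, Ju₁, …). -/
theorem complexEval_conjFrame {k : ℕ} (Φ : E [⋀^Fin (2 * k)]→L[ℝ] ℂ) (u : Fin k → E) :
    (-Complex.I) ^ (k ^ 2) * complexEval Φ (conjFrame u) = (1 / 2) ^ k * Φ (pairFrame u) := by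
  induction k with
  | zero =>
    have : Subsingleton (Finset (Fin (2 * 0))) := by
      rw [mul_zero]; infer_instance
    rw [complexEval, Fintype.sum_subsingleton _ ∅]
    simp only [Finset.card_empty, pow_zero, ne_eq, OfNat.ofNat_ne_zero, not_false_eq_true, zero_pow,
      one_mul]
    congr 1
    funext j
    exact absurd j.2 (by simp)
  | succ k ih =>
    have h1 : complexEval Φ (conjFrame u) = complexEval (p := 2 * k + 1)
        (contractC (vec10 (u 0)) Φ)
        ((⟨k, by omega⟩ : Fin (2 * k + 1)).insertNth (α := fun _ => E × E) (vec01 (u 0))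
        (conjFrame (fun i => u i.succ))) := by
      refine (complexEval_succ (r := 2 * k + 1) Φ (conjFrame u)).trans ?_
      have h0 := conjFrame_succ u
      have h00 : conjFrame u (0 : Fin (2 * k + 1 + 1)) = vec10 (u 0) := congrFun h0 0
      have h01 : (fun j : Fin (2 * k + 1) => conjFrame u (Fin.succ (n := 2 * k + 1) j)) = _ :=
        funext fun j => congrFun h0 j.succ
      rw [h00, h01]
      rfl
    have h2 := complexEval_perm (r := 2 * k + 1) (contractC (vec10 (u 0)) Φ)
      (Fin.cons (vec01 (u 0)) (conjFrame (fun i => u i.succ)))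
      (⟨k, by omega⟩ : Fin (2 * k + 1)).cycleRange
    have h2' := complexEval_succ (r := 2 * k) (contractC (vec10 (u 0)) Φ)
      (Fin.cons (vec01 (u 0)) (conjFrame (fun i => u i.succ)))
    simp only [Fin.cons_zero, Fin.cons_succ] at h2'
    rw [Fin.cons_comp_cycleRange, Fin.sign_cycleRange, h2'] at h2
    have h3 := contractC_conj_pair (r := 2 * k) (u 0) Φ
    rw [h3, complexEval_smul] at h2
    rw [h1, h2]
    have h4 := ih ((ContinuousAlternatingMap.curryLeft (n := 2 * k)
      (ContinuousAlternatingMap.curryLeft (n := 2 * k + 1) Φ (u 0)) (Complex.I • u 0)))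
      (fun i => u i.succ)
    rw [ContinuousAlternatingMap.curryLeft_apply_apply,
      ContinuousAlternatingMap.curryLeft_apply_apply, ← pairFrame_cons] at h4
    rw [pow_succ (1 / 2 : ℂ), mul_right_comm, ← h4]
    have h5 : (-Complex.I) ^ ((k + 1) ^ 2) = (-Complex.I) ^ (k ^ 2) * (-1) ^ k * (-Complex.I) := by
      rw [show (k + 1) ^ 2 = k ^ 2 + 2 * k + 1 by ring, pow_add, pow_add, pow_mul, pow_one]
      congr 3
      rw [neg_sq, Complex.I_sq]
    rw [h5]
    have h6 : ((-1 : ℂ) ^ k) * (-1) ^ k = 1 := by rw [← mul_pow]; simp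
    have h7 : ∀ z : ℂ, ((-1 : ℤˣ) ^ k) • z = (-1) ^ k * z := by
      intro z
      rcases Nat.even_or_odd k with hk | hk <;> simp [hk.neg_one_pow]
    rw [h7]
    linear_combination (-Complex.I) ^ (k ^ 2) * complexEval ((Φ.curryLeft (u 0)).curryLeft
      (Complex.I • u 0)) (conjFrame (fun i => u i.succ)) * (1 / 2 * h6 -
        1 / 2 * ((-1 : ℂ) ^ k * (-1) ^ k) * Complex.I_sq)

theorem isPositiveAt_of_pairFrame {k : ℕ} {Φ : E [⋀^Fin (2 * k)]→L[ℝ] ℂ}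
    (h : ∀ u : Fin k → E, LinearIndependent ℂ u → ∃ r : ℝ, 0 < r ∧ Φ (pairFrame u) = r) :
    IsPositiveAt k Φ := by
  intro u hu
  obtain ⟨r, hr, h⟩ := h u hu
  rw [complexEval_conjFrame, h]
  have : ((1 / 2 : ℂ) ^ k * (r : ℂ)) = (((1 / 2 : ℝ) ^ k * r : ℝ) : ℂ) := by push_cast; rfl
  rw [this, Complex.ofReal_re, Complex.ofReal_im]
  exact ⟨by positivity, rfl⟩

/-- A positive 2-form satisfies `γ (u, √-1 u) > 0`. -/
theorem IsPositiveAt.isTamed {γ : E [⋀^Fin 2]→L[ℝ] ℂ} (h : IsPositiveAt 1 γ) : IsTamed γ := by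
  intro u hu
  have h1 := h (fun _ => u) (LinearIndependent.of_subsingleton (0 : Fin 1) hu)
  have h2 := complexEval_conjFrame (k := 1) γ (fun _ => u)
  rw [h2] at h1
  have h3 : (pairFrame (fun _ : Fin 1 => u) : Fin 2 → E) = ![u, Complex.I • u] := by
    funext j
    fin_cases j <;> simp [pairFrame]
  rw [show γ (pairFrame (fun _ : Fin 1 => u)) = γ ![u, Complex.I • u] from congrArg γ h3] at h1
  obtain ⟨h4, h5⟩ := h1
  norm_num at h4 h5
  exact ⟨(γ ![u, Complex.I • u]).re, h4, Complex.ext rfl (by simpa using h5)⟩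

end ComplexEval

/-! ### Smoothness of the algebraic operations. -/

section SmoothForms

variable {E : Type*} [NormedAddCommGroup E] [NormedSpace ℂ E]
  {F : Type*} [NormedAddCommGroup F] [NormedSpace ℂ F]
  {G : Type*} [NormedAddCommGroup G] [NormedSpace ℝ G]

/-- The projection of continuous multilinear maps onto continuous alternating maps. -/
def alternatingProj (p : ℕ) : ContinuousMultilinearMap ℝ (fun _ : Fin p => E) ℂ →L[ℝ]
    E [⋀^Fin p]→L[ℝ] ℂ :=
  LinearMap.mkContinuous
    { toFun := fun m => (p.factorial : ℝ)⁻¹ • ContinuousMultilinearMap.alternatization m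
      map_add' := fun a b => by rw [map_add, smul_add]
      map_smul' := fun c a => by
        ext v
        simp only [ContinuousAlternatingMap.smul_apply,
          ContinuousMultilinearMap.alternatization_apply_apply,
          _root_.smul_apply, RingHom.id_apply, Finset.smul_sum]
        refine Finset.sum_congr rfl fun σ _ => ?_
        rw [smul_comm _ c, smul_comm _ c] } 1 (fun m => by
      refine ContinuousAlternatingMap.opNorm_le_bound _ (by positivity) fun v => ?_
      change ‖((p.factorial : ℝ)⁻¹ • ContinuousMultilinearMap.alternatization m) v‖ ≤ _
      rw [ContinuousAlternatingMap.smul_apply, norm_smul, Real.norm_of_nonneg (by positivity),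
        ContinuousMultilinearMap.alternatization_apply_apply]
      have h : ‖∑ σ : Equiv.Perm (Fin p), Equiv.Perm.sign σ • m (v ∘ σ)‖ ≤
          ∑ σ : Equiv.Perm (Fin p), ‖m‖ * ∏ i, ‖v i‖ := by
        refine norm_sum_le_of_le _ fun σ _ => ?_
        have h1 : ‖Equiv.Perm.sign σ • m (v ∘ σ)‖ = ‖m (v ∘ σ)‖ := by
          rcases Int.units_eq_one_or (Equiv.Perm.sign σ) with h | h <;> simp [h]
        rw [h1, ← Equiv.prod_comp σ]
        exact m.le_opNorm _
      rw [Finset.sum_const, Finset.card_univ, Fintype.card_perm, Fintype.card_fin,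
        nsmul_eq_mul] at h
      have hp : (0 : ℝ) < p.factorial := by exact_mod_cast Nat.factorial_pos p
      rw [one_mul, inv_mul_le_iff₀ hp]
      exact h)

theorem alternatingProj_apply {p : ℕ} (a : E [⋀^Fin p]→L[ℝ] ℂ) :
    alternatingProj p a.toContinuousMultilinearMap = a := by
  ext v
  change ((p.factorial : ℝ)⁻¹ •
    ContinuousMultilinearMap.alternatization a.toContinuousMultilinearMap) v = _
  rw [ContinuousAlternatingMap.smul_apply,
    ContinuousMultilinearMap.alternatization_apply_apply]
  have : ∀ σ : Equiv.Perm (Fin p),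
      Equiv.Perm.sign σ • a.toContinuousMultilinearMap (v ∘ σ) = a v := by
    intro σ
    rw [show a.toContinuousMultilinearMap (v ∘ σ) = Equiv.Perm.sign σ • a v from
      a.toAlternatingMap.map_perm v σ, smul_smul, Int.units_mul_self, one_smul]
  rw [Finset.sum_congr rfl fun σ _ => this σ, Finset.sum_const, Finset.card_univ,
    Fintype.card_perm, Fintype.card_fin, ← Nat.cast_smul_eq_nsmul ℝ, smul_smul,
    inv_mul_cancel₀ (by exact_mod_cast Nat.factorial_ne_zero p), one_smul]

variable {n : WithTop ℕ∞} {x : G}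

/-- For multilinear maps, pullback is linear in the form and continuous multilinear in copies of the
linear map. Alternating forms are embedded there and recovered by `alternatingProj`. -/
theorem contDiffAt_compContinuousLinearMap {p : ℕ} {a : G → F [⋀^Fin p]→L[ℝ] ℂ}
    {g : G → E →L[ℝ] F} (ha : ContDiffAt ℝ n a x) (hg : ContDiffAt ℝ n g x) :
    ContDiffAt ℝ n (fun y => (a y).compContinuousLinearMap (g y)) x := by
  have h1 : ContDiffAt ℝ n (fun y => (a y).toContinuousMultilinearMap) x :=
    (ContinuousAlternatingMap.toContinuousMultilinearMapLI (𝕜 := ℝ) (E := F) (F := ℂ)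
      (ι := Fin p)).toContinuousLinearMap.contDiff.contDiffAt.comp x ha
  have h2 : ContDiffAt ℝ n (fun y =>
      ContinuousMultilinearMap.compContinuousLinearMapContinuousMultilinear ℝ
        (fun _ : Fin p => E) (fun _ : Fin p => F) ℂ (fun _ => g y)) x :=
    (ContinuousMultilinearMap.contDiff _).contDiffAt.comp x (contDiffAt_pi.2 fun _ => hg)
  have h3 := (alternatingProj (E := E) p).contDiff.contDiffAt.comp x (h2.clm_apply h1)
  refine h3.congr_of_eventuallyEq (Filter.Eventually.of_forall fun y => ?_)
  exact (alternatingProj_apply ((a y).compContinuousLinearMap (g y))).symm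

theorem contDiffAt_wedge {p q : ℕ} {a : G → E [⋀^Fin p]→L[ℝ] ℂ} {b : G → E [⋀^Fin q]→L[ℝ] ℂ}
    (ha : ContDiffAt ℝ n a x) (hb : ContDiffAt ℝ n b x) :
    ContDiffAt ℝ n (fun y => wedge (a y) (b y)) x := by
  have h : ContDiff ℝ n (fun z : (E [⋀^Fin p]→L[ℝ] ℂ) × (E [⋀^Fin q]→L[ℝ] ℂ) =>
      wedge z.1 z.2) := (wedgeL (E := E) p q).isBoundedBilinearMap.contDiff
  exact ContDiffAt.comp (f := fun y => (a y, b y)) x h.contDiffAt (ha.prodMk hb)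

theorem contDiffAt_wedgePow {γ : G → E [⋀^Fin 2]→L[ℝ] ℂ} (h : ContDiffAt ℝ n γ x) (N : ℕ) :
    ContDiffAt ℝ n (fun y => wedgePow (γ y) N) x := by
  induction N with
  | zero => exact contDiffAt_const
  | succ N ih => exact contDiffAt_wedge ih h

theorem contDiffAt_extDeriv {p : ℕ} {a : E → E [⋀^Fin p]→L[ℝ] ℂ} {x : E}
    (ha : ContDiffAt ℝ ∞ a x) : ContDiffAt ℝ ∞ (extDeriv a) x := by
  have h : ContDiffAt ℝ ∞ (fderiv ℝ a) x := ha.fderiv_right (m := ∞) (by simp)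
  exact (ContinuousAlternatingMap.alternatizeUncurryFinCLM (n := p) ℝ E ℂ).contDiff.contDiffAt.comp
    x h

end SmoothForms

theorem minSmoothness_two_le_infty : minSmoothness ℝ 2 ≤ (∞ : WithTop ℕ∞) := by
  rw [minSmoothness_of_isRCLikeNormedField]
  exact WithTop.coe_le_coe.2 le_top

/-! ### Forms in holomorphic charts. -/

section Charts

variable {E : Type*} [NormedAddCommGroup E] [NormedSpace ℂ E]
  {F : Type*} [NormedAddCommGroup F] [NormedSpace ℂ F]
  {F' : Type*} [NormedAddCommGroup F'] [NormedSpace ℂ F']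
  {X : Type*} [TopologicalSpace X] [ChartedSpace E X]

theorem isHolomorphicChart_of_mem_atlas [IsManifold 𝓘(ℂ, E) ω X] {e : OpenPartialHomeomorph X E}
    (he : e ∈ atlas E X) : IsHolomorphicChart E e :=
  ⟨contMDiffOn_of_mem_maximalAtlas (IsManifold.subset_maximalAtlas he),
    contMDiffOn_symm_of_mem_maximalAtlas (IsManifold.subset_maximalAtlas he)⟩

theorem isHolomorphicChart_chartAt [IsManifold 𝓘(ℂ, E) ω X] (x : X) :
    IsHolomorphicChart E (chartAt E x) := isHolomorphicChart_of_mem_atlas (chart_mem_atlas E x)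

theorem IsHolomorphicChart.contDiffAt_transition {e : OpenPartialHomeomorph X F}
    {e' : OpenPartialHomeomorph X F'} (he : IsHolomorphicChart E e) (he' : IsHolomorphicChart E e')
    {y : F} (hy : y ∈ e.target) (hy' : e.symm y ∈ e'.source) :
    ContDiffAt ℂ ω (fun z => e' (e.symm z)) y := by
  have h1 : ContMDiffAt 𝓘(ℂ, F) 𝓘(ℂ, E) ω e.symm y :=
    he.2.contMDiffAt (e.open_target.mem_nhds hy)
  have h2 : ContMDiffAt 𝓘(ℂ, E) 𝓘(ℂ, F') ω e' (e.symm y) :=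
    he'.1.contMDiffAt (e'.open_source.mem_nhds hy')
  exact (h2.comp y h1).contDiffAt

theorem fderiv_real_eq {f : F → F'} {y : F} (hf : DifferentiableAt ℂ f y) :
    fderiv ℝ f y = (fderiv ℂ f y).restrictScalars ℝ :=
  (hf.hasFDerivAt.restrictScalars ℝ).fderiv

theorem contDiffAt_real_of_complex {f : F → F'} {y : F} (hf : ContDiffAt ℂ ω f y) :
    ContDiffAt ℝ ∞ f y := (hf.restrict_scalars ℝ).of_le le_top

/-- The cocycle rule for derivatives of transition maps. Coordinate independence of forms rests on
it, and with c = e it gives the injectivity of these derivatives. -/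
theorem fderiv_comp_transition {e : OpenPartialHomeomorph X F}
    {e' : OpenPartialHomeomorph X F'} {F'' : Type*} [NormedAddCommGroup F''] [NormedSpace ℂ F'']
    {c : OpenPartialHomeomorph X F''}
    (he : IsHolomorphicChart E e) (he' : IsHolomorphicChart E e') (hc : IsHolomorphicChart E c)
    {y : F} (hy : y ∈ e.target) (hy' : e.symm y ∈ e'.source) (hyc : e.symm y ∈ c.source) :
    fderiv ℝ (fun z => c (e.symm z)) y = (fderiv ℝ (fun z => c (e'.symm z)) (e' (e.symm y))).comp
      (fderiv ℝ (fun z => e' (e.symm z)) y) := by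
  have h1 := contDiffAt_real_of_complex (he.contDiffAt_transition he' hy hy')
  have h2 : ContDiffAt ℝ ∞ (fun z => c (e'.symm z)) (e' (e.symm y)) := by
    refine contDiffAt_real_of_complex (he'.contDiffAt_transition hc (e'.map_source hy') ?_)
    rwa [e'.left_inv hy']
  have h3 : (fun z => c (e.symm z)) =ᶠ[𝓝 y]
      (fun z => c (e'.symm z)) ∘ (fun z => e' (e.symm z)) := by
    have : ∀ᶠ z in 𝓝 y, e.symm z ∈ e'.source :=
      (e.continuousAt_symm hy).preimage_mem_nhds (e'.open_source.mem_nhds hy')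
    filter_upwards [this] with z hz
    simp [e'.left_inv hz]
  rw [h3.fderiv_eq, fderiv_comp y (h2.differentiableAt (by simp)) (h1.differentiableAt (by simp))]

variable [IsManifold 𝓘(ℂ, E) ω X]

/-- Change of coordinates for the coordinate expression of a form. -/
theorem inChart_change {p : ℕ} (θ : DForm E X p) {e : OpenPartialHomeomorph X F}
    {e' : OpenPartialHomeomorph X F'} (he : IsHolomorphicChart E e) (he' : IsHolomorphicChart E e')
    {y : F} (hy : y ∈ e.target) (hy' : e.symm y ∈ e'.source) :
    inChart θ e y = (inChart θ e' (e' (e.symm y))).compContinuousLinearMap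
      (fderiv ℝ (fun z => e' (e.symm z)) y) := by
  rw [inChart, inChart, e'.left_inv hy', fderiv_comp_transition he he'
    (isHolomorphicChart_chartAt (e.symm y)) hy hy' (mem_chart_source E _)]
  rfl

omit [IsManifold 𝓘(ℂ, E) ω X] in
theorem inChart_chartAt {p : ℕ} (θ : DForm E X p) (x : X) :
    inChart θ (chartAt E x) (chartAt E x x) = θ x := by
  rw [inChart, (chartAt E x).left_inv (mem_chart_source E x)]
  have : (fun z => chartAt E x ((chartAt E x).symm z)) =ᶠ[𝓝 (chartAt E x x)] id := by
    filter_upwards [(chartAt E x).open_target.mem_nhds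
      ((chartAt E x).map_source (mem_chart_source E x))] with z hz
    exact (chartAt E x).right_inv hz
  rw [this.fderiv_eq, fderiv_id]
  rfl

theorem form_apply_eq_inChart {p : ℕ} (θ : DForm E X p) {e : OpenPartialHomeomorph X F}
    (he : IsHolomorphicChart E e) {x : X} (hx : x ∈ e.source) :
    θ x = (inChart θ e (e x)).compContinuousLinearMap
      (fderiv ℝ (fun z => e ((chartAt E x).symm z)) (chartAt E x x)) := by
  have hl := (chartAt E x).left_inv (mem_chart_source E x)
  have := inChart_change θ (isHolomorphicChart_chartAt x) he
    ((chartAt E x).map_source (mem_chart_source E x)) (by rwa [hl])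
  rwa [inChart_chartAt, hl] at this

theorem contDiffAt_inChart_change {p : ℕ} (θ : DForm E X p) {e : OpenPartialHomeomorph X F}
    {e' : OpenPartialHomeomorph X F'} (he : IsHolomorphicChart E e) (he' : IsHolomorphicChart E e')
    {y : F} (hy : y ∈ e.target) (hy' : e.symm y ∈ e'.source)
    (h : ContDiffAt ℝ ∞ (inChart θ e') (e' (e.symm y))) : ContDiffAt ℝ ∞ (inChart θ e) y := by
  have h1 := contDiffAt_real_of_complex (he.contDiffAt_transition he' hy hy')
  have h3 : ContDiffAt ℝ ∞ (fun z => inChart θ e' (e' (e.symm z))) y :=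
    ContDiffAt.comp (f := fun z => e' (e.symm z)) y h h1
  have h2 : ContDiffAt ℝ ∞ (fun z => (inChart θ e' (e' (e.symm z))).compContinuousLinearMap
      (fderiv ℝ (fun z => e' (e.symm z)) z)) y :=
    contDiffAt_compContinuousLinearMap h3 (h1.fderiv_right (m := ∞) (by simp))
  refine h2.congr_of_eventuallyEq ?_
  filter_upwards [(e.continuousAt_symm hy).preimage_mem_nhds (e'.open_source.mem_nhds hy'),
    e.open_target.mem_nhds hy] with z hz hz'
  exact inChart_change θ he he' hz' hz

theorem IsSmoothForm.contDiffAt {p : ℕ} {θ : DForm E X p} (h : IsSmoothForm θ)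
    {e : OpenPartialHomeomorph X F} (he : IsHolomorphicChart E e) {y : F} (hy : y ∈ e.target) :
    ContDiffAt ℝ ∞ (inChart θ e) y := by
  refine contDiffAt_inChart_change θ he (isHolomorphicChart_chartAt (e.symm y)) hy
    (mem_chart_source E _) ?_
  exact (h _ (chart_mem_atlas E _)).contDiffAt
    ((chartAt E _).open_target.mem_nhds ((chartAt E _).map_source (mem_chart_source E _)))

/-- Smoothness of a form may be checked in arbitrary holomorphic charts. -/
theorem isSmoothForm_of_local {p : ℕ} {θ : DForm E X p}
    (h : ∀ x, ∃ e : OpenPartialHomeomorph X F, IsHolomorphicChart E e ∧ x ∈ e.source ∧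
      ContDiffAt ℝ ∞ (inChart θ e) (e x)) : IsSmoothForm θ := by
  intro e he y hy
  obtain ⟨e', he', hx, h'⟩ := h (e.symm y)
  exact (contDiffAt_inChart_change θ (isHolomorphicChart_of_mem_atlas he) he' hy hx
    h').contDiffWithinAt

/-- The exterior derivative of a form on a manifold. -/
def dForm {p : ℕ} (η : DForm E X p) : DForm E X (p + 1) := fun x =>
  extDeriv (inChart η (chartAt E x)) (chartAt E x x)

/-- The exterior derivative is natural under pullback, and near y one coordinate expression is the
pullback of the other by the transition map. -/
theorem extDeriv_inChart_change {p : ℕ} {η : DForm E X p} (h : IsSmoothForm η)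
    {e : OpenPartialHomeomorph X F} {e' : OpenPartialHomeomorph X F'}
    (he : IsHolomorphicChart E e) (he' : IsHolomorphicChart E e')
    {y : F} (hy : y ∈ e.target) (hy' : e.symm y ∈ e'.source) :
    extDeriv (inChart η e) y = (extDeriv (inChart η e') (e' (e.symm y))).compContinuousLinearMap
      (fderiv ℝ (fun z => e' (e.symm z)) y) := by
  have h1 := contDiffAt_real_of_complex (he.contDiffAt_transition he' hy hy')
  rw [← extDeriv_pullback (f := fun z => e' (e.symm z))
    ((h.contDiffAt he' (e'.map_source hy')).differentiableAt (by simp)) h1 minSmoothness_two_le_infty]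
  refine Filter.EventuallyEq.extDeriv_eq ?_
  filter_upwards [(e.continuousAt_symm hy).preimage_mem_nhds (e'.open_source.mem_nhds hy'),
    e.open_target.mem_nhds hy] with z hz hz'
  exact inChart_change η he he' hz' hz

theorem IsSmoothForm.extDeriv_inChart {p : ℕ} {η : DForm E X p} (h : IsSmoothForm η)
    {e : OpenPartialHomeomorph X F} (he : IsHolomorphicChart E e) {y : F} (hy : y ∈ e.target) :
    extDeriv (inChart η e) y = inChart (dForm η) e y := by
  rw [extDeriv_inChart_change h he (isHolomorphicChart_chartAt (e.symm y)) hy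
    (mem_chart_source E _)]
  rfl

theorem IsSmoothForm.isExtDeriv_dForm {p : ℕ} {η : DForm E X p} (h : IsSmoothForm η) :
    IsExtDeriv η (dForm η) :=
  fun _ he _ hy => h.extDeriv_inChart (isHolomorphicChart_of_mem_atlas he) hy

theorem IsSmoothForm.dForm {p : ℕ} {η : DForm E X p} (h : IsSmoothForm η) :
    IsSmoothForm (dForm η) := by
  intro e he y hy
  have he' := isHolomorphicChart_of_mem_atlas he
  refine ((contDiffAt_extDeriv (h.contDiffAt he' hy)).congr_of_eventuallyEq
    ?_).contDiffWithinAt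
  filter_upwards [e.open_target.mem_nhds hy] with z hz
  exact (h.extDeriv_inChart he' hz).symm

omit [IsManifold 𝓘(ℂ, E) ω X] in
theorem IsExtDeriv.eq_dForm {p : ℕ} {η : DForm E X p} {θ : DForm E X (p + 1)}
    (h : IsExtDeriv η θ) : θ = CplxFib.dForm η := by
  funext x
  rw [← inChart_chartAt θ x, ← h _ (chart_mem_atlas E x) _
    ((chartAt E x).map_source (mem_chart_source E x))]
  rfl

theorem isClosedForm_of_dForm_eq_zero {p : ℕ} {η : DForm E X p} (h : IsSmoothForm η)
    (h0 : CplxFib.dForm η = 0) : IsClosedForm η := by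
  intro e he y hy
  rw [h.extDeriv_inChart (isHolomorphicChart_of_mem_atlas he) hy, h0]
  rfl

omit [IsManifold 𝓘(ℂ, E) ω X] in
theorem IsClosedForm.dForm_eq_zero {p : ℕ} {η : DForm E X p} (h : IsClosedForm η) :
    CplxFib.dForm η = 0 := by
  funext x
  exact h _ (chart_mem_atlas E x) _ ((chartAt E x).map_source (mem_chart_source E x))

end Charts

/-! ### Exterior calculus on a manifold. -/

section FormAlgebra

variable {E : Type*} [NormedAddCommGroup E] [NormedSpace ℂ E]
  {F : Type*} [NormedAddCommGroup F] [NormedSpace ℂ F]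
  {X : Type*} [TopologicalSpace X] [ChartedSpace E X]

theorem inChart_add {p : ℕ} (θ η : DForm E X p) (e : OpenPartialHomeomorph X F) :
    inChart (θ + η) e = inChart θ e + inChart η e := rfl

theorem inChart_wedge {p q : ℕ} (θ : DForm E X p) (η : DForm E X q)
    (e : OpenPartialHomeomorph X F) :
    inChart (fun x => wedge (θ x) (η x)) e = fun y => wedge (inChart θ e y) (inChart η e y) :=
  funext fun _ => wedge_compContinuousLinearMap _ _ _

theorem inChart_wedgePow (γ : DForm E X 2) (N : ℕ) (e : OpenPartialHomeomorph X F) :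
    inChart (fun x => wedgePow (γ x) N) e = fun y => wedgePow (inChart γ e y) N :=
  funext fun _ => wedgePow_compContinuousLinearMap _ _ _

theorem inChart_castDegree {p q : ℕ} (h : p = q) (θ : DForm E X p)
    (e : OpenPartialHomeomorph X F) :
    inChart (fun x => castDegree h (θ x)) e = fun y => castDegree h (inChart θ e y) := rfl

theorem inChart_smul {p : ℕ} (ρ : X → ℝ) (θ : DForm E X p) (e : OpenPartialHomeomorph X F) :
    inChart (fun x => ρ x • θ x) e = fun y => ρ (e.symm y) • inChart θ e y := rfl

theorem IsSmoothForm.add {p : ℕ} {θ η : DForm E X p} (hθ : IsSmoothForm θ) (hη : IsSmoothForm η) :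
    IsSmoothForm (θ + η) := fun e he => (hθ e he).add (hη e he)

theorem IsSmoothForm.sub {p : ℕ} {θ η : DForm E X p} (hθ : IsSmoothForm θ) (hη : IsSmoothForm η) :
    IsSmoothForm (θ - η) := fun e he => (hθ e he).sub (hη e he)

theorem isSmoothForm_zero {p : ℕ} : IsSmoothForm (0 : DForm E X p) :=
  fun e _ => contDiffOn_const (c := (0 : E [⋀^Fin p]→L[ℝ] ℂ)) (s := e.target)

theorem IsSmoothForm.sum {p : ℕ} {ι : Type*} (s : Finset ι) {θ : ι → DForm E X p}
    (hθ : ∀ i, IsSmoothForm (θ i)) : IsSmoothForm (∑ i ∈ s, θ i) := by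
  classical
  induction s using Finset.induction_on with
  | empty => exact isSmoothForm_zero
  | insert i s hi ih => rw [Finset.sum_insert hi]; exact (hθ i).add ih

theorem IsSmoothForm.wedge {p q : ℕ} {θ : DForm E X p} {η : DForm E X q} (hθ : IsSmoothForm θ)
    (hη : IsSmoothForm η) : IsSmoothForm (fun x => CplxFib.wedge (θ x) (η x)) := by
  intro e he y hy
  rw [inChart_wedge]
  exact (contDiffAt_wedge ((hθ e he).contDiffAt (e.open_target.mem_nhds hy))
    ((hη e he).contDiffAt (e.open_target.mem_nhds hy))).contDiffWithinAt

theorem IsSmoothForm.wedgePow {γ : DForm E X 2} (h : IsSmoothForm γ) (N : ℕ) :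
    IsSmoothForm (fun x => CplxFib.wedgePow (γ x) N) := by
  intro e he y hy
  rw [inChart_wedgePow]
  exact (contDiffAt_wedgePow ((h e he).contDiffAt (e.open_target.mem_nhds hy))
    N).contDiffWithinAt

theorem IsSmoothForm.castDegree {p q : ℕ} (h : p = q) {θ : DForm E X p} (hθ : IsSmoothForm θ) :
    IsSmoothForm (fun x => CplxFib.castDegree h (θ x)) := by
  subst h; exact hθ

theorem dForm_castDegree {p q : ℕ} (h : p = q) (θ : DForm E X p) :
    dForm (fun x => castDegree h (θ x)) = fun x => castDegree (by omega) (dForm θ x) := by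
  subst h; rfl

theorem IsSmoothForm.differentiableAt_inChart {p : ℕ} {θ : DForm E X p} (h : IsSmoothForm θ)
    (x : X) : DifferentiableAt ℝ (inChart θ (chartAt E x)) (chartAt E x x) :=
  ((h _ (chart_mem_atlas E x)).contDiffAt ((chartAt E x).open_target.mem_nhds
    ((chartAt E x).map_source (mem_chart_source E x)))).differentiableAt (by simp)

theorem dForm_add {p : ℕ} {θ η : DForm E X p} (hθ : IsSmoothForm θ) (hη : IsSmoothForm η) :
    dForm (θ + η) = dForm θ + dForm η := by
  funext x
  exact extDeriv_add (hθ.differentiableAt_inChart x) (hη.differentiableAt_inChart x)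

theorem dForm_zero {p : ℕ} : dForm (0 : DForm E X p) = 0 := by
  funext x
  have : inChart (0 : DForm E X p) (chartAt E x) = fun _ => 0 := rfl
  rw [dForm, this, extDeriv]
  simp only [fderiv_fun_const, Pi.zero_apply]
  exact map_zero (ContinuousAlternatingMap.alternatizeUncurryFinCLM ℝ E ℂ)

theorem dForm_sum {p : ℕ} {ι : Type*} (s : Finset ι) {θ : ι → DForm E X p}
    (hθ : ∀ i, IsSmoothForm (θ i)) : dForm (∑ i ∈ s, θ i) = ∑ i ∈ s, dForm (θ i) := by
  classical
  induction s using Finset.induction_on with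
  | empty => exact dForm_zero
  | insert i s hi ih =>
    rw [Finset.sum_insert hi, Finset.sum_insert hi, dForm_add (hθ i) (IsSmoothForm.sum s hθ), ih]

theorem dForm_sub {p : ℕ} {θ η : DForm E X p} (hθ : IsSmoothForm θ) (hη : IsSmoothForm η) :
    dForm (θ - η) = dForm θ - dForm η := by
  have := dForm_add (hθ.sub hη) hη
  rw [sub_add_cancel] at this
  rw [this, add_sub_cancel_right]

theorem dForm_wedge {p q : ℕ} (h : p + 1 + q = p + q + 1) {θ : DForm E X p} {η : DForm E X q}
    (hθ : IsSmoothForm θ) (hη : IsSmoothForm η) :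
    dForm (fun x => wedge (θ x) (η x)) = fun x => castDegree h (wedge (dForm θ x) (η x)) +
      ((-1 : ℝ) ^ p) • wedge (q := q + 1) (θ x) (dForm η x) := by
  funext x
  have := extDeriv_wedge h (hθ.differentiableAt_inChart x) (hη.differentiableAt_inChart x)
  rw [dForm, inChart_wedge, this, inChart_chartAt, inChart_chartAt]
  rfl

theorem wedge_zero_left {p q : ℕ} (β : E [⋀^Fin q]→L[ℝ] ℂ) :
    wedge (0 : E [⋀^Fin p]→L[ℝ] ℂ) β = 0 := by
  rw [← wedgeL_apply, map_zero]; rfl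

theorem wedge_zero_right {p q : ℕ} (α : E [⋀^Fin p]→L[ℝ] ℂ) :
    wedge α (0 : E [⋀^Fin q]→L[ℝ] ℂ) = 0 := by
  rw [← wedgeL_apply, map_zero]

theorem castDegree_zero {p q : ℕ} (h : p = q) : castDegree h (0 : E [⋀^Fin p]→L[ℝ] ℂ) = 0 := rfl

theorem dForm_wedge_of_closed_right {p q : ℕ} (h : p + 1 + q = p + q + 1) {θ : DForm E X p}
    {η : DForm E X q} (hθ : IsSmoothForm θ) (hη : IsSmoothForm η) (h0 : dForm η = 0) :
    dForm (fun x => wedge (θ x) (η x)) = fun x => castDegree h (wedge (dForm θ x) (η x)) := by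
  rw [dForm_wedge h hθ hη, h0]
  funext x
  rw [show (0 : DForm E X (q + 1)) x = 0 from rfl, wedge_zero_right]
  exact (congrArg (castDegree h _ + ·)
    (smul_zero (A := E [⋀^Fin (p + q + 1)]→L[ℝ] ℂ) ((-1 : ℝ) ^ p))).trans (add_zero _)

theorem dForm_wedge_of_closed_left {p q : ℕ} (hp : Even p) {θ : DForm E X p}
    {η : DForm E X q} (hθ : IsSmoothForm θ) (hη : IsSmoothForm η) (h0 : dForm θ = 0) :
    dForm (fun x => wedge (θ x) (η x)) = fun x => wedge (q := q + 1) (θ x) (dForm η x) := by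
  rw [dForm_wedge (by omega) hθ hη, h0]
  funext x
  rw [show (0 : DForm E X (p + 1)) x = 0 from rfl, wedge_zero_left, castDegree_zero, zero_add,
    hp.neg_one_pow, one_smul]

/-- The wedge powers of a closed 2-form are closed. -/
theorem dForm_wedgePow {γ : DForm E X 2} (h : IsSmoothForm γ) (hc : dForm γ = 0) (N : ℕ) :
    dForm (fun x => wedgePow (γ x) N) = 0 := by
  induction N with
  | zero =>
    funext x
    have : inChart (fun x => wedgePow (γ x) 0) (chartAt E x) = fun _ =>
      ContinuousAlternatingMap.constOfIsEmpty ℝ E (Fin 0) (1 : ℂ) := rfl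
    rw [dForm, this, extDeriv]
    simp only [fderiv_fun_const, Pi.zero_apply]
    exact map_zero (ContinuousAlternatingMap.alternatizeUncurryFinCLM ℝ E ℂ)
  | succ N ih =>
    have := dForm_wedge_of_closed_left (p := 2 * N) (q := 2) (even_two_mul N) (h.wedgePow N) h ih
    refine this.trans ?_
    rw [hc]
    funext x
    exact wedge_zero_right _

/-- The wedge powers of cohomologous closed 2-forms are cohomologous. -/
theorem exists_dForm_eq_wedgePow_sub {γ₀ γ₁ : DForm E X 2} {η : DForm E X 1}
    (h₀ : IsSmoothForm γ₀) (h₁ : IsSmoothForm γ₁) (hη : IsSmoothForm η) (hc₀ : dForm γ₀ = 0)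
    (hc₁ : dForm γ₁ = 0) (h : dForm η = γ₁ - γ₀) (N : ℕ) :
    ∃ ζ : DForm E X (2 * N + 1), IsSmoothForm ζ ∧
      dForm ζ = fun x => wedgePow (γ₁ x) (N + 1) - wedgePow (γ₀ x) (N + 1) := by
  have key : ∀ N : ℕ, dForm (fun x => wedge (wedgePow (γ₀ x) N) (η x)) =
      fun x => wedge (wedgePow (γ₀ x) N) (γ₁ x) - wedge (wedgePow (γ₀ x) N) (γ₀ x) := by
    intro N
    have := dForm_wedge_of_closed_left (p := 2 * N) (q := 1) (even_two_mul N) (h₀.wedgePow N) hη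
      (dForm_wedgePow h₀ hc₀ N)
    refine this.trans ?_
    rw [h]
    funext x
    exact wedge_sub_right _ _ _
  induction N with
  | zero =>
    exact ⟨fun x => wedge (wedgePow (γ₀ x) 0) (η x), (h₀.wedgePow 0).wedge hη, key 0⟩
  | succ N ih =>
    obtain ⟨ζ, hζ, hd⟩ := ih
    have hs1 : IsSmoothForm (fun x => wedge (ζ x) (γ₁ x)) := hζ.wedge h₁
    have hs2 : IsSmoothForm (fun x => wedge (wedgePow (γ₀ x) (N + 1)) (η x)) :=
      (h₀.wedgePow (N + 1)).wedge hη
    -- Telescoping: γ₁^{N+2} - γ₀^{N+2} = (γ₁^{N+1} - γ₀^{N+1}) ∧ γ₁ + γ₀^{N+1} ∧ (γ₁ - γ₀). The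
    -- first summand is d(ζ ∧ γ₁) and the second is d(γ₀^{N+1} ∧ η), since γ₀ and γ₁ are closed.
    refine ⟨(fun x => wedge (ζ x) (γ₁ x)) + fun x => wedge (wedgePow (γ₀ x) (N + 1)) (η x),
      hs1.add hs2, ?_⟩
    refine (dForm_add hs1 hs2).trans ?_
    have e1 := dForm_wedge_of_closed_right (p := 2 * N + 1) (q := 2) (by omega) hζ h₁ hc₁
    rw [hd] at e1
    refine (congrArg₂ (· + ·) e1 (key (N + 1))).trans ?_
    funext x
    have e2 : wedge (wedgePow (γ₁ x) (N + 1) - wedgePow (γ₀ x) (N + 1)) (γ₁ x) =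
      wedge (wedgePow (γ₁ x) (N + 1)) (γ₁ x) - wedge (wedgePow (γ₀ x) (N + 1)) (γ₁ x) :=
      wedge_sub_left _ _ _
    change wedge (wedgePow (γ₁ x) (N + 1) - wedgePow (γ₀ x) (N + 1)) (γ₁ x) +
      (wedge (wedgePow (γ₀ x) (N + 1)) (γ₁ x) -
        wedge (wedgePow (γ₀ x) (N + 1)) (γ₀ x)) = wedge (wedgePow (γ₁ x) (N + 1)) (γ₁ x) -
        wedge (wedgePow (γ₀ x) (N + 1)) (γ₀ x)
    rw [e2]
    exact sub_add_sub_cancel _ _ _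

end FormAlgebra

/-! ### Integrals depending on a parameter. -/

section ParametricIntegral

open MeasureTheory

variable {B : Type*} [NormedAddCommGroup B] [NormedSpace ℝ B]
  {V : Type*} [NormedAddCommGroup V] [NormedSpace ℝ V] [FiniteDimensional ℝ V]
  [MeasureSpace V] [BorelSpace V] [(volume : Measure V).IsAddHaarMeasure]
  {G : Type*} [NormedAddCommGroup G] [NormedSpace ℝ G] [CompleteSpace G]

omit [NormedSpace ℝ B] [NormedSpace ℝ V] [FiniteDimensional ℝ V] [MeasureSpace V] [BorelSpace V]
  [(volume : Measure V).IsAddHaarMeasure] in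
theorem hasCompactSupport_slice {G : Type*} [Zero G] {g : B × V → G} (hg : HasCompactSupport g)
    (z : B) : HasCompactSupport fun v => g (z, v) :=
  HasCompactSupport.intro (hg.isCompact.image continuous_snd) fun _ hv =>
    image_eq_zero_of_notMem_tsupport fun h => hv ⟨_, h, rfl⟩

omit [NormedSpace ℝ G] [CompleteSpace G] in
omit [NormedSpace ℝ B] [NormedSpace ℝ V] [FiniteDimensional ℝ V] in
theorem integrable_slice {g : B × V → G} (hg : Continuous g) (hc : HasCompactSupport g) (z : B) :
    Integrable fun v => g (z, v) :=
  (hg.comp (by fun_prop)).integrable_of_hasCompactSupport (hasCompactSupport_slice hc z)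

omit [CompleteSpace G] in
-- The integral is a convolution with the constant function 1, evaluated at 0. Convolution with a
-- parameter is smooth when the supports lie in a common compact set.
theorem contDiff_integral_slice {g : B × V → G} (hg : ContDiff ℝ ∞ g)
    (hc : HasCompactSupport g) : ContDiff ℝ ∞ fun z => ∫ v, g (z, v) := by
  have h := contDiffOn_convolution_right_with_param_comp (μ := (volume : Measure V)) (𝕜 := ℝ)
    (n := ⊤) (ContinuousLinearMap.lsmul ℝ ℝ : ℝ →L[ℝ] G →L[ℝ] G) (s := (Set.univ : Set B))
    (v := fun _ => (0 : V)) contDiffOn_const (f := fun _ => (1 : ℝ)) (g := fun z v => g (z, v))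
    (k := Prod.snd '' tsupport g) isOpen_univ (hc.isCompact.image continuous_snd)
    (fun z v _ hv => image_eq_zero_of_notMem_tsupport fun h => hv ⟨_, h, rfl⟩)
    (locallyIntegrable_const _) hg.contDiffOn
  rw [contDiffOn_univ] at h
  convert h using 2 with z
  rw [convolution_def]
  simp only [zero_sub, ContinuousLinearMap.lsmul_apply, one_smul]
  exact (integral_neg_eq_self (fun v => g (z, v)) volume).symm

omit [CompleteSpace G] in
theorem hasFDerivAt_integral_slice {g : B × V → G} (hg : ContDiff ℝ ∞ g)
    (hc : HasCompactSupport g) (z : B) :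
    HasFDerivAt (fun z => ∫ v, g (z, v))
      (∫ v, (fderiv ℝ g (z, v)).comp (ContinuousLinearMap.inl ℝ B V)) z := by
  have hd : Continuous (fderiv ℝ g) := hg.continuous_fderiv (by simp)
  have hdc : HasCompactSupport (fderiv ℝ g) := hc.fderiv ℝ
  have hd' : Continuous fun y => (fderiv ℝ g y).comp (ContinuousLinearMap.inl ℝ B V) := by
    fun_prop
  have hdc' : HasCompactSupport fun y => (fderiv ℝ g y).comp (ContinuousLinearMap.inl ℝ B V) :=
    hdc.comp_left (g := fun l : B × V →L[ℝ] G => l.comp (ContinuousLinearMap.inl ℝ B V))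
      (ContinuousLinearMap.zero_comp _)
  -- The dominating function is C on the projection of the support to V and zero elsewhere,
  -- uniformly in z.
  obtain ⟨C, hC⟩ := hdc'.exists_bound_of_continuous hd'
  have hK : IsCompact (Prod.snd '' tsupport g) := hc.isCompact.image continuous_snd
  refine hasFDerivAt_integral_of_dominated_of_fderiv_le (s := Set.univ)
    (bound := (Prod.snd '' tsupport g).indicator fun _ => C)
    (F' := fun z v => (fderiv ℝ g (z, v)).comp (ContinuousLinearMap.inl ℝ B V)) Filter.univ_mem
    (Filter.Eventually.of_forall fun z => (integrable_slice hg.continuous hc z).1)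
    (integrable_slice hg.continuous hc z)
    (hd'.comp (by fun_prop : Continuous fun v : V => (z, v))).aestronglyMeasurable
    (Filter.Eventually.of_forall fun v z' _ => ?_)
    ((integrable_indicator_iff hK.measurableSet).2 (integrableOn_const hK.measure_lt_top.ne))
    (Filter.Eventually.of_forall fun v z' _ => ?_)
  · by_cases hv : v ∈ Prod.snd '' tsupport g
    · rw [Set.indicator_of_mem hv]; exact hC _
    · have : fderiv ℝ g (z', v) = 0 := image_eq_zero_of_notMem_tsupport fun h =>
        hv ⟨_, tsupport_fderiv_subset ℝ h, rfl⟩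
      rw [Set.indicator_of_notMem hv, this, ContinuousLinearMap.zero_comp, norm_zero]
  · exact ((hg.differentiable (by simp)) (z', v)).hasFDerivAt.comp z' (hasFDerivAt_prodMk_left z' v)

theorem map_fderiv_integral_slice {H : Type*} [NormedAddCommGroup H] [NormedSpace ℝ H]
    [CompleteSpace H] (Λ : (B →L[ℝ] G) →L[ℝ] H) {g : B × V → G} (hg : ContDiff ℝ ∞ g)
    (hc : HasCompactSupport g) (z : B) : Λ (fderiv ℝ (fun z => ∫ v, g (z, v)) z) =
      ∫ v, Λ ((fderiv ℝ g (z, v)).comp (ContinuousLinearMap.inl ℝ B V)) := by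
  have hd : Continuous (fderiv ℝ g) := hg.continuous_fderiv (by simp)
  have hi : Integrable fun v => (fderiv ℝ g (z, v)).comp (ContinuousLinearMap.inl ℝ B V) :=
    integrable_slice (g := fun y => (fderiv ℝ g y).comp (ContinuousLinearMap.inl ℝ B V))
      (by fun_prop) ((hc.fderiv ℝ).comp_left
        (g := fun l : B × V →L[ℝ] G => l.comp (ContinuousLinearMap.inl ℝ B V))
        (ContinuousLinearMap.zero_comp _)) z
  rw [(hasFDerivAt_integral_slice hg hc z).fderiv, ← ContinuousLinearMap.integral_comp_comm _ hi]

omit [CompleteSpace G] in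
-- Integration by parts against the constant function 1; compact support leaves no boundary term.
theorem integral_fderiv_slice_eq_zero {g : B × V → G} (hg : ContDiff ℝ ∞ g)
    (hc : HasCompactSupport g) (z : B) (w : V) : ∫ v, fderiv ℝ g (z, v) (0, w) = 0 := by
  have hd : Continuous fun y => fderiv ℝ g y (0, w) :=
    (hg.continuous_fderiv (by simp)).clm_apply continuous_const
  have hdc : HasCompactSupport fun y => fderiv ℝ g y (0, w) :=
    (hc.fderiv ℝ).comp_left (g := fun l : B × V →L[ℝ] G => l (0, w)) rfl
  have hs : ∀ v, HasFDerivAt (fun v => g (z, v))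
      ((fderiv ℝ g (z, v)).comp (ContinuousLinearMap.inr ℝ B V)) v := fun v =>
    ((hg.differentiable (by simp)) (z, v)).hasFDerivAt.comp v (hasFDerivAt_prodMk_right z v)
  have := integral_bilinear_hasFDerivAt_right_eq_neg_left_of_integrable
    (μ := (volume : Measure V)) (f := fun _ : V => (1 : ℝ)) (f' := fun _ => 0)
    (g := fun v => g (z, v)) (v := w)
    (g' := fun v => (fderiv ℝ g (z, v)).comp (ContinuousLinearMap.inr ℝ B V))
    (B := (ContinuousLinearMap.lsmul ℝ ℝ : ℝ →L[ℝ] G →L[ℝ] G))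
    (by simp) (by simpa using integrable_slice hd hdc z)
    (by simpa using integrable_slice hg.continuous hc z)
    (fun v _ => hasFDerivAt_const _ _) (fun v _ => hs v)
  simpa using this

end ParametricIntegral

/-! ### Cartan's formula for constant vector fields. -/

section Cartan

variable {E : Type*} [NormedAddCommGroup E] [NormedSpace ℂ E]
  {G : Type*} [NormedAddCommGroup G] [NormedSpace ℝ G]

theorem contDiff_curryLeft {p : ℕ} {A : G → E [⋀^Fin (p + 1)]→L[ℝ] ℂ} (hA : ContDiff ℝ ∞ A)
    (v : E) : ContDiff ℝ ∞ fun y => (A y).curryLeft v := by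
  have h := (contractL (r := p) 1 fun _ => v).contDiff.comp hA
  rwa [show (contractL (r := p) 1 fun _ => v) ∘ A = fun y => (A y).curryLeft v from
    funext fun y => contractL_apply (r := p) 1 (fun _ => v) (A y)] at h

omit [NormedSpace ℝ G] in
theorem hasCompactSupport_curryLeft {p : ℕ} {A : G → E [⋀^Fin (p + 1)]→L[ℝ] ℂ}
    (hc : HasCompactSupport A) (v : E) : HasCompactSupport fun y => (A y).curryLeft v :=
  hc.comp_left (g := fun a : E [⋀^Fin (p + 1)]→L[ℝ] ℂ => a.curryLeft v) rfl

theorem contDiff_castDegree {p q : ℕ} (h : p = q) {A : G → E [⋀^Fin p]→L[ℝ] ℂ}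
    (hA : ContDiff ℝ ∞ A) : ContDiff ℝ ∞ fun y => castDegree h (A y) := by
  subst h; exact hA

omit [NormedSpace ℝ G] in
theorem hasCompactSupport_castDegree {p q : ℕ} (h : p = q) {A : G → E [⋀^Fin p]→L[ℝ] ℂ}
    (hc : HasCompactSupport A) : HasCompactSupport fun y => castDegree h (A y) := by
  subst h; exact hc

theorem fderiv_castDegree {p q : ℕ} (h : p = q) (A : G → E [⋀^Fin p]→L[ℝ] ℂ) (y v : G) :
    fderiv ℝ (fun y => castDegree h (A y)) y v = castDegree h (fderiv ℝ A y v) := by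
  subst h; rfl

theorem contDiff_fderiv_apply {H : Type*} [NormedAddCommGroup H] [NormedSpace ℝ H] {A : G → H}
    (hA : ContDiff ℝ ∞ A) (v : G) : ContDiff ℝ ∞ fun y => fderiv ℝ A y v :=
  (hA.fderiv_right (m := ∞) (by simp)).clm_apply contDiff_const

theorem hasCompactSupport_fderiv_apply {H : Type*} [NormedAddCommGroup H] [NormedSpace ℝ H]
    {A : G → H} (hc : HasCompactSupport A) (v : G) : HasCompactSupport fun y => fderiv ℝ A y v :=
  (hc.fderiv ℝ).comp_left (g := fun l : G →L[ℝ] H => l v) rfl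

theorem extDeriv_eq_alternatizeCLM {p : ℕ}
    (a : E → E [⋀^Fin p]→L[ℝ] ℂ) (x : E) : extDeriv a x =
      ContinuousAlternatingMap.alternatizeUncurryFinCLM (n := p) ℝ E ℂ (fderiv ℝ a x) := rfl

theorem contDiff_extDeriv {p : ℕ}
    {a : E → E [⋀^Fin p]→L[ℝ] ℂ} (ha : ContDiff ℝ ∞ a) : ContDiff ℝ ∞ (extDeriv a) :=
  contDiff_iff_contDiffAt.2 fun _ => contDiffAt_extDeriv ha.contDiffAt

theorem hasCompactSupport_extDeriv {p : ℕ}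
    {a : E → E [⋀^Fin p]→L[ℝ] ℂ} (hc : HasCompactSupport a) : HasCompactSupport (extDeriv a) :=
  (hc.fderiv ℝ).comp_left
    (g := ContinuousAlternatingMap.alternatizeUncurryFinCLM (n := p) ℝ E ℂ) (map_zero _)

/-- Cartan's formula for a constant vector field. -/
theorem curryLeft_extDeriv {p : ℕ} {A : E → E [⋀^Fin (p + 1)]→L[ℝ] ℂ} {y : E}
    (h : DifferentiableAt ℝ A y) (v : E) :
    (extDeriv A y).curryLeft v = fderiv ℝ A y v - extDeriv (fun y => (A y).curryLeft v) y := by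
  have h' : DifferentiableAt ℝ (fun y => (A y).curryLeft v) y :=
    ((contractL (r := p) 1 fun _ => v).differentiableAt.comp y h).congr_of_eventuallyEq
      (Filter.Eventually.of_forall fun y => (contractL_apply (r := p) 1 (fun _ => v) (A y)).symm)
  ext w
  -- The summand of index 0 differentiates along v. The others are those of the exterior derivative
  -- of the contracted form with the index shifted by one, hence with the opposite sign.
  rw [ContinuousAlternatingMap.curryLeft_apply_apply, extDeriv_apply h, Fin.sum_univ_succ,
    ContinuousAlternatingMap.sub_apply, extDeriv_apply h', sub_eq_add_neg, ← Finset.sum_neg_distrib]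
  congr 1
  · have : HasFDerivAt (fun x => A x (Fin.removeNth 0 (Matrix.vecCons v w)))
        ((ContinuousAlternatingMap.apply ℝ E ℂ w).comp (fderiv ℝ A y)) y :=
      (ContinuousAlternatingMap.apply ℝ E ℂ w).hasFDerivAt.comp y h.hasFDerivAt
    rw [this.fderiv]
    simp
  · refine Finset.sum_congr rfl fun i _ => ?_
    have hw : ∀ x, A x (Fin.removeNth i.succ (Matrix.vecCons v w)) =
        (A x).curryLeft v (i.removeNth w) := by
      intro x
      rw [ContinuousAlternatingMap.curryLeft_apply_apply]
      congr 1
      exact Fin.cons_comp_succ_succAbove _ _ _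
    simp only [hw]
    rw [Matrix.cons_val_succ, Fin.val_succ, pow_succ, mul_neg_one, neg_smul]

theorem curryLeft_extDeriv_zero {A : E → E [⋀^Fin 0]→L[ℝ] ℂ} {y : E}
    (h : DifferentiableAt ℝ A y) (v : E) :
    (extDeriv A y).curryLeft v = fderiv ℝ A y v := by
  ext w
  rw [ContinuousAlternatingMap.curryLeft_apply_apply, extDeriv_apply h, Fin.sum_univ_succ]
  have : HasFDerivAt (fun x => A x (Fin.removeNth 0 (Matrix.vecCons v w)))
        ((ContinuousAlternatingMap.apply ℝ E ℂ w).comp (fderiv ℝ A y)) y :=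
      (ContinuousAlternatingMap.apply ℝ E ℂ w).hasFDerivAt.comp y h.hasFDerivAt
  rw [this.fderiv]
  simp

end Cartan

/-! ### Fibre integration on a product and the exterior derivative. -/

section FiberForm

open MeasureTheory

variable {B : Type*} [NormedAddCommGroup B] [NormedSpace ℂ B] {n : ℕ}

variable (B n) in
/-- The inclusion of the base directions as a real-linear map. -/
abbrev baseInl : B →L[ℝ] B × (Fin n → ℂ) :=
  (ContinuousLinearMap.inl ℂ B (Fin n → ℂ)).restrictScalars ℝ

/-- Contraction with vertical vectors followed by restriction to base directions. -/
def verticalContractL {r : ℕ} (q : ℕ) (f : Fin q → (Fin n → ℂ)) :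
    ((B × (Fin n → ℂ)) [⋀^Fin (r + q)]→L[ℝ] ℂ) →L[ℝ] B [⋀^Fin r]→L[ℝ] ℂ :=
  (ContinuousAlternatingMap.compContinuousLinearMapCLM (baseInl B n)).comp
    (contractL q fun j => ((0 : B), f j))

theorem verticalContractL_apply {r : ℕ} (q : ℕ) (f : Fin q → (Fin n → ℂ))
    (β : (B × (Fin n → ℂ)) [⋀^Fin (r + q)]→L[ℝ] ℂ) : verticalContractL q f β =
      (contract q (fun j => ((0 : B), f j)) β).compContinuousLinearMap (baseInl B n) := by
  rw [← contractL_apply]; rfl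

/-- The integral over the second factor of the contraction with constant vertical vectors. -/
def fiberForm {r : ℕ} (q : ℕ) (f : Fin q → (Fin n → ℂ))
    (A : B × (Fin n → ℂ) → (B × (Fin n → ℂ)) [⋀^Fin (r + q)]→L[ℝ] ℂ) (z : B) :
    B [⋀^Fin r]→L[ℝ] ℂ :=
  ∫ v, verticalContractL q f (A (z, v))

variable {r q : ℕ} {f : Fin q → (Fin n → ℂ)}
  {A A' : B × (Fin n → ℂ) → (B × (Fin n → ℂ)) [⋀^Fin (r + q)]→L[ℝ] ℂ}

theorem contDiff_verticalContractL (hA : ContDiff ℝ ∞ A) :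
    ContDiff ℝ ∞ fun y => verticalContractL q f (A y) :=
  have h : ContDiff ℝ ∞ (verticalContractL (B := B) (r := r) q f) :=
    ContinuousLinearMap.contDiff (verticalContractL (B := B) (r := r) q f)
  h.comp hA

theorem hasCompactSupport_verticalContractL (hc : HasCompactSupport A) :
    HasCompactSupport fun y => verticalContractL q f (A y) :=
  hc.comp_left (map_zero _)

theorem contDiff_fiberForm (hA : ContDiff ℝ ∞ A) (hc : HasCompactSupport A) :
    ContDiff ℝ ∞ (fiberForm q f A) :=
  contDiff_integral_slice (contDiff_verticalContractL hA) (hasCompactSupport_verticalContractL hc)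

theorem integrable_verticalContractL (hA : ContDiff ℝ ∞ A) (hc : HasCompactSupport A) (z : B) :
    Integrable fun v => verticalContractL q f (A (z, v)) :=
  integrable_slice (contDiff_verticalContractL hA).continuous
    (hasCompactSupport_verticalContractL hc) z

theorem fiberForm_sub (hA : ContDiff ℝ ∞ A) (hc : HasCompactSupport A) (hA' : ContDiff ℝ ∞ A')
    (hc' : HasCompactSupport A') (z : B) :
    fiberForm q f (fun y => A y - A' y) z = fiberForm q f A z - fiberForm q f A' z := by
  simp only [fiberForm, map_sub]
  exact integral_sub (integrable_verticalContractL hA hc z) (integrable_verticalContractL hA' hc' z)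

theorem fiberForm_fderiv_vertical (hA : ContDiff ℝ ∞ A) (hc : HasCompactSupport A) (z : B)
    (w : Fin n → ℂ) : fiberForm q f (fun y => fderiv ℝ A y (0, w)) z = 0 := by
  have := integral_fderiv_slice_eq_zero (contDiff_verticalContractL (f := f) hA)
    (hasCompactSupport_verticalContractL hc) z w
  rw [← this, fiberForm]
  congr 1
  funext v
  have h := (verticalContractL q f).hasFDerivAt.comp (z, v)
    ((hA.differentiable (by simp)) (z, v)).hasFDerivAt
  exact (congrArg (fun l => l ((0 : B), w)) h.fderiv).symm

/-- With nothing contracted, the integrand is the pullback to the slice z ↦ (z, v). Pullback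
commutes with d, and d passes under the integral because alternatization is continuous linear. -/
theorem extDeriv_fiberForm_zero {A : B × (Fin n → ℂ) → (B × (Fin n → ℂ)) [⋀^Fin r]→L[ℝ] ℂ}
    {f : Fin 0 → (Fin n → ℂ)} (hA : ContDiff ℝ ∞ A) (hc : HasCompactSupport A) (z : B) :
    extDeriv (fiberForm 0 f A) z = fiberForm (r := r + 1) 0 f (extDeriv A) z := by
  have h1 := contDiff_verticalContractL (r := r) (q := 0) (f := f) hA
  have h0 := map_fderiv_integral_slice
    (ContinuousAlternatingMap.alternatizeUncurryFinCLM (n := r) ℝ B ℂ) h1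
    (hasCompactSupport_verticalContractL hc) z
  refine h0.trans ?_
  rw [fiberForm]
  congr 1
  funext v
  have h2 := extDeriv_pullback (f := fun z : B => (z, v)) (x := z)
    ((hA.differentiable (by simp)) _) (r := ∞)
    ((contDiff_id.prodMk contDiff_const).contDiffAt) minSmoothness_two_le_infty
  have hfd : ∀ z : B, fderiv ℝ (fun z : B => (z, v)) z = baseInl B n := fun z =>
    (hasFDerivAt_prodMk_left z v).fderiv
  simp only [hfd] at h2
  rw [verticalContractL_apply]
  refine Eq.trans ?_ h2
  rw [extDeriv_eq_alternatizeCLM]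
  congr 1
  have h3 := h1.differentiable (by simp) (z, v)
  have h4 := h3.hasFDerivAt.comp z (hasFDerivAt_prodMk_left (𝕜 := ℝ) z v)
  refine Eq.trans h4.fderiv.symm ?_
  congr 1

theorem fiberForm_castDegree_succ {r p : ℕ} (q : ℕ) (f : Fin (q + 1) → (Fin n → ℂ))
    (h : p + 1 = r + (q + 1)) (A : B × (Fin n → ℂ) → (B × (Fin n → ℂ)) [⋀^Fin (p + 1)]→L[ℝ] ℂ)
    (z : B) : fiberForm (q + 1) f (fun y => castDegree h (A y)) z =
      fiberForm (r := r) q (fun j => f j.succ)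
        (fun y => castDegree (by omega) ((A y).curryLeft (0, f 0))) z := by
  simp only [fiberForm, verticalContractL_apply]
  congr 1
  funext v
  congr 1
  exact contract_castDegree_succ _ _ _

theorem castDegree_sub {E : Type*} [NormedAddCommGroup E] [NormedSpace ℂ E] {p q : ℕ} (h : p = q)
    (a b : E [⋀^Fin p]→L[ℝ] ℂ) : castDegree h (a - b) = castDegree h a - castDegree h b := rfl

/-- Cartan's formula for the constant vertical field (0, f 0): the derivative along the field
integrates to zero over the fibre, so contraction and d anticommute under the integral. -/
theorem fiberForm_castDegree_extDeriv {r p : ℕ} (q : ℕ) (f : Fin (q + 1) → (Fin n → ℂ))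
    (h : p + 1 + 1 = r + (q + 1))
    {A : B × (Fin n → ℂ) → (B × (Fin n → ℂ)) [⋀^Fin (p + 1)]→L[ℝ] ℂ}
    (hA : ContDiff ℝ ∞ A) (hc : HasCompactSupport A) (z : B) :
    fiberForm (r := r) (q + 1) f (fun y => castDegree h (extDeriv A y)) z =
      -fiberForm (r := r) q (fun j => f j.succ)
        (fun y => castDegree (by omega) (extDeriv (fun y => (A y).curryLeft (0, f 0)) y)) z := by
  have h' : p + 1 = r + q := by omega
  have hA1 := contDiff_curryLeft hA (0, f 0)
  have hc1 := hasCompactSupport_curryLeft hc (0, f 0)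
  have h3 : fiberForm (r := r) q (fun j => f j.succ)
      (fun y => castDegree h' (fderiv ℝ A y (0, f 0))) z = 0 := by
    have := fiberForm_fderiv_vertical (f := fun j => f j.succ) (contDiff_castDegree h' hA)
      (hasCompactSupport_castDegree h' hc) z (f 0)
    simpa only [fderiv_castDegree] using this
  rw [fiberForm_castDegree_succ]
  have h4 : (fun y => castDegree h' ((extDeriv A y).curryLeft (0, f 0))) = fun y =>
      castDegree h' (fderiv ℝ A y (0, f 0)) -
        castDegree h' (extDeriv (fun y => (A y).curryLeft (0, f 0)) y) := by
    funext y
    rw [curryLeft_extDeriv ((hA.differentiable (by simp)) y), castDegree_sub]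
  rw [h4, fiberForm_sub (contDiff_castDegree h' (contDiff_fderiv_apply hA _))
    (hasCompactSupport_castDegree h' (hasCompactSupport_fderiv_apply hc _))
    (contDiff_castDegree h' (contDiff_extDeriv hA1))
    (hasCompactSupport_castDegree h' (hasCompactSupport_extDeriv hc1)), h3, zero_sub]

/-- Integration over the fibres of a product commutes with the exterior derivative up to sign. -/
theorem extDeriv_fiberForm {r : ℕ} (q : ℕ) (f : Fin q → (Fin n → ℂ))
    {A : B × (Fin n → ℂ) → (B × (Fin n → ℂ)) [⋀^Fin (r + q)]→L[ℝ] ℂ}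
    (h : r + q + 1 = r + 1 + q)
    (hA : ContDiff ℝ ∞ A) (hc : HasCompactSupport A) (z : B) :
    extDeriv (fiberForm q f A) z =
      (-1 : ℝ) ^ q • fiberForm (r := r + 1) q f (fun y => castDegree h (extDeriv A y)) z := by
  induction q with
  | zero =>
    rw [pow_zero, one_smul]
    exact extDeriv_fiberForm_zero hA hc z
  | succ q ih =>
    have h1 : fiberForm (q + 1) f A = fiberForm q (fun j => f j.succ)
        fun y => ContinuousAlternatingMap.curryLeft (n := r + q) (A y) (0, f 0) :=
      funext fun z => fiberForm_castDegree_succ (p := r + q) q f rfl A z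
    -- Every contracted vector contributes one sign, which accounts for (-1)^q.
    have h2 := fiberForm_castDegree_extDeriv (p := r + q) (r := r + 1) q f (by omega) hA hc z
    refine Eq.trans ?_ (congrArg (fun a => (-1 : ℝ) ^ (q + 1) • a) h2).symm
    rw [h1, ih _ (by omega) (contDiff_curryLeft (p := r + q) hA _)
      (hasCompactSupport_curryLeft (p := r + q) hc _)]
    simp only [pow_succ, mul_neg_one, neg_smul, smul_neg, neg_neg]

/-- The integral over the fibres of an exact form with compact support whose degree is the
dimension of the fibres vanishes. -/
theorem fiberForm_extDeriv_eq_zero (q : ℕ) (f : Fin (q + 1) → (Fin n → ℂ))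
    {A : B × (Fin n → ℂ) → (B × (Fin n → ℂ)) [⋀^Fin q]→L[ℝ] ℂ}
    (h : q + 1 = 0 + (q + 1))
    (hA : ContDiff ℝ ∞ A) (hc : HasCompactSupport A) (z : B) :
    fiberForm (r := 0) (q + 1) f (fun y => castDegree h (extDeriv A y)) z = 0 := by
  induction q with
  | zero =>
    -- For a 0-form, contracting its differential leaves a pure vertical derivative, whose integral
    -- vanishes.
    rw [fiberForm_castDegree_succ]
    refine Eq.trans ?_ (fiberForm_fderiv_vertical (r := 0) (q := 0) (f := fun j => f j.succ)
      hA hc z (f 0))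
    congr 1
    funext y
    exact curryLeft_extDeriv_zero ((hA.differentiable (by simp)) y) _
  | succ q ih =>
    rw [fiberForm_castDegree_extDeriv q.succ f h hA hc z, ih _ (by omega) (contDiff_curryLeft hA _)
      (hasCompactSupport_curryLeft hc _), neg_zero]

end FiberForm

/-! ### The underlying real manifold; supports of derivatives. -/

section RealStructure

variable {E : Type*} [NormedAddCommGroup E] [NormedSpace ℂ E]
  {X : Type*} [TopologicalSpace X] [ChartedSpace E X]

variable (E X) in
/-- The real smooth manifold underlying a complex manifold. -/
theorem isManifold_real [IsManifold 𝓘(ℂ, E) ω X] : IsManifold 𝓘(ℝ, E) ∞ X := by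
  refine isManifold_of_contDiffOn _ _ _ fun e e' he he' => ?_
  have h : ∀ y ∈ (e.symm.trans e').source, ContDiffAt ℝ ∞ (fun z => e' (e.symm z)) y := by
    intro y hy
    rw [OpenPartialHomeomorph.trans_source] at hy
    exact contDiffAt_real_of_complex ((isHolomorphicChart_of_mem_atlas he).contDiffAt_transition
      (isHolomorphicChart_of_mem_atlas he') hy.1 hy.2)
  intro y hy
  simp only [modelWithCornersSelf_coe_symm, Set.preimage_id_eq, id_eq, modelWithCornersSelf_coe,
    Set.range_id, Set.inter_univ] at hy ⊢
  exact (h y hy).contDiffWithinAt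

theorem contDiffAt_comp_chart_symm [IsManifold 𝓘(ℂ, E) ω X] {G : Type*} [NormedAddCommGroup G]
    [NormedSpace ℝ G] {ρ : X → G} {e : OpenPartialHomeomorph X E} (he : e ∈ atlas E X) {y : E}
    (hy : y ∈ e.target) (hρ : ContMDiffAt 𝓘(ℝ, E) 𝓘(ℝ, G) ∞ ρ (e.symm y)) :
    ContDiffAt ℝ ∞ (fun z => ρ (e.symm z)) y := by
  have := isManifold_real E X
  have h1 : ContMDiffAt 𝓘(ℝ, E) 𝓘(ℝ, E) ∞ e.symm y :=
    (contMDiffOn_symm_of_mem_maximalAtlas (IsManifold.subset_maximalAtlas he)).contMDiffAt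
      (e.open_target.mem_nhds hy)
  exact (hρ.comp y h1).contDiffAt

theorem IsSmoothForm.smul [IsManifold 𝓘(ℂ, E) ω X] {p : ℕ} {ρ : X → ℝ} {θ : DForm E X p}
    (hρ : ContMDiff 𝓘(ℝ, E) 𝓘(ℝ, ℝ) ∞ ρ) (hθ : IsSmoothForm θ) :
    IsSmoothForm (fun x => ρ x • θ x) := by
  intro e he y hy
  rw [inChart_smul]
  exact ((contDiffAt_comp_chart_symm he hy hρ.contMDiffAt).smul
    ((hθ e he).contDiffAt (e.open_target.mem_nhds hy))).contDiffWithinAt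

theorem inChart_eventuallyEq_zero {p : ℕ} {F : Type*} [NormedAddCommGroup F] [NormedSpace ℂ F]
    {θ : DForm E X p} {e : OpenPartialHomeomorph X F} {y : F} (hy : y ∈ e.target)
    (h : ∀ᶠ x in 𝓝 (e.symm y), θ x = 0) : inChart θ e =ᶠ[𝓝 y] fun _ => 0 := by
  filter_upwards [(e.continuousAt_symm hy).eventually h] with z hz
  rw [inChart, hz]
  rfl

theorem extDeriv_const_zero {p : ℕ} (y : E) :
    extDeriv (fun _ : E => (0 : E [⋀^Fin p]→L[ℝ] ℂ)) y = 0 := by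
  rw [extDeriv_eq_alternatizeCLM]
  simp only [fderiv_fun_const, Pi.zero_apply, map_zero]

theorem dForm_eq_zero_of_eventuallyEq {p : ℕ} {θ : DForm E X p} {x : X}
    (h : ∀ᶠ y in 𝓝 x, θ y = 0) : dForm θ x = 0 := by
  have hx := (chartAt E x).map_source (mem_chart_source E x)
  rw [dForm, (inChart_eventuallyEq_zero hx
    (by rwa [(chartAt E x).left_inv (mem_chart_source E x)])).extDeriv_eq]
  exact extDeriv_const_zero _

theorem tsupport_dForm_subset {p : ℕ} (θ : DForm E X p) : tsupport (dForm θ) ⊆ tsupport θ := by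
  refine closure_minimal (fun x hx => ?_) (isClosed_tsupport θ)
  by_contra h
  exact hx (dForm_eq_zero_of_eventuallyEq (notMem_tsupport_iff_eventuallyEq.1 h))

end RealStructure

/-! ### Extension by zero of compactly supported coordinate expressions. -/

section ZeroExtension

variable {E : Type*} [NormedAddCommGroup E] [NormedSpace ℂ E]
  {F : Type*} [NormedAddCommGroup F] [NormedSpace ℂ F]
  {X : Type*} [TopologicalSpace X] [ChartedSpace E X]

open Classical in
/-- The coordinate expression of a form, extended by zero outside of the chart. -/
def zeroExt {p : ℕ} (e : OpenPartialHomeomorph X F) (α : DForm E X p) (y : F) :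
    F [⋀^Fin p]→L[ℝ] ℂ :=
  if y ∈ e.target then inChart α e y else 0

variable {p : ℕ} {e : OpenPartialHomeomorph X F} {α β : DForm E X p}

theorem zeroExt_of_mem {y : F} (hy : y ∈ e.target) : zeroExt e α y = inChart α e y := if_pos hy

theorem zeroExt_of_notMem {y : F} (hy : y ∉ e.target) : zeroExt e α y = 0 := if_neg hy

theorem zeroExt_add (e : OpenPartialHomeomorph X F) (α β : DForm E X p) (y : F) :
    zeroExt e (α + β) y = zeroExt e α y + zeroExt e β y := by
  by_cases hy : y ∈ e.target
  · simp only [zeroExt_of_mem hy, inChart_add, Pi.add_apply]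
  · simp only [zeroExt_of_notMem hy, add_zero]

theorem zeroExt_castDegree {q : ℕ} (h : p = q) (y : F) :
    zeroExt e (fun x => castDegree h (α x)) y = castDegree h (zeroExt e α y) := by
  subst h; rfl

theorem zeroExt_eventuallyEq {y : F} (hy : y ∈ e.target) : zeroExt e α =ᶠ[𝓝 y] inChart α e := by
  filter_upwards [e.open_target.mem_nhds hy] with z hz
  exact zeroExt_of_mem hz

theorem zeroExt_ne_zero {y : F} (h : zeroExt e α y ≠ 0) :
    y ∈ e.target ∧ e.symm y ∈ tsupport α := by
  by_cases hy : y ∈ e.target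
  · refine ⟨hy, subset_tsupport α fun h0 => h ?_⟩
    rw [zeroExt_of_mem hy, inChart, h0]
    rfl
  · exact (h (zeroExt_of_notMem hy)).elim

variable [CompactSpace X]

omit [NormedSpace ℂ F] [ChartedSpace E X] in
theorem isCompact_image_tsupport (hs : tsupport α ⊆ e.source) : IsCompact (e '' tsupport α) :=
  (isClosed_tsupport α).isCompact.image_of_continuousOn (e.continuousOn.mono hs)

/-- Compactness of X makes the image of the support compact, hence closed in F and not only in the
target. This is why the extension is smooth across the boundary of the target. -/
theorem tsupport_zeroExt_subset (hs : tsupport α ⊆ e.source) :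
    tsupport (zeroExt e α) ⊆ e '' tsupport α := by
  refine closure_minimal (fun y hy => ?_) (isCompact_image_tsupport hs).isClosed
  obtain ⟨h1, h2⟩ := zeroExt_ne_zero hy
  exact ⟨_, h2, e.right_inv h1⟩

theorem hasCompactSupport_zeroExt (hs : tsupport α ⊆ e.source) :
    HasCompactSupport (zeroExt e α) :=
  (isCompact_image_tsupport hs).of_isClosed_subset (isClosed_tsupport _)
    (tsupport_zeroExt_subset hs)

theorem tsupport_zeroExt_subset_target (hs : tsupport α ⊆ e.source) :
    tsupport (zeroExt e α) ⊆ e.target := by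
  intro y hy
  obtain ⟨x, hx, rfl⟩ := tsupport_zeroExt_subset hs hy
  exact e.map_source (hs hx)

variable [IsManifold 𝓘(ℂ, E) ω X]

theorem contDiff_zeroExt (hα : IsSmoothForm α) (he : IsHolomorphicChart E e)
    (hs : tsupport α ⊆ e.source) : ContDiff ℝ ∞ (zeroExt e α) :=
  contDiff_iff_contDiffAt.2 fun y => by
    by_cases hy : y ∈ tsupport (zeroExt e α)
    · have hy' := tsupport_zeroExt_subset_target hs hy
      exact (hα.contDiffAt he hy').congr_of_eventuallyEq (zeroExt_eventuallyEq hy')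
    · exact contDiffAt_const.congr_of_eventuallyEq (notMem_tsupport_iff_eventuallyEq.1 hy)

theorem extDeriv_zeroExt (hα : IsSmoothForm α) (he : IsHolomorphicChart E e)
    (hs : tsupport α ⊆ e.source) (y : F) :
    extDeriv (zeroExt e α) y = zeroExt e (dForm α) y := by
  by_cases hy : y ∈ e.target
  · rw [(zeroExt_eventuallyEq hy).extDeriv_eq, hα.extDeriv_inChart he hy, zeroExt_of_mem hy]
  · have h : zeroExt e α =ᶠ[𝓝 y] fun _ => 0 := notMem_tsupport_iff_eventuallyEq.1 fun h =>
      hy (tsupport_zeroExt_subset_target hs h)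
    rw [h.extDeriv_eq, zeroExt_of_notMem hy]
    exact extDeriv_const_zero _

end ZeroExtension

/-! ### Push-forward of a form supported in one admissible chart. -/

section PushChart

open MeasureTheory

variable {B : Type*} [NormedAddCommGroup B] [NormedSpace ℂ B]
  {E : Type*} [NormedAddCommGroup E] [NormedSpace ℂ E]
  {M : Type*} [TopologicalSpace M] [ChartedSpace B M]
  {X : Type*} [TopologicalSpace X] [ChartedSpace E X] {n : ℕ}

open Classical in
/-- The integral along the fibres of a form supported in an admissible chart. -/
def pushChart (e : OpenPartialHomeomorph X (B × (Fin n → ℂ))) (b : OpenPartialHomeomorph M B)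
    {r : ℕ} (α : DForm E X (r + 2 * n)) : DForm B M r := fun y =>
  if y ∈ b.source then
    (fiberForm (2 * n) (frameBasis n) (zeroExt e α) (b y)).compContinuousLinearMap
      (fderiv ℝ (fun z => b ((chartAt B y).symm z)) (chartAt B y y))
  else 0

variable {r : ℕ} {π : X → M} {e : OpenPartialHomeomorph X (B × (Fin n → ℂ))}
  {b : OpenPartialHomeomorph M B} {α β : DForm E X (r + 2 * n)}

theorem pushChart_of_mem {y : M} (hy : y ∈ b.source) : pushChart e b α y =
    (fiberForm (2 * n) (frameBasis n) (zeroExt e α) (b y)).compContinuousLinearMap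
      (fderiv ℝ (fun z => b ((chartAt B y).symm z)) (chartAt B y y)) := if_pos hy

theorem pushChart_of_notMem {y : M} (hy : y ∉ b.source) : pushChart e b α y = 0 := if_neg hy

theorem vertical_eq : (fun j => ((0 : B), frameBasis n j)) = verticalFrame B n :=
  (funext (verticalFrame_eq_inr_frameBasis n)).symm

theorem FiberPartition.integrate_eq (P : FiberPartition B E n π) (β : DForm E X (r + 2 * n)) :
    P.integrate β = ∑ i, pushChart (P.chart i) (P.base i) fun x => P.ρ i x • β x := by
  funext y
  rw [FiberPartition.integrate, Finset.sum_apply]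
  refine Finset.sum_congr rfl fun i _ => ?_
  by_cases hy : y ∈ (P.base i).source
  · rw [if_pos hy, pushChart_of_mem hy, fiberForm]
    congr 2
    funext v
    by_cases hv : (P.base i y, v) ∈ (P.chart i).target
    · rw [if_pos hv, zeroExt_of_mem hv, inChart_smul, map_smul, verticalContractL_apply,
        vertical_eq]
    · rw [if_neg hv, zeroExt_of_notMem hv, map_zero]
  · rw [if_neg hy, pushChart_of_notMem hy]

theorem IsAdmissible.map_symm (h : IsAdmissible B E π e b) {y : M} (hy : y ∈ b.source)
    {v : Fin n → ℂ} (hv : (b y, v) ∈ e.target) : π (e.symm (b y, v)) = y := by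
  have h1 := h.fst_eq _ (e.map_target hv)
  rw [e.right_inv hv] at h1
  exact (b.injOn hy (h.mapsTo (e.map_target hv)) h1).symm

theorem pushChart_eq_zero (h : IsAdmissible B E π e b) {y : M} (hy : y ∉ π '' tsupport α) :
    pushChart e b α y = 0 := by
  by_cases hb : y ∈ b.source
  · have h0 : ∀ v, zeroExt e α (b y, v) = 0 := by
      intro v
      by_contra hv
      obtain ⟨h1, h2⟩ := zeroExt_ne_zero hv
      exact hy ⟨_, h2, h.map_symm hb h1⟩
    rw [pushChart_of_mem hb, fiberForm]
    simp only [h0, map_zero, integral_zero]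
    rfl
  · exact pushChart_of_notMem hb

theorem inChart_pushChart [IsManifold 𝓘(ℂ, B) ω M] (hb : IsHolomorphicChart B b) {z : B}
    (hz : z ∈ b.target) : inChart (pushChart e b α) b z =
      fiberForm (2 * n) (frameBasis n) (zeroExt e α) z := by
  have hc := isHolomorphicChart_chartAt (E := B) (b.symm z)
  have h := fderiv_comp_transition hb hc hb hz (mem_chart_source B _) (b.map_target hz)
  have h0 : fderiv ℝ (fun w => b (b.symm w)) z = ContinuousLinearMap.id ℝ B := by
    have : (fun w => b (b.symm w)) =ᶠ[𝓝 z] id := by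
      filter_upwards [b.open_target.mem_nhds hz] with w hw
      exact b.right_inv hw
    rw [this.fderiv_eq, fderiv_id]
  rw [inChart, pushChart_of_mem (b.map_target hz), b.right_inv hz]
  refine Eq.trans (b := (fiberForm (2 * n) (frameBasis n) (zeroExt e α)
    z).compContinuousLinearMap (fderiv ℝ (fun w => b (b.symm w)) z)) ?_ ?_
  · rw [h]; rfl
  · rw [h0]; rfl

variable [CompactSpace X] [IsManifold 𝓘(ℂ, E) ω X] [IsManifold 𝓘(ℂ, B) ω M] [T2Space M]

omit [IsManifold 𝓘(ℂ, E) ω X] [IsManifold 𝓘(ℂ, B) ω M] in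
-- The image of the support under π is compact, so closed in the Hausdorff space M, and lies in
-- b.source. Thus the push-forward vanishes near, and not merely at, every point outside b.source.
theorem pushChart_eventuallyEq_zero (h : IsAdmissible B E π e b) (hπ : Continuous π)
    (hs : tsupport α ⊆ e.source) {y : M} (hy : y ∉ b.source) :
    ∀ᶠ y' in 𝓝 y, pushChart e b α y' = 0 := by
  have hK : IsClosed (π '' tsupport α) :=
    ((isClosed_tsupport α).isCompact.image hπ).isClosed
  have : y ∉ π '' tsupport α := fun ⟨x, hx, hxy⟩ => hy (hxy ▸ h.mapsTo (hs hx))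
  filter_upwards [hK.isOpen_compl.mem_nhds this] with y' hy'
  exact pushChart_eq_zero h hy'

theorem isSmoothForm_pushChart (h : IsAdmissible B E π e b) (hπ : Continuous π)
    (hα : IsSmoothForm α) (hs : tsupport α ⊆ e.source) : IsSmoothForm (pushChart e b α) := by
  refine isSmoothForm_of_local (F := B) fun y => ?_
  by_cases hy : y ∈ b.source
  · refine ⟨b, h.holo_base, hy, ?_⟩
    refine (contDiff_fiberForm (contDiff_zeroExt hα h.holo hs)
      (hasCompactSupport_zeroExt hs)).contDiffAt.congr_of_eventuallyEq
      (f := fiberForm (2 * n) (frameBasis n) (zeroExt e α)) ?_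
    filter_upwards [b.open_target.mem_nhds (b.map_source hy)] with z hz
    exact inChart_pushChart h.holo_base hz
  · refine ⟨chartAt B y, isHolomorphicChart_chartAt y, mem_chart_source B y, ?_⟩
    refine contDiffAt_const.congr_of_eventuallyEq (inChart_eventuallyEq_zero
      ((chartAt B y).map_source (mem_chart_source B y)) ?_)
    rw [(chartAt B y).left_inv (mem_chart_source B y)]
    exact pushChart_eventuallyEq_zero h hπ hs hy

/-- The integral along the fibres in a chart commutes with the exterior derivative. -/
theorem dForm_pushChart (hr : r + 2 * n + 1 = r + 1 + 2 * n) (h : IsAdmissible B E π e b)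
    (hπ : Continuous π) (hα : IsSmoothForm α) (hs : tsupport α ⊆ e.source) :
    dForm (pushChart e b α) = pushChart e b fun x => castDegree hr (dForm α x) := by
  funext y
  by_cases hy : y ∈ b.source
  · have hP := isSmoothForm_pushChart h hπ hα hs
    rw [form_apply_eq_inChart (dForm (pushChart e b α)) h.holo_base hy, pushChart_of_mem hy,
      ← hP.extDeriv_inChart h.holo_base (b.map_source hy)]
    congr 1
    have h1 : inChart (pushChart e b α) b =ᶠ[𝓝 (b y)]
        fiberForm (2 * n) (frameBasis n) (zeroExt e α) := by
      filter_upwards [b.open_target.mem_nhds (b.map_source hy)] with z hz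
      exact inChart_pushChart h.holo_base hz
    -- The fibres have even real dimension, so the sign (-1)^{2n} is 1.
    rw [h1.extDeriv_eq, extDeriv_fiberForm _ _ hr (contDiff_zeroExt hα h.holo hs)
      (hasCompactSupport_zeroExt hs), pow_mul, neg_one_sq, one_pow, one_smul]
    congr 1
    funext z
    rw [zeroExt_castDegree, extDeriv_zeroExt hα h.holo hs]
  · rw [pushChart_of_notMem hy]
    exact dForm_eq_zero_of_eventuallyEq (pushChart_eventuallyEq_zero h hπ hs hy)

omit [IsManifold 𝓘(ℂ, B) ω M] [T2Space M] in
theorem pushChart_add (he : IsHolomorphicChart E e)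
    (hα : IsSmoothForm α) (hs : tsupport α ⊆ e.source) (hβ : IsSmoothForm β)
    (hs' : tsupport β ⊆ e.source) :
    pushChart e b (α + β) = pushChart e b α + pushChart e b β := by
  funext y
  rw [Pi.add_apply]
  by_cases hy : y ∈ b.source
  · rw [pushChart_of_mem hy, pushChart_of_mem hy, pushChart_of_mem hy]
    refine Eq.trans (congrArg (fun a => ContinuousAlternatingMap.compContinuousLinearMap a _) ?_)
      (map_add (ContinuousAlternatingMap.compContinuousLinearMapCLM (ι := Fin r) (F := ℂ)
        (fderiv ℝ (fun z => b ((chartAt B y).symm z)) (chartAt B y y))) _ _)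
    simp only [fiberForm, zeroExt_add, map_add]
    exact integral_add
      (integrable_verticalContractL (contDiff_zeroExt hα he hs) (hasCompactSupport_zeroExt hs) _)
      (integrable_verticalContractL (contDiff_zeroExt hβ he hs') (hasCompactSupport_zeroExt hs') _)
  · simp only [pushChart_of_notMem hy, add_zero]

omit [CompactSpace X] [IsManifold 𝓘(ℂ, E) ω X] [IsManifold 𝓘(ℂ, B) ω M] [T2Space M] in
theorem pushChart_zero : pushChart e b (0 : DForm E X (r + 2 * n)) = 0 := by
  funext y
  by_cases hy : y ∈ b.source
  · have : zeroExt e (0 : DForm E X (r + 2 * n)) = fun _ => 0 := by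
      funext z
      by_cases hz : z ∈ e.target
      · rw [zeroExt_of_mem hz]; rfl
      · exact zeroExt_of_notMem hz
    rw [pushChart_of_mem hy, this, fiberForm]
    simp only [map_zero, integral_zero]
    rfl
  · exact pushChart_of_notMem hy

omit [ChartedSpace E X] [IsManifold 𝓘(ℂ, E) ω X] [CompactSpace X] in
theorem tsupport_sum_subset {p : ℕ} {ι : Type*} (s : Finset ι) {θ : ι → DForm E X p} {u : Set X}
    (h : ∀ i ∈ s, tsupport (θ i) ⊆ u) : tsupport (∑ i ∈ s, θ i) ⊆ u := by
  classical
  induction s using Finset.induction_on with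
  | empty => simp [tsupport]
  | insert i s hi ih =>
    rw [Finset.sum_insert hi]
    exact (tsupport_add _ _).trans (Set.union_subset (h _ (Finset.mem_insert_self _ _))
      (ih fun j hj => h j (Finset.mem_insert_of_mem hj)))

omit [IsManifold 𝓘(ℂ, B) ω M] [T2Space M] in
theorem pushChart_sum {ι : Type*} (s : Finset ι) {θ : ι → DForm E X (r + 2 * n)}
    (he : IsHolomorphicChart E e) (hθ : ∀ i, IsSmoothForm (θ i))
    (hs : ∀ i, tsupport (θ i) ⊆ e.source) :
    pushChart e b (∑ i ∈ s, θ i) = ∑ i ∈ s, pushChart e b (θ i) := by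
  classical
  induction s using Finset.induction_on with
  | empty => exact pushChart_zero
  | insert i s hi ih =>
    rw [Finset.sum_insert hi, Finset.sum_insert hi, pushChart_add he (hθ i) (hs i)
      (IsSmoothForm.sum s hθ) (tsupport_sum_subset s fun i _ => hs i), ih]

end PushChart

theorem tsupport_subset_of_zero {X α β : Type*} [TopologicalSpace X] [Zero α] [Zero β] {f : X → α}
    {g : X → β} (h : ∀ x, g x = 0 → f x = 0) : tsupport f ⊆ tsupport g :=
  closure_mono fun x hx h0 => hx (h x h0)

/-! ### Supports of products with functions. -/

section FormSupport

variable {E : Type*} [NormedAddCommGroup E] [NormedSpace ℂ E] {X : Type*} [TopologicalSpace X]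
  {p : ℕ}

theorem tsupport_form_smul_subset_left (ρ : X → ℝ) (β : DForm E X p) :
    tsupport (fun x => ρ x • β x) ⊆ tsupport ρ :=
  tsupport_subset_of_zero fun x h => by
    ext w
    change ρ x • β x w = 0
    rw [h, zero_smul]

theorem tsupport_form_smul_subset_right (ρ : X → ℝ) (β : DForm E X p) :
    tsupport (fun x => ρ x • β x) ⊆ tsupport β :=
  tsupport_subset_of_zero fun x h => by
    ext w
    change ρ x • β x w = 0
    rw [h]
    exact smul_zero _

end FormSupport

/-! ### Independence of the admissible chart. -/

section ChangeOfCharts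

open MeasureTheory

variable {B : Type*} [NormedAddCommGroup B] [NormedSpace ℂ B]
  {E : Type*} [NormedAddCommGroup E] [NormedSpace ℂ E]
  {M : Type*} [TopologicalSpace M] [ChartedSpace B M] [IsManifold 𝓘(ℂ, B) ω M]
  {X : Type*} [TopologicalSpace X] [ChartedSpace E X] [IsManifold 𝓘(ℂ, E) ω X] {n : ℕ}
  {r : ℕ} {π : X → M} {e e' : OpenPartialHomeomorph X (B × (Fin n → ℂ))}
  {b b' : OpenPartialHomeomorph M B} {α : DForm E X (r + 2 * n)}

/-- Change of variables for functions which vanish outside of an open set and its image. -/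
theorem integral_eq_map_integral_of_change {V G H : Type*} [NormedAddCommGroup V] [NormedSpace ℝ V]
    [FiniteDimensional ℝ V] [MeasureSpace V] [BorelSpace V] [(volume : Measure V).IsAddHaarMeasure]
    [NormedAddCommGroup G] [NormedSpace ℝ G] [CompleteSpace G]
    [NormedAddCommGroup H] [NormedSpace ℝ H] [CompleteSpace H] (S : G →L[ℝ] H) {φ : V → H}
    {ψ : V → G} {U : Set V} {g : V → V} {D : V → V →L[ℝ] V} (hU : IsOpen U)
    (hg : ∀ v ∈ U, HasFDerivWithinAt g (D v) U v) (hinj : Set.InjOn g U)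
    (h : ∀ v ∈ U, φ v = |(D v).det| • S (ψ (g v))) (h0 : ∀ v ∉ U, φ v = 0)
    (h0' : ∀ v ∉ g '' U, ψ v = 0) (hψ : Integrable ψ) : ∫ v, φ v = S (∫ v, ψ v) :=
  calc ∫ v, φ v
      = ∫ v in U, φ v := (setIntegral_eq_integral_of_forall_compl_eq_zero h0).symm
    _ = ∫ v in U, |(D v).det| • S (ψ (g v)) := setIntegral_congr_fun hU.measurableSet h
    _ = ∫ v in g '' U, S (ψ v) :=
        (integral_image_eq_integral_abs_det_fderiv_smul volume hU.measurableSet hg hinj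
          fun v => S (ψ v)).symm
    _ = ∫ v, S (ψ v) :=
        setIntegral_eq_integral_of_forall_compl_eq_zero fun v hv => by rw [h0' v hv, map_zero]
    _ = S (∫ v, ψ v) := ContinuousLinearMap.integral_comp_comm _ hψ

theorem det_restrictScalars_clm {V : Type*} [NormedAddCommGroup V] [NormedSpace ℂ V]
    [FiniteDimensional ℂ V] (A : V →L[ℂ] V) :
    (A.restrictScalars ℝ).det = Complex.normSq (LinearMap.det (A : V →ₗ[ℂ] V)) :=
  det_restrictScalars_complex (A : V →ₗ[ℂ] V)

/-- The vertical part of an endomorphism of a product. -/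
def verticalPart (T : (B × (Fin n → ℂ)) →L[ℂ] B × (Fin n → ℂ)) : (Fin n → ℂ) →L[ℂ] (Fin n → ℂ) :=
  (ContinuousLinearMap.snd ℂ B (Fin n → ℂ)).comp
    (T.comp (ContinuousLinearMap.inr ℂ B (Fin n → ℂ)))

/-- The vertical contraction under a fibre preserving change of coordinates. -/
theorem verticalContractL_compContinuousLinearMap
    (β : (B × (Fin n → ℂ)) [⋀^Fin (r + 2 * n)]→L[ℝ] ℂ)
    (T : (B × (Fin n → ℂ)) →L[ℂ] B × (Fin n → ℂ)) (S : B →L[ℝ] B)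
    (h : ∀ w, (T w).1 = S w.1) :
    verticalContractL (2 * n) (frameBasis n) (β.compContinuousLinearMap (T.restrictScalars ℝ)) =
      |((verticalPart T).restrictScalars ℝ).det| •
      (verticalContractL (2 * n) (frameBasis n) β).compContinuousLinearMap S := by
  rw [det_restrictScalars_clm, abs_of_nonneg (Complex.normSq_nonneg _), verticalContractL_apply,
    verticalContractL_apply, contract_comp]
  -- The base component of T depends only on base components, so T maps vertical vectors to vertical
  -- ones and acts on the frame through its vertical part alone.
  have hf : (fun j => (T.restrictScalars ℝ) ((0 : B), frameBasis n j)) =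
      fun j => ((0 : B), (verticalPart T : (Fin n → ℂ) →ₗ[ℂ] (Fin n → ℂ)) (frameBasis n j)) := by
    funext j
    refine Prod.ext ?_ rfl
    exact (h _).trans (map_zero S)
  rw [hf, contract_vertical_det, vertical_eq]
  ext w
  refine congrArg (fun c : ℂ => Complex.normSq
    (LinearMap.det (verticalPart T : (Fin n → ℂ) →ₗ[ℂ] (Fin n → ℂ))) • c) ?_
  refine (contract_vertical_horizontal β fun i => T (w i, 0)).trans ?_
  simp only [h]
  rfl

/-- The transition map between two admissible charts. -/
def transition (e e' : OpenPartialHomeomorph X (B × (Fin n → ℂ))) (z : B × (Fin n → ℂ)) :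
    B × (Fin n → ℂ) := e' (e.symm z)

omit [IsManifold 𝓘(ℂ, B) ω M] [IsManifold 𝓘(ℂ, E) ω X] in
theorem IsAdmissible.transition_eq (h : IsAdmissible B E π e b) (h' : IsAdmissible B E π e' b')
    {y : M} (hy : y ∈ b.source) {v : Fin n → ℂ} (hv : (b y, v) ∈ e.target)
    (hv' : e.symm (b y, v) ∈ e'.source) :
    transition e e' (b y, v) = (b' y, (transition e e' (b y, v)).2) := by
  refine Prod.ext ?_ rfl
  have := h'.fst_eq _ hv'
  rwa [h.map_symm hy hv] at this

omit [IsManifold 𝓘(ℂ, B) ω M] [IsManifold 𝓘(ℂ, E) ω X] in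
-- Both charts lie over base charts, so the base component of the transition map is locally b' ∘ b⁻¹
-- of the base coordinate and ignores the fibre coordinate.
theorem IsAdmissible.fderiv_transition_fst (h : IsAdmissible B E π e b)
    (h' : IsAdmissible B E π e' b')
    {y : M} (hy : y ∈ b.source) (hy' : y ∈ b'.source) {v : Fin n → ℂ} (hv : (b y, v) ∈ e.target)
    (hv' : e.symm (b y, v) ∈ e'.source) (w : B × (Fin n → ℂ)) :
    (fderiv ℂ (transition e e') (b y, v) w).1 = fderiv ℝ (fun z => b' (b.symm z)) (b y) w.1 := by
  have hτd : DifferentiableAt ℂ (transition e e') (b y, v) :=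
    (h.holo.contDiffAt_transition h'.holo hv hv').differentiableAt (by simp)
  have hb := contDiffAt_real_of_complex (h.holo_base.contDiffAt_transition h'.holo_base
    (b.map_source hy) (by rwa [b.left_inv hy]))
  have h1 : HasFDerivAt (fun z : B × (Fin n → ℂ) => b' (b.symm z.1))
      ((fderiv ℝ (fun z => b' (b.symm z)) (b y)).comp
        (ContinuousLinearMap.fst ℝ B (Fin n → ℂ))) (b y, v) :=
    HasFDerivAt.comp (g := fun z => b' (b.symm z)) (b y, v)
      (hb.differentiableAt (by simp)).hasFDerivAt hasFDerivAt_fst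
  have h2 : HasFDerivAt (fun z => (transition e e' z).1)
      ((ContinuousLinearMap.fst ℝ B (Fin n → ℂ)).comp
        ((fderiv ℂ (transition e e') (b y, v)).restrictScalars ℝ)) (b y, v) :=
    hasFDerivAt_fst.comp (b y, v) (hτd.hasFDerivAt.restrictScalars ℝ)
  have h3 : (fun z => (transition e e' z).1) =ᶠ[𝓝 (b y, v)] fun z => b' (b.symm z.1) := by
    have h4 : (e.target ∩ e.symm ⁻¹' e'.source) ∈ 𝓝 (b y, v) :=
      (e.isOpen_inter_preimage_symm e'.open_source).mem_nhds ⟨hv, hv'⟩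
    filter_upwards [h4] with z hz
    have h5 := h'.fst_eq _ hz.2
    have h6 := h.fst_eq _ (e.map_target hz.1)
    rw [e.right_inv hz.1] at h6
    rw [h6, b.left_inv (h.mapsTo (e.map_target hz.1))]
    exact h5
  exact (congrArg (fun l => l w) ((h1.congr_of_eventuallyEq h3).unique h2)).symm

theorem hasFDerivAt_snd_slice {τ : B × (Fin n → ℂ) → B × (Fin n → ℂ)} {z : B} {v : Fin n → ℂ}
    (h : DifferentiableAt ℂ τ (z, v)) : HasFDerivAt (fun v => (τ (z, v)).2)
      ((verticalPart (fderiv ℂ τ (z, v))).restrictScalars ℝ) v := by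
  have h1 : HasFDerivAt (fun v => τ (z, v)) ((fderiv ℂ τ (z, v)).comp
      (ContinuousLinearMap.inr ℂ B (Fin n → ℂ))) v :=
    h.hasFDerivAt.comp v (hasFDerivAt_prodMk_right z v)
  have h2 : HasFDerivAt (fun v => (τ (z, v)).2) (verticalPart (fderiv ℂ τ (z, v))) v :=
    hasFDerivAt_snd.comp v h1
  exact h2.restrictScalars ℝ

omit [IsManifold 𝓘(ℂ, B) ω M] in
theorem verticalContractL_zeroExt_change (h : IsAdmissible B E π e b)
    (h' : IsAdmissible B E π e' b')
    {y : M} (hy : y ∈ b.source) (hy' : y ∈ b'.source) {v : Fin n → ℂ} (hv : (b y, v) ∈ e.target)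
    (hv' : e.symm (b y, v) ∈ e'.source) :
    verticalContractL (2 * n) (frameBasis n) (zeroExt e α (b y, v)) =
      |((verticalPart (fderiv ℂ (transition e e') (b y, v))).restrictScalars ℝ).det| •
        (verticalContractL (2 * n) (frameBasis n)
          (zeroExt e' α (b' y, (transition e e' (b y, v)).2))).compContinuousLinearMap
            (fderiv ℝ (fun z => b' (b.symm z)) (b y)) := by
  have hτd : DifferentiableAt ℂ (transition e e') (b y, v) :=
    (h.holo.contDiffAt_transition h'.holo hv hv').differentiableAt (by simp)
  have h0 := h.transition_eq h' hy hv hv'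
  have h1 : transition e e' (b y, v) ∈ e'.target := e'.map_source hv'
  have h2 := verticalContractL_compContinuousLinearMap
    (inChart α e' (transition e e' (b y, v))) (fderiv ℂ (transition e e') (b y, v))
    (fderiv ℝ (fun z => b' (b.symm z)) (b y)) (h.fderiv_transition_fst h' hy hy' hv hv')
  rw [← h0, zeroExt_of_mem hv, zeroExt_of_mem h1, inChart_change α h.holo h'.holo hv hv', ← h2,
    ← fderiv_real_eq hτd]
  rfl

omit [IsManifold 𝓘(ℂ, B) ω M] [IsManifold 𝓘(ℂ, E) ω X] in
-- Where the expression in e' is nonzero, the point lies in the support of α, hence in both charts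
-- and over y. So nothing outside the overlap contributes to the integral.
theorem zeroExt_eq_zero_of_notMem_image (h : IsAdmissible B E π e b)
    (h' : IsAdmissible B E π e' b') (hs : tsupport α ⊆ e.source) {y : M}
    (hy' : y ∈ b'.source) {v : Fin n → ℂ}
    (hv : v ∉ (fun v => (transition e e' (b y, v)).2) ''
      {v | (b y, v) ∈ e.target ∧ e.symm (b y, v) ∈ e'.source}) : zeroExt e' α (b' y, v) = 0 := by
  by_contra h0
  obtain ⟨h1, h2⟩ := zeroExt_ne_zero h0
  have hπ := h'.map_symm hy' h1
  have h3 : (b y, (e (e'.symm (b' y, v))).2) = e (e'.symm (b' y, v)) := by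
    refine Prod.ext ?_ rfl
    have := h.fst_eq _ (hs h2)
    rw [hπ] at this
    exact this.symm
  refine hv ⟨(e (e'.symm (b' y, v))).2, ⟨?_, ?_⟩, ?_⟩
  · rw [h3]; exact e.map_source (hs h2)
  · rw [h3, e.left_inv (hs h2)]; exact e'.map_target h1
  · change (e' (e.symm (b y, (e (e'.symm (b' y, v))).2))).2 = v
    rw [h3, e.left_inv (hs h2), e'.right_inv h1]

omit [IsManifold 𝓘(ℂ, B) ω M] in
/-- The integral along the fibres of a form supported in two admissible charts may be computed in
either of them. -/
theorem fiberForm_change [CompactSpace X] (h : IsAdmissible B E π e b)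
    (h' : IsAdmissible B E π e' b')
    (hα : IsSmoothForm α) (hs : tsupport α ⊆ e.source) (hs' : tsupport α ⊆ e'.source) {y : M}
    (hy : y ∈ b.source) (hy' : y ∈ b'.source) :
    fiberForm (2 * n) (frameBasis n) (zeroExt e α) (b y) =
      (fiberForm (2 * n) (frameBasis n) (zeroExt e' α) (b' y)).compContinuousLinearMap
        (fderiv ℝ (fun z => b' (b.symm z)) (b y)) := by
  -- Change of variables in the fibre over y along the slice of the transition map. The Jacobian it
  -- requires is the determinant produced by the vertical contraction.
  refine integral_eq_map_integral_of_change
    (ContinuousAlternatingMap.compContinuousLinearMapCLM (ι := Fin r) (F := ℂ)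
      (fderiv ℝ (fun z => b' (b.symm z)) (b y)))
    (U := {v | (b y, v) ∈ e.target ∧ e.symm (b y, v) ∈ e'.source})
    (g := fun v => (transition e e' (b y, v)).2)
    (D := fun v => (verticalPart (fderiv ℂ (transition e e') (b y, v))).restrictScalars ℝ)
    ?_ ?_ ?_ ?_ ?_ ?_ ?_
  · exact (e.isOpen_inter_preimage_symm e'.open_source).preimage
      (by fun_prop : Continuous fun v : Fin n → ℂ => (b y, v))
  · intro v hv
    exact (hasFDerivAt_snd_slice ((h.holo.contDiffAt_transition h'.holo hv.1
      hv.2).differentiableAt (by simp))).hasFDerivWithinAt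
  · intro v hv w hw hvw
    have h1 : transition e e' (b y, v) = transition e e' (b y, w) :=
      (h.transition_eq h' hy hv.1 hv.2).trans
        ((congrArg (Prod.mk (b' y)) hvw).trans (h.transition_eq h' hy hw.1 hw.2).symm)
    exact congrArg Prod.snd (e.symm.injOn hv.1 hw.1 (e'.injOn hv.2 hw.2 h1))
  · intro v hv
    exact verticalContractL_zeroExt_change h h' hy hy' hv.1 hv.2
  · intro v hv
    have : zeroExt e α (b y, v) = 0 := by
      by_contra h0
      obtain ⟨h1, h2⟩ := zeroExt_ne_zero h0
      exact hv ⟨h1, hs' h2⟩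
    rw [this, map_zero]
  · intro v hv
    rw [zeroExt_eq_zero_of_notMem_image h h' hs hy' hv, map_zero]
  · exact integrable_verticalContractL (contDiff_zeroExt hα h'.holo hs')
      (hasCompactSupport_zeroExt hs') _

/-- Outside π(supp α) both sides vanish; over it y lies in both base charts and the fibre integrals
can be compared. -/
theorem pushChart_change [CompactSpace X] (h : IsAdmissible B E π e b)
    (h' : IsAdmissible B E π e' b')
    (hα : IsSmoothForm α) (hs : tsupport α ⊆ e.source) (hs' : tsupport α ⊆ e'.source) :
    pushChart e b α = pushChart e' b' α := by
  funext y
  by_cases hy : y ∈ π '' tsupport α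
  · obtain ⟨x, hx, rfl⟩ := hy
    have hb := h.mapsTo (hs hx)
    have hb' := h'.mapsTo (hs' hx)
    have hc := mem_chart_source B (π x)
    have hl := (chartAt B (π x)).left_inv hc
    rw [pushChart_of_mem hb, pushChart_of_mem hb', fiberForm_change h h' hα hs hs' hb hb',
      fderiv_comp_transition (isHolomorphicChart_chartAt (π x)) h.holo_base h'.holo_base
        ((chartAt B (π x)).map_source hc) (by rwa [hl]) (by rwa [hl]), hl]
    rfl
  · rw [pushChart_eq_zero h hy, pushChart_eq_zero h' hy]

end ChangeOfCharts

/-! ### Global integration along the fibres and Stokes' formula. -/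

section Integrate

variable {B : Type*} [NormedAddCommGroup B] [NormedSpace ℂ B]
  {E : Type*} [NormedAddCommGroup E] [NormedSpace ℂ E]
  {M : Type*} [TopologicalSpace M] [ChartedSpace B M] [IsManifold 𝓘(ℂ, B) ω M] [T2Space M]
  {X : Type*} [TopologicalSpace X] [ChartedSpace E X] [IsManifold 𝓘(ℂ, E) ω X] [CompactSpace X]
  {n r : ℕ} {π : X → M} (P : FiberPartition B E n π)

omit [IsManifold 𝓘(ℂ, B) ω M] [T2Space M] [IsManifold 𝓘(ℂ, E) ω X] [CompactSpace X] in
theorem FiberPartition.tsupport_smul_subset {p : ℕ} (i : Fin P.N) (β : DForm E X p) :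
    tsupport (fun x => P.ρ i x • β x) ⊆ (P.chart i).source :=
  (tsupport_form_smul_subset_left _ _).trans (P.tsupport_subset i)

omit [IsManifold 𝓘(ℂ, B) ω M] [T2Space M] [IsManifold 𝓘(ℂ, E) ω X] [CompactSpace X] in
theorem FiberPartition.sum_smul_eq {p : ℕ} (β : DForm E X p) :
    β = ∑ i, fun x => P.ρ i x • β x := by
  funext x
  rw [Finset.sum_apply, ← Finset.sum_smul, P.sum_eq_one, one_smul]

omit [T2Space M] in
-- Each γ_i is supported in chart i but need not be a multiple of ρ_i. The piece ρ_j γ_i, originally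
-- integrated in chart j, is moved to chart i, and there the sum over j restores γ_i.
theorem FiberPartition.integrate_sum {γ : Fin P.N → DForm E X (r + 2 * n)}
    (hγ : ∀ i, IsSmoothForm (γ i)) (hs : ∀ i, tsupport (γ i) ⊆ (P.chart i).source) :
    P.integrate (∑ i, γ i) = ∑ i, pushChart (P.chart i) (P.base i) (γ i) := by
  have hρ : ∀ j i, IsSmoothForm fun x => P.ρ j x • γ i x := fun j i => (hγ i).smul (P.smooth j)
  have hρs : ∀ j i, tsupport (fun x => P.ρ j x • γ i x) ⊆ (P.chart i).source := fun j i =>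
    (tsupport_form_smul_subset_right _ _).trans (hs i)
  have h1 : ∀ j, pushChart (P.chart j) (P.base j) (fun x => P.ρ j x • (∑ i, γ i) x) =
      ∑ i, pushChart (P.chart i) (P.base i) fun x => P.ρ j x • γ i x := by
    intro j
    have : (fun x => P.ρ j x • (∑ i, γ i) x) = ∑ i, fun x => P.ρ j x • γ i x := by
      funext x
      rw [Finset.sum_apply, Finset.sum_apply, Finset.smul_sum]
    rw [this, pushChart_sum _ (P.admissible j).holo (hρ j) fun i => P.tsupport_smul_subset j (γ i)]
    exact Finset.sum_congr rfl fun i _ => pushChart_change (P.admissible j) (P.admissible i)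
      (hρ j i) (P.tsupport_smul_subset j (γ i)) (hρs j i)
  rw [P.integrate_eq, Finset.sum_congr rfl fun j _ => h1 j, Finset.sum_comm]
  refine Finset.sum_congr rfl fun i _ => ?_
  rw [← pushChart_sum _ (P.admissible i).holo (fun j => hρ j i) fun j => hρs j i,
    ← P.sum_smul_eq]

theorem FiberPartition.isSmoothForm_integrate (hπ : Continuous π) {β : DForm E X (r + 2 * n)}
    (hβ : IsSmoothForm β) : IsSmoothForm (P.integrate β) := by
  rw [P.integrate_eq]
  exact IsSmoothForm.sum _ fun i => isSmoothForm_pushChart (P.admissible i) hπ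
    (hβ.smul (P.smooth i)) (P.tsupport_smul_subset i β)

/-- Integration along the fibres commutes with the exterior derivative. -/
theorem FiberPartition.dForm_integrate (hr : r + 2 * n + 1 = r + 1 + 2 * n) (hπ : Continuous π)
    {β : DForm E X (r + 2 * n)} (hβ : IsSmoothForm β) :
    dForm (P.integrate β) = P.integrate fun x => castDegree hr (dForm β x) := by
  -- As ∑ ρ_i = 1, the form dβ is the sum of the d(ρ_i β). A single summand also contains dρ_i ∧ β,
  -- so the definition of the integral does not apply to it termwise and `integrate_sum` is needed.
  have h1 : (fun x => castDegree hr (dForm β x)) =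
      ∑ i, fun x => castDegree hr (dForm (fun x => P.ρ i x • β x) x) := by
    funext x
    conv_lhs => rw [P.sum_smul_eq β, dForm_sum _ fun i => hβ.smul (P.smooth i)]
    rw [Finset.sum_apply, Finset.sum_apply]
    clear * -
    generalize r + 1 + 2 * n = s at hr
    subst hr
    rfl
  rw [P.integrate_eq, dForm_sum _ fun i => isSmoothForm_pushChart (P.admissible i) hπ
    (hβ.smul (P.smooth i)) (P.tsupport_smul_subset i β), h1, P.integrate_sum
    (fun i => IsSmoothForm.castDegree hr (hβ.smul (P.smooth i)).dForm) fun i => ?_]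
  · exact Finset.sum_congr rfl fun i _ => dForm_pushChart hr (P.admissible i) hπ
      (hβ.smul (P.smooth i)) (P.tsupport_smul_subset i β)
  · exact (tsupport_subset_of_zero fun x h => by rw [h, castDegree_zero]).trans
      ((tsupport_dForm_subset _).trans (P.tsupport_smul_subset i β))

omit [T2Space M] in
/-- The integral along the fibres of an exact form of fibre degree vanishes. -/
theorem FiberPartition.integrate_dForm_eq_zero {q : ℕ} (hq : q + 1 = 0 + 2 * n)
    {β : DForm E X q} (hβ : IsSmoothForm β) :
    P.integrate (r := 0) (fun x => castDegree hq (dForm β x)) = 0 := by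
  have h1 : (fun x => castDegree hq (dForm β x)) =
      ∑ i, fun x => castDegree hq (dForm (fun x => P.ρ i x • β x) x) := by
    funext x
    conv_lhs => rw [P.sum_smul_eq β, dForm_sum _ fun i => hβ.smul (P.smooth i)]
    rw [Finset.sum_apply, Finset.sum_apply]
    clear * -
    generalize 0 + 2 * n = s at hq
    subst hq
    rfl
  rw [h1, P.integrate_sum
    (fun i => IsSmoothForm.castDegree hq (hβ.smul (P.smooth i)).dForm) fun i => ?_]
  · refine Finset.sum_eq_zero fun i _ => ?_
    funext y
    by_cases hy : y ∈ (P.base i).source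
    · rw [pushChart_of_mem hy]
      have h2 : zeroExt (P.chart i) (fun x => castDegree hq (dForm (fun x => P.ρ i x • β x) x)) =
          fun z => castDegree hq (extDeriv (zeroExt (P.chart i) fun x => P.ρ i x • β x) z) := by
        funext z
        rw [zeroExt_castDegree, extDeriv_zeroExt (hβ.smul (P.smooth i)) (P.admissible i).holo
          (P.tsupport_smul_subset i β)]
      have h3 := contDiff_zeroExt (hβ.smul (P.smooth i)) (P.admissible i).holo
          (P.tsupport_smul_subset i β)
      have h4 := hasCompactSupport_zeroExt (P.tsupport_smul_subset i β)
      have h5 : fiberForm (r := 0) (2 * n) (frameBasis n) (fun z => castDegree hq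
          (extDeriv (zeroExt (P.chart i) fun x => P.ρ i x • β x) z)) (P.base i y) = 0 := by
        revert h3 h4
        generalize zeroExt (P.chart i) (fun x => P.ρ i x • β x) = A
        generalize (frameBasis n : Fin (2 * n) → Fin n → ℂ) = f
        intro h3 h4
        -- The number 2n of contracted vectors is replaced by a variable, so that its equality with
        -- q + 1 can be substituted in the types.
        have h6 : ∀ (s : ℕ) (hs : s = q + 1) (f : Fin s → Fin n → ℂ) (h : q + 1 = 0 + s),
            fiberForm (r := 0) s f (fun z => castDegree h (extDeriv A z)) (P.base i y) = 0 := by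
          intro s hs f h
          subst hs
          exact fiberForm_extDeriv_eq_zero q f h h3 h4 _
        exact h6 (2 * n) (by omega) f hq
      rw [h2, h5]
      rfl
    · exact pushChart_of_notMem hy
  · exact (tsupport_subset_of_zero fun x h => by rw [h, castDegree_zero]).trans
      ((tsupport_dForm_subset _).trans (P.tsupport_smul_subset i β))

end Integrate

/-! ### Rotation invariance and positivity after vertical contraction. -/

section RotationInvariance

variable {E : Type*} [NormedAddCommGroup E] [NormedSpace ℂ E]
  {B : Type*} [NormedAddCommGroup B] [NormedSpace ℂ B]

/-- Write c = a + ib and expand: the mixed terms cancel, and the others add up to (a² + b²) γ(u, v).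
-/
theorem IsJInvariant.apply_smul {γ : E [⋀^Fin 2]→L[ℝ] ℂ} (hJ : IsJInvariant γ) {c : ℂ}
    (hc : ‖c‖ = 1) (u v : E) : γ ![c • u, c • v] = γ ![u, v] := by
  have h1 : γ ![Complex.I • u, v] = -γ ![u, Complex.I • v] := by
    rw [form_two_swap, hJ.apply_I_right_comm]
  have h2 : c.re ^ 2 + c.im ^ 2 = 1 := by
    have := Complex.sq_norm c
    rw [hc, Complex.normSq_apply] at this
    nlinarith
  rw [smul_eq_re_add_im c u, smul_eq_re_add_im c v, form_two_add_left, form_two_add_right,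
    form_two_add_right, form_two_smul_left, form_two_smul_left, form_two_smul_left,
    form_two_smul_left, form_two_smul_right, form_two_smul_right, form_two_smul_right,
    form_two_smul_right, h1, hJ]
  simp only [Complex.real_smul]
  have h3 : (c.re : ℂ) ^ 2 + (c.im : ℂ) ^ 2 = 1 := by exact_mod_cast h2
  linear_combination (γ ![u, v]) * h3

theorem IsJInvariant.wedgePow_apply_smul {γ : E [⋀^Fin 2]→L[ℝ] ℂ} (hJ : IsJInvariant γ) {c : ℂ}
    (hc : ‖c‖ = 1) (N : ℕ) (w : Fin (2 * N) → E) :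
    wedgePow γ N (fun i => c • w i) = wedgePow γ N w := by
  have h : γ.compContinuousLinearMap ((c • ContinuousLinearMap.id ℂ E).restrictScalars ℝ) = γ := by
    ext w
    rw [ContinuousAlternatingMap.compContinuousLinearMap_apply]
    have h0 : ∀ w : Fin 2 → E, w = ![w 0, w 1] := fun w => by
      funext i; fin_cases i <;> rfl
    rw [h0 w, ← hJ.apply_smul hc]
    congr 1
    funext i
    fin_cases i <;> rfl
  conv_rhs => rw [← h, ← wedgePow_compContinuousLinearMap]
  rfl

theorem castDegree_wedgePow_apply_smul {γ : E [⋀^Fin 2]→L[ℝ] ℂ} (hJ : IsJInvariant γ) {c : ℂ}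
    (hc : ‖c‖ = 1) {N p : ℕ} (h : 2 * N = p) (w : Fin p → E) :
    castDegree h (wedgePow γ N) (fun i => c • w i) = castDegree h (wedgePow γ N) w := by
  subst h
  exact hJ.wedgePow_apply_smul hc N w

theorem append_smul {p q s : ℕ} (h : s = p + q) (c : ℂ) (f : Fin p → E) (g : Fin q → E) :
    (fun i : Fin s => c • Fin.append f g (Fin.cast h i)) =
      fun i => Fin.append (fun j => c • f j) (fun j => c • g j) (Fin.cast h i) := by
  subst h
  funext i
  refine Fin.addCases (fun j => ?_) (fun j => ?_) i <;> simp

/-- Rotating only the base vectors by c amounts to rotating all vectors by c after multiplying the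
vertical frame by c⁻¹. The latter costs |det c⁻¹|² = 1. -/
theorem verticalContractL_wedgePow_smul {n k : ℕ} {γ : (B × (Fin n → ℂ)) [⋀^Fin 2]→L[ℝ] ℂ}
    (hJ : IsJInvariant γ) {c : ℂ} (hc : ‖c‖ = 1) (h : 2 * (n + k) = 2 * k + 2 * n)
    (w : Fin (2 * k) → B) :
    verticalContractL (2 * n) (frameBasis n) (castDegree h (wedgePow γ (n + k)))
      (fun i => c • w i) =
    verticalContractL (2 * n) (frameBasis n) (castDegree h (wedgePow γ (n + k))) w := by
  have hc0 : c ≠ 0 := by rintro rfl; simp at hc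
  set β := castDegree h (wedgePow γ (n + k)) with hβ
  have h1 : ∀ w : Fin (2 * k) → B, verticalContractL (2 * n) (frameBasis n) β w =
      contract (2 * n) (verticalFrame B n) β (fun i => (w i, 0)) := fun w => by
    rw [verticalContractL_apply, vertical_eq]; rfl
  rw [h1, h1, contract_apply]
  have h2 : (fun i => Fin.append (verticalFrame B n) (fun i => (c • w i, (0 : Fin n → ℂ)))
      (Fin.cast (Nat.add_comm (2 * k) (2 * n)) i)) = fun i => c • Fin.append
        (fun j => ((0 : B), ((c⁻¹ • LinearMap.id : (Fin n → ℂ) →ₗ[ℂ] (Fin n → ℂ)))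
          (frameBasis n j))) (fun i => (w i, (0 : Fin n → ℂ)))
        (Fin.cast (Nat.add_comm (2 * k) (2 * n)) i) := by
    rw [append_smul]
    funext i
    congr 1
    · funext j
      rw [verticalFrame_eq_inr_frameBasis]
      refine Prod.ext (by simp) ?_
      simp [smul_smul, mul_inv_cancel₀ hc0]
    · funext j
      exact Prod.ext rfl (by simp)
  rw [h2, hβ, castDegree_wedgePow_apply_smul hJ hc h, ← contract_apply, contract_vertical_det]
  have h3 : Complex.normSq (LinearMap.det (c⁻¹ • LinearMap.id : (Fin n → ℂ) →ₗ[ℂ] (Fin n → ℂ))) =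
      1 := by
    rw [LinearMap.det_smul, LinearMap.det_id, mul_one, map_pow, map_inv₀, Complex.normSq_eq_norm_sq,
      hc]
    simp
  rw [h3, one_smul]

theorem append_pairFrame {n k : ℕ} (h : 2 * (n + k) = 2 * n + 2 * k) (e : Fin n → E)
    (u : Fin k → E) : (fun i : Fin (2 * (n + k)) => Fin.append (pairFrame e) (pairFrame u)
      (Fin.cast h i)) = pairFrame (Fin.append e u) := by
  funext i
  obtain ⟨j, rfl⟩ : ∃ j : Fin (2 * n + 2 * k), i = Fin.cast h.symm j := ⟨Fin.cast h i, rfl⟩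
  refine Fin.addCases (fun j => ?_) (fun j => ?_) j
  · simp only [Fin.cast_cast, Fin.cast_eq_self, Fin.append_left]
    rw [pairFrame, pairFrame]
    congr 1
    exact (Fin.append_left e u ⟨j.1 / 2, by omega⟩).symm
  · simp only [Fin.cast_cast, Fin.cast_eq_self, Fin.append_right]
    rw [pairFrame, pairFrame]
    have h1 : (2 * n + j.1) % 2 = j.1 % 2 := by omega
    have h2 : (2 * n + j.1) / 2 = n + j.1 / 2 := by omega
    simp only [Fin.val_cast, Fin.val_natAdd, h1]
    congr 1
    refine (Fin.append_right e u ⟨j.1 / 2, by omega⟩).symm.trans ?_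
    congr 1
    ext
    simp [h2]

theorem linearIndependent_append_vertical {n k : ℕ} {u : Fin k → B}
    (hu : LinearIndependent ℂ u) : LinearIndependent ℂ (Fin.append
      (fun i : Fin n => ((0 : B), (Pi.single i (1 : ℂ) : Fin n → ℂ)))
      (fun i : Fin k => (u i, (0 : Fin n → ℂ)))) := by
  have h1 : LinearIndependent ℂ (fun i : Fin n => (Pi.single i (1 : ℂ) : Fin n → ℂ)) := by
    have := (Pi.basisFun ℂ (Fin n)).linearIndependent
    convert this using 1
    funext i
    simp
  have h2 := linearIndependent_inl_union_inr' hu h1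
  have h3 := h2.comp (fun i => ((finSumFinEquiv.symm : Fin (n + k) ≃ Fin n ⊕ Fin k).trans
    (Equiv.sumComm _ _)) i) (Equiv.injective _)
  convert h3 using 1
  funext i
  refine Fin.addCases (fun j => ?_) (fun j => ?_) i <;> simp

theorem castDegree_apply_cast {p q : ℕ} (h : p = q) (a : E [⋀^Fin p]→L[ℝ] ℂ) (w : Fin q → E) :
    castDegree h a w = a (fun i => w (Fin.cast h i)) := by
  subst h; rfl

/-- The value is ω^{n+k} on the pairs built from the n vertical basis vectors and the k lifts (u_i,
0). These n + k vectors are jointly independent over ℂ. -/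
theorem verticalContractL_wedgePow_pos {n k : ℕ} {γ : (B × (Fin n → ℂ)) [⋀^Fin 2]→L[ℝ] ℂ}
    (hJ : IsJInvariant γ) (ht : IsTamed γ) (h : 2 * (n + k) = 2 * k + 2 * n)
    {u : Fin k → B} (hu : LinearIndependent ℂ u) : ∃ r : ℝ, 0 < r ∧
    verticalContractL (2 * n) (frameBasis n) (castDegree h (wedgePow γ (n + k))) (pairFrame u) =
      r := by
  obtain ⟨r, hr, h1⟩ := wedgePow_pairFrame_pos hJ ht _ (linearIndependent_append_vertical
    (n := n) hu)
  refine ⟨r, hr, ?_⟩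
  rw [← h1, ← append_pairFrame (by omega), verticalContractL_apply, vertical_eq,
    ContinuousAlternatingMap.compContinuousLinearMap_apply, contract_apply, castDegree_apply_cast]
  congr 1
  funext i
  simp only [Fin.cast_cast]
  congr 1
  · funext j
    rw [verticalFrame_eq]
    exact (pairFrame_map (ContinuousLinearMap.inr ℂ B (Fin n → ℂ))
      (fun i => Pi.single i (1 : ℂ)) j).symm
  · funext j
    exact (pairFrame_map (ContinuousLinearMap.inl ℂ B (Fin n → ℂ)) u j).symm

end RotationInvariance

/-! ### Derivatives of holomorphic transition maps. -/

section Transition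

variable {E : Type*} [NormedAddCommGroup E] [NormedSpace ℂ E]
  {F : Type*} [NormedAddCommGroup F] [NormedSpace ℂ F]
  {F' : Type*} [NormedAddCommGroup F'] [NormedSpace ℂ F']
  {X : Type*} [TopologicalSpace X] [ChartedSpace E X]

/-- Holomorphy makes the derivative complex-linear, and the opposite transition inverts it on the
left. Complex linearity transports invariance, and injectivity is needed in addition for tameness.
-/
theorem exists_fderiv_transition {e : OpenPartialHomeomorph X F} {e' : OpenPartialHomeomorph X F'}
    (he : IsHolomorphicChart E e) (he' : IsHolomorphicChart E e') {y : F} (hy : y ∈ e.target)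
    (hy' : e.symm y ∈ e'.source) : ∃ A : F →L[ℂ] F', Function.Injective A ∧
      fderiv ℝ (fun z => e' (e.symm z)) y = A.restrictScalars ℝ := by
  have hd := (he.contDiffAt_transition he' hy hy').differentiableAt (by simp)
  refine ⟨_, fun u v huv => ?_, fderiv_real_eq hd⟩
  have h1 := fderiv_comp_transition he he' he hy hy' (e.map_target hy)
  have h2 : (fun z => e (e.symm z)) =ᶠ[𝓝 y] id := by
    filter_upwards [e.open_target.mem_nhds hy] with z hz
    exact e.right_inv hz
  rw [h2.fderiv_eq, fderiv_id, fderiv_real_eq hd] at h1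
  have h3 : ∀ w, w = fderiv ℝ (fun z => e (e'.symm z)) (e' (e.symm y))
      (fderiv ℂ (fun z => e' (e.symm z)) y w) := fun w => congrArg (fun l => l w) h1
  rw [h3 u, h3 v, huv]

variable [IsManifold 𝓘(ℂ, E) ω X]

theorem isJInvariant_inChart {γ : DForm E X 2} (hJ : ∀ x, IsJInvariant (γ x))
    {e : OpenPartialHomeomorph X F} (he : IsHolomorphicChart E e) {y : F} (hy : y ∈ e.target) :
    IsJInvariant (inChart γ e y) := by
  obtain ⟨A, -, hA⟩ := exists_fderiv_transition he (isHolomorphicChart_chartAt (e.symm y)) hy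
    (mem_chart_source E _)
  rw [inChart, hA]
  exact (hJ _).comp _ fun u => A.map_smul _ _

theorem isTamed_inChart {γ : DForm E X 2} (ht : ∀ x, IsTamed (γ x))
    {e : OpenPartialHomeomorph X F} (he : IsHolomorphicChart E e) {y : F} (hy : y ∈ e.target) :
    IsTamed (inChart γ e y) := by
  obtain ⟨A, hA', hA⟩ := exists_fderiv_transition he (isHolomorphicChart_chartAt (e.symm y)) hy
    (mem_chart_source E _)
  rw [inChart, hA]
  exact (ht _).comp _ (fun u => A.map_smul _ _) hA'

end Transition

/-! ### Type and positivity of the push-forward. -/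

section FiberPositivity

open MeasureTheory

variable {B : Type*} [NormedAddCommGroup B] [NormedSpace ℂ B]
  {E : Type*} [NormedAddCommGroup E] [NormedSpace ℂ E]
  {M : Type*} [TopologicalSpace M] [ChartedSpace B M] [IsManifold 𝓘(ℂ, B) ω M]
  {X : Type*} [TopologicalSpace X] [ChartedSpace E X] [IsManifold 𝓘(ℂ, E) ω X] [CompactSpace X]
  {n k r : ℕ} {π : X → M}

omit [IsManifold 𝓘(ℂ, B) ω M] in
theorem pushChart_apply {e : OpenPartialHomeomorph X (B × (Fin n → ℂ))}
    {b : OpenPartialHomeomorph M B} {α : DForm E X (r + 2 * n)} (he : IsHolomorphicChart E e)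
    (hα : IsSmoothForm α) (hs : tsupport α ⊆ e.source) {y : M} (hy : y ∈ b.source)
    (w : Fin r → B) : pushChart e b α y w =
      ∫ v, verticalContractL (2 * n) (frameBasis n) (zeroExt e α (b y, v))
        (fun i => fderiv ℝ (fun z => b ((chartAt B y).symm z)) (chartAt B y y) (w i)) := by
  rw [pushChart_of_mem hy]
  have hi := integrable_verticalContractL (f := frameBasis n) (contDiff_zeroExt hα he hs)
    (hasCompactSupport_zeroExt hs) (b y)
  exact ((ContinuousAlternatingMap.apply ℝ B ℂ fun i =>
    fderiv ℝ (fun z => b ((chartAt B y).symm z)) (chartAt B y y) (w i)).integral_comp_comm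
      hi).symm

variable (P : FiberPartition B E n π) {γ : DForm E X 2}

omit [IsManifold 𝓘(ℂ, E) ω X] [CompactSpace X] in
theorem zeroExt_smul_wedgePow {e : OpenPartialHomeomorph X (B × (Fin n → ℂ))} (ρ : X → ℝ)
    {p N : ℕ} (h : 2 * N = p) {y : B × (Fin n → ℂ)} (hy : y ∈ e.target) :
    zeroExt e (fun x => ρ x • castDegree h (wedgePow (γ x) N)) y =
      ρ (e.symm y) • castDegree h (wedgePow (inChart γ e y) N) := by
  rw [zeroExt_of_mem hy, inChart_smul, inChart_castDegree, inChart_wedgePow]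

theorem exists_fderiv_base {b : OpenPartialHomeomorph M B} (hb : IsHolomorphicChart B b) {y : M}
    (hy : y ∈ b.source) : ∃ A : B →L[ℂ] B, Function.Injective A ∧
      fderiv ℝ (fun z => b ((chartAt B y).symm z)) (chartAt B y y) = A.restrictScalars ℝ := by
  have hc := mem_chart_source B y
  exact exists_fderiv_transition (isHolomorphicChart_chartAt y) hb ((chartAt B y).map_source hc)
    (by rwa [(chartAt B y).left_inv hc])

omit [TopologicalSpace M] [ChartedSpace B M] [IsManifold 𝓘(ℂ, B) ω M] in
theorem form_sum_apply {p : ℕ} {ι : Type*} (s : Finset ι) (θ : ι → DForm B M p) (y : M)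
    (w : Fin p → B) : (∑ i ∈ s, θ i) y w = ∑ i ∈ s, θ i y w := by
  classical
  induction s using Finset.induction_on with
  | empty => rfl
  | insert i s hi ih => rw [Finset.sum_insert hi, Finset.sum_insert hi, ← ih]; rfl

theorem FiberPartition.isType_integrate_wedgePow (hγ : IsSmoothForm γ)
    (hJ : ∀ x, IsJInvariant (γ x)) (h : 2 * (n + k) = 2 * k + 2 * n) (y : M) :
    IsType k k (P.integrate (fun x => castDegree h (wedgePow (γ x) (n + k))) y) := by
  have hβ : IsSmoothForm fun x => castDegree h (wedgePow (γ x) (n + k)) :=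
    IsSmoothForm.castDegree h (hγ.wedgePow (n + k))
  refine isType_of_rotation_invariant _ fun c hc w => ?_
  rw [P.integrate_eq, form_sum_apply, form_sum_apply]
  refine Finset.sum_congr rfl fun i _ => ?_
  by_cases hy : y ∈ (P.base i).source
  · have hs := hβ.smul (P.smooth i)
    have ht := P.tsupport_smul_subset i fun x => castDegree h (wedgePow (γ x) (n + k))
    rw [pushChart_apply (P.admissible i).holo hs ht hy, pushChart_apply (P.admissible i).holo hs ht
      hy]
    obtain ⟨A, -, hA⟩ := exists_fderiv_base (P.admissible i).holo_base hy
    congr 1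
    funext v
    by_cases hv : (P.base i y, v) ∈ (P.chart i).target
    · rw [zeroExt_smul_wedgePow _ h hv, map_smul, ContinuousAlternatingMap.smul_apply,
        ContinuousAlternatingMap.smul_apply, hA]
      congr 1
      have := verticalContractL_wedgePow_smul
        (isJInvariant_inChart hJ (P.admissible i).holo hv) hc h fun i => A (w i)
      refine Eq.trans ?_ this
      congr 1
      funext i
      exact A.map_smul _ _
    · rw [zeroExt_of_notMem hv, map_zero]; rfl
  · rw [pushChart_of_notMem hy]; rfl

/-- The number s is the integral of ρ_i times a positive density. A single chart may miss the fibre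
over y, so only s ≥ 0 holds in general; the middle clause keeps track of when s > 0. -/
theorem FiberPartition.exists_pushChart_wedgePow_eq (hγ : IsSmoothForm γ)
    (hJ : ∀ x, IsJInvariant (γ x)) (ht : ∀ x, IsTamed (γ x))
    (h : 2 * (n + k) = 2 * k + 2 * n) (y : M) (i : Fin P.N) {u : Fin k → B}
    (hu : LinearIndependent ℂ u) : ∃ s : ℝ, 0 ≤ s ∧ ((∃ x, π x = y ∧ 0 < P.ρ i x) → 0 < s) ∧
      pushChart (P.chart i) (P.base i)
        (fun x => P.ρ i x • castDegree h (wedgePow (γ x) (n + k))) y (pairFrame u) = s := by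
  have hβ : IsSmoothForm fun x => castDegree h (wedgePow (γ x) (n + k)) :=
    IsSmoothForm.castDegree h (hγ.wedgePow (n + k))
  have hsource : ∀ x, 0 < P.ρ i x → x ∈ (P.chart i).source := fun x hx =>
    P.tsupport_subset i (subset_tsupport _ hx.ne')
  by_cases hy : y ∈ (P.base i).source
  · have hs := hβ.smul (P.smooth i)
    have hts := P.tsupport_smul_subset i fun x => castDegree h (wedgePow (γ x) (n + k))
    obtain ⟨A, hAinj, hA⟩ := exists_fderiv_base (P.admissible i).holo_base hy
    rw [pushChart_apply (P.admissible i).holo hs hts hy, hA]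
    set α : DForm E X (2 * k + 2 * n) :=
      fun x => P.ρ i x • castDegree h (wedgePow (γ x) (n + k)) with hα
    set φ : (Fin n → ℂ) → ℂ := fun v => verticalContractL (r := 2 * k) (2 * n) (frameBasis n)
      (zeroExt (P.chart i) α (P.base i y, v)) (fun j => A.restrictScalars ℝ (pairFrame u j)) with hφ
    have hAu : LinearIndependent ℂ (fun j => A (u j)) := by
      have := hu.map' (A : B →ₗ[ℂ] B) (LinearMap.ker_eq_bot.2 hAinj)
      exact this
    have hval : ∀ v (hv : (P.base i y, v) ∈ (P.chart i).target), ∃ r : ℝ, 0 < r ∧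
        φ v = ((P.ρ i ((P.chart i).symm (P.base i y, v)) * r : ℝ) : ℂ) := by
      intro v hv
      obtain ⟨r, hr, hr'⟩ := verticalContractL_wedgePow_pos
        (isJInvariant_inChart hJ (P.admissible i).holo hv)
        (isTamed_inChart ht (P.admissible i).holo hv) h hAu
      refine ⟨r, hr, ?_⟩
      rw [hφ]
      simp only [hα]
      rw [zeroExt_smul_wedgePow _ h hv, map_smul, ContinuousAlternatingMap.smul_apply]
      have h1 : (fun j => A.restrictScalars ℝ (pairFrame u j)) = pairFrame fun j => A (u j) :=
        (funext fun j => pairFrame_map A u j).symm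
      rw [h1, hr', Complex.real_smul, Complex.ofReal_mul]
    have hre : ∀ v, φ v = ((φ v).re : ℂ) ∧ 0 ≤ (φ v).re := by
      intro v
      by_cases hv : (P.base i y, v) ∈ (P.chart i).target
      · obtain ⟨r, hr, h1⟩ := hval v hv
        rw [h1]
        refine ⟨rfl, ?_⟩
        rw [Complex.ofReal_re]
        exact mul_nonneg (P.nonneg i _) hr.le
      · have : φ v = 0 := by
          rw [hφ]
          simp only []
          rw [zeroExt_of_notMem hv, map_zero]
          rfl
        rw [this]
        simp
    have hcd : ContDiff ℝ ∞ (zeroExt (P.chart i) α) := contDiff_zeroExt hs (P.admissible i).holo hts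
    have hcs : HasCompactSupport (zeroExt (P.chart i) α) := hasCompactSupport_zeroExt hts
    have hcont : Continuous φ := by
      have h1 : Continuous fun z => verticalContractL (r := 2 * k) (2 * n) (frameBasis n)
        (zeroExt (P.chart i) α z) := (contDiff_verticalContractL hcd).continuous
      exact (ContinuousAlternatingMap.apply ℝ B ℂ _).continuous.comp (h1.comp (by fun_prop))
    have hsupp : HasCompactSupport φ := by
      have h1 := hasCompactSupport_slice (hasCompactSupport_verticalContractL
        (r := 2 * k) (q := 2 * n) (f := frameBasis n) hcs) (P.base i y)
      exact h1.comp_left (g := fun a : B [⋀^Fin (2 * k)]→L[ℝ] ℂ =>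
        a fun j => A.restrictScalars ℝ (pairFrame u j)) rfl
    refine ⟨∫ v, (φ v).re, integral_nonneg fun v => (hre v).2, ?_, ?_⟩
    · rintro ⟨x, hx, hρ⟩
      have hxs := hsource x hρ
      have hex : (P.base i y, (P.chart i x).2) = P.chart i x := by
        refine Prod.ext ?_ rfl
        rw [(P.admissible i).fst_eq x hxs, hx]
      have hv : (P.base i y, (P.chart i x).2) ∈ (P.chart i).target := by
        rw [hex]; exact (P.chart i).map_source hxs
      obtain ⟨r, hr, h1⟩ := hval _ hv
      refine Continuous.integral_pos_of_hasCompactSupport_nonneg_nonzero (x := (P.chart i x).2)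
        (Complex.continuous_re.comp hcont) (hsupp.comp_left (g := Complex.re) rfl)
        (fun v => (hre v).2) ?_
      rw [h1, hex, (P.chart i).left_inv hxs, Complex.ofReal_re]
      exact (mul_pos hρ hr).ne'
    · rw [← integral_complex_ofReal]
      exact integral_congr_ae (Filter.Eventually.of_forall fun v => (hre v).1)
  · refine ⟨0, le_rfl, ?_, ?_⟩
    · rintro ⟨x, rfl, hρ⟩
      exact (hy ((P.admissible i).mapsTo (hsource x hρ))).elim
    · rw [pushChart_of_notMem hy]; rfl

theorem FiberPartition.isPositiveAt_integrate_wedgePow (hπ : Function.Surjective π)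
    (hγ : IsSmoothForm γ) (hJ : ∀ x, IsJInvariant (γ x)) (ht : ∀ x, IsTamed (γ x))
    (h : 2 * (n + k) = 2 * k + 2 * n) (y : M) :
    IsPositiveAt k (P.integrate (fun x => castDegree h (wedgePow (γ x) (n + k))) y) := by
  refine isPositiveAt_of_pairFrame fun u hu => ?_
  choose s hs0 hs1 hs using fun i => P.exists_pushChart_wedgePow_eq hγ hJ ht h y i hu
  -- Surjectivity provides a point over y. Some ρ_i is positive there, so at least one summand is
  -- strictly positive.
  obtain ⟨x, hx⟩ := hπ y
  have h1 : ∃ i, 0 < P.ρ i x := by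
    by_contra! hn
    have := Finset.sum_nonpos fun i (_ : i ∈ Finset.univ) => hn i
    rw [P.sum_eq_one] at this
    linarith
  obtain ⟨i, hi⟩ := h1
  refine ⟨∑ i, s i, Finset.sum_pos' (fun i _ => hs0 i) ⟨i, Finset.mem_univ i, hs1 i ⟨x, hx, hi⟩⟩,
    ?_⟩
  rw [P.integrate_eq, form_sum_apply, Finset.sum_congr rfl fun i _ => hs i]
  push_cast
  rfl

end FiberPositivity

/-! ### The operator ∂∂̄ on functions. -/

section DDbar

variable {E : Type*} [NormedAddCommGroup E] [NormedSpace ℂ E]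
  {F : Type*} [NormedAddCommGroup F] [NormedSpace ℂ F]

theorem dbar_apply (f : E → ℂ) (y : E) (w : Fin 1 → E) : dbar f y w =
    1 / 2 * (fderiv ℝ f y (w 0) + Complex.I * fderiv ℝ f y (Complex.I • w 0)) := rfl

theorem dbar_congr {f g : E → ℂ} {y : E} (h : f =ᶠ[𝓝 y] g) : dbar f =ᶠ[𝓝 y] dbar g := by
  filter_upwards [h.eventuallyEq_nhds] with z hz
  rw [dbar, dbar, hz.fderiv_eq]

theorem ddbar_congr {f g : E → ℂ} {y : E} (h : f =ᶠ[𝓝 y] g) : ddbar f y = ddbar g y :=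
  (dbar_congr h).extDeriv_eq

theorem contDiffAt_dbar {f : E → ℂ} {y : E} (hf : ContDiffAt ℝ ∞ f y) :
    ContDiffAt ℝ ∞ (dbar f) y := by
  have h1 : ContDiffAt ℝ ∞ (fderiv ℝ f) y := hf.fderiv_right (m := ∞) (by simp)
  exact (ContinuousAlternatingMap.ofSubsingletonLIE (𝕜 := ℝ) (E := E) (F := ℂ)
    (0 : Fin 1)).contDiff.contDiffAt.comp y
    ((h1.add ((h1.clm_comp contDiffAt_const).const_smul Complex.I)).const_smul (1 / 2 : ℂ))

theorem contDiffAt_ddbar {f : E → ℂ} {y : E} (hf : ContDiffAt ℝ ∞ f y) :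
    ContDiffAt ℝ ∞ (ddbar f) y := contDiffAt_extDeriv (contDiffAt_dbar hf)

theorem extDeriv_ddbar {f : E → ℂ} {y : E} (hf : ContDiffAt ℝ ∞ f y) :
    extDeriv (ddbar f) y = 0 :=
  extDeriv_extDeriv_apply (contDiffAt_dbar hf) minSmoothness_two_le_infty

theorem contDiffAt_eventually {G H : Type*} [NormedAddCommGroup G] [NormedSpace ℝ G]
    [NormedAddCommGroup H] [NormedSpace ℝ H] {f : G → H} {y : G} (hf : ContDiffAt ℝ ∞ f y) :
    ∀ᶠ z in 𝓝 y, DifferentiableAt ℝ f z :=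
  ((hf.of_le (m := 1) (by exact_mod_cast le_top)).eventually (by simp)).mono fun _ hz =>
    hz.differentiableAt (by simp)

theorem ddbar_add {f g : E → ℂ} {y : E} (hf : ContDiffAt ℝ ∞ f y) (hg : ContDiffAt ℝ ∞ g y) :
    ddbar (fun z => f z + g z) y = ddbar f y + ddbar g y := by
  have h : dbar (fun z => f z + g z) =ᶠ[𝓝 y] dbar f + dbar g := by
    filter_upwards [contDiffAt_eventually hf, contDiffAt_eventually hg] with z hz hz'
    ext w
    rw [dbar_apply, fderiv_fun_add hz hz']
    change _ = dbar f z w + dbar g z w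
    rw [dbar_apply, dbar_apply]
    simp only [_root_.add_apply]
    ring
  rw [ddbar, h.extDeriv_eq]
  exact extDeriv_add ((contDiffAt_dbar hf).differentiableAt (by simp))
    ((contDiffAt_dbar hg).differentiableAt (by simp))

theorem fderiv_dbar_apply {f : E → ℂ} {y : E} (hf : ContDiffAt ℝ ∞ f y) (w : Fin 1 → E) (u : E) :
    fderiv ℝ (fun z => dbar f z w) y u = 1 / 2 * (fderiv ℝ (fderiv ℝ f) y u (w 0) +
      Complex.I * fderiv ℝ (fderiv ℝ f) y u (Complex.I • w 0)) := by
  have h1 : HasFDerivAt (fderiv ℝ f) (fderiv ℝ (fderiv ℝ f) y) y :=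
    ((hf.fderiv_right (m := ∞) (by simp)).differentiableAt (by simp)).hasFDerivAt
  have h2 : ∀ v : E, HasFDerivAt (fun z => fderiv ℝ f z v)
      ((ContinuousLinearMap.apply ℝ ℂ v).comp (fderiv ℝ (fderiv ℝ f) y)) y := fun v =>
    (ContinuousLinearMap.apply ℝ ℂ v).hasFDerivAt.comp y h1
  have h3 := (((h2 (w 0)).add ((h2 (Complex.I • w 0)).const_mul Complex.I)).const_mul
    (1 / 2 : ℂ)).fderiv
  have h4 := congrArg (fun l => l u) h3
  exact h4

/-- In d(∂̄f) the second derivatives in the directions u, v cancel by symmetry; only those with one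
argument multiplied by i survive. -/
theorem ddbar_apply {f : E → ℂ} {y : E} (hf : ContDiffAt ℝ ∞ f y) (u v : E) :
    ddbar f y ![u, v] = Complex.I / 2 * (fderiv ℝ (fderiv ℝ f) y u (Complex.I • v) -
      fderiv ℝ (fderiv ℝ f) y v (Complex.I • u)) := by
  have hs : fderiv ℝ (fderiv ℝ f) y u v = fderiv ℝ (fderiv ℝ f) y v u :=
    (hf.isSymmSndFDerivAt minSmoothness_two_le_infty).eq u v
  rw [ddbar, extDeriv_apply ((contDiffAt_dbar hf).differentiableAt (by simp)), Fin.sum_univ_two,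
    fderiv_dbar_apply hf, fderiv_dbar_apply hf]
  have h1 : Fin.removeNth 0 ![u, v] 0 = v := rfl
  have h2 : Fin.removeNth 1 ![u, v] 0 = u := rfl
  rw [h1, h2]
  simp only [Fin.val_zero, pow_zero, one_smul, Fin.val_one, pow_one, neg_smul,
    Matrix.cons_val_zero, Matrix.cons_val_one]
  rw [hs]
  ring

theorem isJInvariant_ddbar {f : E → ℂ} {y : E} (hf : ContDiffAt ℝ ∞ f y) :
    IsJInvariant (ddbar f y) := by
  intro u v
  have hs := hf.isSymmSndFDerivAt minSmoothness_two_le_infty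
  rw [ddbar_apply hf, ddbar_apply hf, smul_smul, smul_smul, Complex.I_mul_I, neg_one_smul,
    neg_one_smul, map_neg, map_neg, hs.eq (Complex.I • u) v, hs.eq (Complex.I • v) u]
  ring

theorem ddbar_apply_self {f : E → ℂ} {y : E} (hf : ContDiffAt ℝ ∞ f y) (u : E) :
    Complex.I * ddbar f y ![u, Complex.I • u] = 1 / 2 * (fderiv ℝ (fderiv ℝ f) y u u +
      fderiv ℝ (fderiv ℝ f) y (Complex.I • u) (Complex.I • u)) := by
  rw [ddbar_apply hf, smul_smul, Complex.I_mul_I, neg_one_smul, map_neg]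
  linear_combination (-1 / 2 * (fderiv ℝ (fderiv ℝ f) y u u +
      fderiv ℝ (fderiv ℝ f) y (Complex.I • u) (Complex.I • u))) * Complex.I_mul_I

theorem dbar_comp {f : F → ℂ} {g : E → F} {y : E} (hf : DifferentiableAt ℝ f (g y))
    (hg : DifferentiableAt ℂ g y) :
    dbar (fun z => f (g z)) y = (dbar f (g y)).compContinuousLinearMap (fderiv ℝ g y) := by
  have h : fderiv ℝ (fun z => f (g z)) y = (fderiv ℝ f (g y)).comp (fderiv ℝ g y) :=
    fderiv_comp y hf (hg.restrictScalars ℝ)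
  ext w
  rw [dbar_apply, h, fderiv_real_eq hg]
  change _ = dbar f (g y) (fun i => fderiv ℂ g y (w i))
  rw [dbar_apply, ← map_smul]
  rfl

theorem ddbar_comp {f : F → ℂ} {g : E → F} {y : E} (hf : ContDiffAt ℝ ∞ f (g y))
    (hg : ContDiffAt ℂ ω g y) :
    ddbar (fun z => f (g z)) y = (ddbar f (g y)).compContinuousLinearMap (fderiv ℝ g y) := by
  have hgr := contDiffAt_real_of_complex hg
  rw [ddbar, ddbar, ← extDeriv_pullback ((contDiffAt_dbar hf).differentiableAt (by simp)) hgr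
    minSmoothness_two_le_infty]
  refine Filter.EventuallyEq.extDeriv_eq ?_
  have h1 : ∀ᶠ z in 𝓝 y, DifferentiableAt ℂ g z :=
    ((hg.of_le (m := 1) (by exact_mod_cast le_top)).eventually (by simp)).mono fun _ hz =>
      hz.differentiableAt (by simp)
  filter_upwards [h1, hgr.continuousAt.eventually (contDiffAt_eventually hf)] with z hz hz'
  exact dbar_comp hz' hz

theorem ddbar_const (c : ℂ) (y : E) : ddbar (fun _ => c) y = 0 := by
  have : dbar (fun _ : E => c) = fun _ => 0 := by
    funext z
    ext w
    rw [dbar_apply]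
    simp
  rw [ddbar, this]
  exact extDeriv_const_zero _

theorem ddbar_of_holomorphic {f : E → ℂ} {y : E} (hf : ContDiffAt ℂ ω f y) : ddbar f y = 0 := by
  have h1 : ∀ᶠ z in 𝓝 y, DifferentiableAt ℂ f z :=
    ((hf.of_le (m := 1) (by exact_mod_cast le_top)).eventually (by simp)).mono fun _ hz =>
      hz.differentiableAt (by simp)
  have h2 : dbar f =ᶠ[𝓝 y] fun _ => 0 := by
    filter_upwards [h1] with z hz
    ext w
    rw [dbar_apply, fderiv_real_eq hz, ContinuousLinearMap.coe_restrictScalars', map_smul,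
      smul_eq_mul, ← mul_assoc, Complex.I_mul_I]
    simp
  rw [ddbar, h2.extDeriv_eq]
  exact extDeriv_const_zero _

theorem ddbar_of_antiholomorphic {f : E → ℂ} {y : E} (hf : ContDiffAt ℂ ω f y) :
    ddbar (fun z => (starRingEnd ℂ) (f z)) y = 0 := by
  have h1 : ∀ᶠ z in 𝓝 y, DifferentiableAt ℂ f z :=
    ((hf.of_le (m := 1) (by exact_mod_cast le_top)).eventually (by simp)).mono fun _ hz =>
      hz.differentiableAt (by simp)
  have hs : ContDiffAt ℝ ∞ (fun z => (starRingEnd ℂ) (f z)) y :=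
    Complex.conjCLE.contDiff.contDiffAt.comp y (contDiffAt_real_of_complex hf)
  -- For an antiholomorphic function ∂̄ is the whole exterior derivative, so ∂∂̄ is an instance of
  -- d² = 0.
  have h2 : dbar (fun z => (starRingEnd ℂ) (f z)) =ᶠ[𝓝 y] extDeriv (fun z =>
      ContinuousAlternatingMap.constOfIsEmpty ℝ E (Fin 0) ((starRingEnd ℂ) (f z))) := by
    filter_upwards [h1] with z hz
    rw [extDeriv_constOfIsEmpty]
    have h3 : HasFDerivAt (fun z => (starRingEnd ℂ) (f z))
        ((Complex.conjCLE : ℂ →L[ℝ] ℂ).comp ((fderiv ℂ f z).restrictScalars ℝ)) z :=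
      (Complex.conjCLE : ℂ →L[ℝ] ℂ).hasFDerivAt.comp z (hz.hasFDerivAt.restrictScalars ℝ)
    ext w
    rw [dbar_apply, h3.fderiv]
    change 1 / 2 * ((starRingEnd ℂ) (fderiv ℂ f z (w 0)) +
      Complex.I * (starRingEnd ℂ) (fderiv ℂ f z (Complex.I • w 0))) =
      (starRingEnd ℂ) (fderiv ℂ f z (w 0))
    rw [map_smul, smul_eq_mul, map_mul, Complex.conj_I]
    linear_combination (-1 / 2 * (starRingEnd ℂ) (fderiv ℂ f z (w 0))) * Complex.I_mul_I
  rw [ddbar, h2.extDeriv_eq]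
  exact extDeriv_extDeriv_apply
    ((ContinuousAlternatingMap.constOfIsEmptyLIE ℝ E ℂ (Fin 0)).contDiff.contDiffAt.comp y hs)
    minSmoothness_two_le_infty

/-- The logarithm of the modulus of a nonvanishing holomorphic function is pluriharmonic. -/
theorem ddbar_log_norm_sq {h : E → ℂ} {y : E} (hh : ContDiffAt ℂ ω h y) (h0 : h y ≠ 0) :
    ContDiffAt ℝ ∞ (fun z => ((Real.log (‖h z‖ ^ 2) : ℝ) : ℂ)) y ∧
    ddbar (fun z => ((Real.log (‖h z‖ ^ 2) : ℝ) : ℂ)) y = 0 := by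
  have h1 : ContDiffAt ℂ ω (fun z => h z / h y) y := by
    simpa only [div_eq_mul_inv] using hh.mul contDiffAt_const
  have h2 : ContDiffAt ℂ ω (fun z => Complex.log (h z / h y)) y := by
    refine ContDiffAt.comp (f := fun z => h z / h y) y (Complex.contDiffAt_log ?_) h1
    rw [div_self h0]
    exact Complex.one_mem_slitPlane
  -- The quotient h/h(y) takes the value 1 at y, so the principal branch of its logarithm is
  -- holomorphic near y, and log|h|² is twice its real part plus a constant.
  have h3 : (fun z => ((Real.log (‖h z‖ ^ 2) : ℝ) : ℂ)) =ᶠ[𝓝 y] fun z =>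
      (Complex.log (h z / h y) + (starRingEnd ℂ) (Complex.log (h z / h y))) +
        ((Real.log (‖h y‖ ^ 2) : ℝ) : ℂ) := by
    filter_upwards [hh.continuousAt.eventually_ne h0] with z hz
    rw [Complex.add_conj, Complex.log_re, norm_div, Real.log_div (norm_ne_zero_iff.2 hz)
      (norm_ne_zero_iff.2 h0), Real.log_pow, Real.log_pow]
    push_cast
    ring
  have s1 := contDiffAt_real_of_complex h2
  have s2 : ContDiffAt ℝ ∞ (fun z => (starRingEnd ℂ) (Complex.log (h z / h y))) y :=
    Complex.conjCLE.contDiff.contDiffAt.comp y s1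
  refine ⟨((s1.add s2).add contDiffAt_const).congr_of_eventuallyEq h3, ?_⟩
  rw [ddbar_congr h3, ddbar_add (s1.add s2) contDiffAt_const, ddbar_add s1 s2,
    ddbar_of_holomorphic h2, ddbar_of_antiholomorphic h2, ddbar_const, add_zero, add_zero]

end DDbar

/-! ### Complex constants and the exterior derivative. -/

section ExtDerivSmul

variable {E : Type*} [NormedAddCommGroup E] [NormedSpace ℂ E]

theorem extDeriv_const_smul {p : ℕ} (c : ℂ) {a : E → E [⋀^Fin p]→L[ℝ] ℂ} {y : E}
    (ha : DifferentiableAt ℝ a y) : extDeriv (fun z => c • a z) y = c • extDeriv a y := by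
  have h : DifferentiableAt ℝ (fun z => c • a z) y := ha.const_smul c
  ext w
  rw [extDeriv_apply h, ContinuousAlternatingMap.smul_apply, extDeriv_apply ha, Finset.smul_sum]
  refine Finset.sum_congr rfl fun i _ => ?_
  have h1 : HasFDerivAt (fun x => a x (Fin.removeNth i w))
      ((ContinuousAlternatingMap.apply ℝ E ℂ (Fin.removeNth i w)).comp (fderiv ℝ a y)) y :=
    HasFDerivAt.comp (g := ContinuousAlternatingMap.apply ℝ E ℂ (Fin.removeNth i w)) y
      (ContinuousAlternatingMap.apply ℝ E ℂ (Fin.removeNth i w)).hasFDerivAt ha.hasFDerivAt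
  have h2 : fderiv ℝ (fun x => (c • a x) (Fin.removeNth i w)) y =
      c • fderiv ℝ (fun x => a x (Fin.removeNth i w)) y := by
    rw [h1.fderiv]
    exact (h1.const_smul c).fderiv
  rw [h2, smul_comm c]
  rfl

end ExtDerivSmul

/-! ### Frames and transition functions of a line bundle. -/

section Trivializations

variable {E : Type*} [NormedAddCommGroup E] [NormedSpace ℂ E]
  {X : Type*} [TopologicalSpace X] [ChartedSpace E X]
  {L : X → Type*} [∀ x, AddCommGroup (L x)] [∀ x, Module ℂ (L x)]
  [∀ x, TopologicalSpace (L x)] [TopologicalSpace (Bundle.TotalSpace ℂ L)]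
  [FiberBundle ℂ L] [VectorBundle ℂ ℂ L]

/-- Local trivializations of a line bundle. -/
abbrev Triv (L : X → Type*) [TopologicalSpace (Bundle.TotalSpace ℂ L)] :=
  Bundle.Trivialization ℂ (Bundle.TotalSpace.proj : Bundle.TotalSpace ℂ L → X)

variable (t t' : Triv L) [MemTrivializationAtlas t] [MemTrivializationAtlas t']

theorem triv_symm_smul {x : X} (hx : x ∈ t.baseSet) (c : ℂ) : t.symm x c = c • t.symm x 1 := by
  rw [← t.coe_symmₗ (R := ℂ) hx, ← map_smul, smul_eq_mul, mul_one]

theorem triv_linearMapAt_symm {x : X} (hx : x ∈ t.baseSet) (c : ℂ) :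
    t.linearMapAt ℂ x (t.symm x c) = c := by
  rw [← t.coe_symmₗ (R := ℂ) hx, t.linearMapAt_symmₗ hx]

theorem triv_symm_linearMapAt {x : X} (hx : x ∈ t.baseSet) (ξ : L x) :
    t.symm x (t.linearMapAt ℂ x ξ) = ξ := by
  rw [← t.coe_symmₗ (R := ℂ) hx, t.symmₗ_linearMapAt hx]

theorem triv_symm_one_ne_zero {x : X} (hx : x ∈ t.baseSet) : t.symm x (1 : ℂ) ≠ 0 := by
  intro h
  have := triv_linearMapAt_symm t hx 1
  rw [h, map_zero] at this
  exact zero_ne_one this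

theorem triv_linearMapAt_eq {x : X} (hx : x ∈ t.baseSet) (ξ : L x) :
    ξ = t.linearMapAt ℂ x ξ • t.symm x (1 : ℂ) := by
  rw [← triv_symm_smul t hx, triv_symm_linearMapAt t hx]

/-- The transition function between two trivializations. -/
def trivChange (x : X) : ℂ := t'.linearMapAt ℂ x (t.symm x 1)

omit [MemTrivializationAtlas t] in
theorem trivChange_spec {x : X} (hx' : x ∈ t'.baseSet) :
    t.symm x (1 : ℂ) = trivChange t t' x • t'.symm x (1 : ℂ) := triv_linearMapAt_eq t' hx' _

theorem trivChange_ne_zero {x : X} (hx : x ∈ t.baseSet) (hx' : x ∈ t'.baseSet) :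
    trivChange t t' x ≠ 0 := by
  intro h
  have := trivChange_spec t t' hx'
  rw [h, zero_smul] at this
  exact triv_symm_one_ne_zero t hx this

theorem linearMapAt_change {x : X} (hx : x ∈ t.baseSet) (ξ : L x) :
    t'.linearMapAt ℂ x ξ = t.linearMapAt ℂ x ξ * trivChange t t' x := by
  conv_lhs => rw [triv_linearMapAt_eq t hx ξ, map_smul]
  rfl

theorem contMDiffOn_trivChange [ContMDiffVectorBundle ω ℂ L 𝓘(ℂ, E)] :
    ContMDiffOn 𝓘(ℂ, E) 𝓘(ℂ, ℂ) ω (trivChange t t') (t.baseSet ∩ t'.baseSet) := by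
  have h := contMDiffOn_coordChangeL (IB := 𝓘(ℂ, E)) (n := ω) t t'
  have h1 : ContMDiffOn 𝓘(ℂ, E) 𝓘(ℂ, ℂ) ω
      (fun x => (t.coordChangeL ℂ t' x : ℂ →L[ℂ] ℂ) 1) (t.baseSet ∩ t'.baseSet) :=
    h.clm_apply contMDiffOn_const
  refine h1.congr fun x hx => ?_
  rw [trivChange, t'.coe_linearMapAt_of_mem hx.2]
  exact (t.coordChangeL_apply t' hx 1).symm

end Trivializations

/-! ### The curvature and the Chern form. -/

section Curvature

variable {E : Type*} [NormedAddCommGroup E] [NormedSpace ℂ E]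
  {X : Type*} [TopologicalSpace X] [ChartedSpace E X] [IsManifold 𝓘(ℂ, E) ω X]
  {L : X → Type*} [∀ x, AddCommGroup (L x)] [∀ x, Module ℂ (L x)]
  [∀ x, TopologicalSpace (L x)] [TopologicalSpace (Bundle.TotalSpace ℂ L)]
  [FiberBundle ℂ L] [VectorBundle ℂ ℂ L] (φ : SmoothMetric E L)
  (t t' : Triv L) [MemTrivializationAtlas t] [MemTrivializationAtlas t']

/-- The weight of a metric in local coordinates, as a complex valued function. -/
def SmoothMetric.localWeight (φ : SmoothMetric E L) (t : Triv L) (e : OpenPartialHomeomorph X E)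
    (z : E) : ℂ := ((φ.weight t (e.symm z) : ℝ) : ℂ)

theorem contDiffAt_comp_chart_symm_complex {f : X → ℂ} {e : OpenPartialHomeomorph X E}
    (he : e ∈ atlas E X) {y : E} (hy : y ∈ e.target)
    (hf : ContMDiffAt 𝓘(ℂ, E) 𝓘(ℂ, ℂ) ω f (e.symm y)) :
    ContDiffAt ℂ ω (fun z => f (e.symm z)) y :=
  (hf.comp y ((isHolomorphicChart_of_mem_atlas he).2.contMDiffAt
    (e.open_target.mem_nhds hy))).contDiffAt

theorem SmoothMetric.contDiffAt_localWeight {e : OpenPartialHomeomorph X E} (he : e ∈ atlas E X)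
    {y : E} (hy : y ∈ e.target) (ht : e.symm y ∈ t.baseSet) :
    ContDiffAt ℝ ∞ (φ.localWeight t e) y := by
  have h1 : ContDiffAt ℝ ∞ (fun z => φ.normSq (e.symm z) (t.symm (e.symm z) 1)) y :=
    contDiffAt_comp_chart_symm he hy ((φ.smooth t).contMDiffAt (t.open_baseSet.mem_nhds ht))
  exact Complex.ofRealCLM.contDiff.contDiffAt.comp y
    (h1.log (φ.normSq_pos _ _ (triv_symm_one_ne_zero t ht)).ne').neg

omit [IsManifold 𝓘(ℂ, E) ω X] in
theorem SmoothMetric.weight_change {x : X} (hx : x ∈ t.baseSet) (hx' : x ∈ t'.baseSet) :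
    φ.weight t x = φ.weight t' x + -Real.log (‖trivChange t t' x‖ ^ 2) := by
  have h1 : ‖trivChange t t' x‖ ^ 2 ≠ 0 :=
    pow_ne_zero 2 (norm_ne_zero_iff.2 (trivChange_ne_zero t t' hx hx'))
  rw [SmoothMetric.weight, trivChange_spec t t' hx', φ.normSq_smul,
    Real.log_mul h1 (φ.normSq_pos _ _ (triv_symm_one_ne_zero t' hx')).ne', SmoothMetric.weight]
  ring

variable [ContMDiffVectorBundle ω ℂ L 𝓘(ℂ, E)]

/-- Two local weights differ by log|g|² for a nonvanishing holomorphic transition function g, and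
this is annihilated by ∂∂̄. -/
theorem SmoothMetric.ddbar_localWeight_change {e : OpenPartialHomeomorph X E} (he : e ∈ atlas E X)
    {y : E} (hy : y ∈ e.target) (ht : e.symm y ∈ t.baseSet) (ht' : e.symm y ∈ t'.baseSet) :
    ddbar (φ.localWeight t e) y = ddbar (φ.localWeight t' e) y := by
  have hopen : (e.symm ⁻¹' (t'.baseSet ∩ t.baseSet)) ∈ 𝓝 y :=
    (e.continuousAt_symm hy).preimage_mem_nhds
      ((t'.open_baseSet.inter t.open_baseSet).mem_nhds ⟨ht', ht⟩)
  have h1 : ContDiffAt ℂ ω (fun z => trivChange t' t (e.symm z)) y :=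
    contDiffAt_comp_chart_symm_complex he hy ((contMDiffOn_trivChange t' t).contMDiffAt
      ((t'.open_baseSet.inter t.open_baseSet).mem_nhds ⟨ht', ht⟩))
  obtain ⟨h2, h3⟩ := ddbar_log_norm_sq h1 (trivChange_ne_zero t' t ht' ht)
  have h4 : φ.localWeight t e =ᶠ[𝓝 y] fun z => φ.localWeight t' e z +
      ((Real.log (‖trivChange t' t (e.symm z)‖ ^ 2) : ℝ) : ℂ) := by
    filter_upwards [hopen] with z hz
    rw [SmoothMetric.localWeight, SmoothMetric.localWeight, φ.weight_change t' t hz.1 hz.2]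
    push_cast
    ring
  rw [ddbar_congr h4, ddbar_add (φ.contDiffAt_localWeight t' he hy ht') h2, h3, add_zero]

/-- The curvature form in an arbitrary chart, computed with an arbitrary trivialization. -/
theorem SmoothMetric.inChart_curvature {e : OpenPartialHomeomorph X E} (he : e ∈ atlas E X)
    {y : E} (hy : y ∈ e.target) (ht : e.symm y ∈ t.baseSet) :
    inChart φ.curvature e y = Complex.I • ddbar (φ.localWeight t e) y := by
  set x := e.symm y with hx
  have hc := chart_mem_atlas E x
  have hxs := mem_chart_source E x
  have hxt := FiberBundle.mem_baseSet_trivializationAt' (F := ℂ) (E := L) x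
  have hl : (chartAt E x).symm (chartAt E x x) = x := (chartAt E x).left_inv hxs
  have h1 := φ.contDiffAt_localWeight (FiberBundle.trivializationAt ℂ L x) hc
    ((chartAt E x).map_source hxs) (by rwa [hl])
  have h2 := (isHolomorphicChart_of_mem_atlas he).contDiffAt_transition
    (isHolomorphicChart_chartAt (E := E) x) hy hxs
  -- The curvature at x is defined by the chart and the frame preferred at x. The chart is changed
  -- by the naturality of ∂∂̄ under holomorphic maps, the frame by the preceding lemma.
  have h3 := ddbar_comp (f := φ.localWeight (FiberBundle.trivializationAt ℂ L x) (chartAt E x))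
    (g := fun z => chartAt E x (e.symm z)) h1 h2
  have h4 : (fun z => φ.localWeight (FiberBundle.trivializationAt ℂ L x) (chartAt E x)
      (chartAt E x (e.symm z))) =ᶠ[𝓝 y]
      φ.localWeight (FiberBundle.trivializationAt ℂ L x) e := by
    filter_upwards [(e.continuousAt_symm hy).preimage_mem_nhds
      ((chartAt E x).open_source.mem_nhds hxs)] with z hz
    rw [SmoothMetric.localWeight, SmoothMetric.localWeight, (chartAt E x).left_inv hz]
  rw [φ.ddbar_localWeight_change t (FiberBundle.trivializationAt ℂ L x) he hy ht hxt,
    ← ddbar_congr h4, h3]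
  rfl

theorem SmoothMetric.inChart_curvature_eventuallyEq (x : X) :
    inChart φ.curvature (chartAt E x) =ᶠ[𝓝 (chartAt E x x)] fun y => Complex.I •
      ddbar (φ.localWeight (FiberBundle.trivializationAt ℂ L x) (chartAt E x)) y := by
  have hxs := mem_chart_source E x
  have hx := (chartAt E x).map_source hxs
  filter_upwards [(chartAt E x).open_target.mem_nhds hx,
    ((chartAt E x).continuousAt_symm hx).preimage_mem_nhds
      ((FiberBundle.trivializationAt ℂ L x).open_baseSet.mem_nhds
        (by rw [(chartAt E x).left_inv hxs]
            exact FiberBundle.mem_baseSet_trivializationAt' (F := ℂ) (E := L) x))] with z hz hz'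
  exact φ.inChart_curvature _ (chart_mem_atlas E x) hz hz'

omit [ContMDiffVectorBundle ω ℂ L 𝓘(ℂ, E)] in
theorem SmoothMetric.contDiffAt_localWeight_self (x : X) : ContDiffAt ℝ ∞
    (φ.localWeight (FiberBundle.trivializationAt ℂ L x) (chartAt E x)) (chartAt E x x) := by
  have hxs := mem_chart_source E x
  refine φ.contDiffAt_localWeight _ (chart_mem_atlas E x) ((chartAt E x).map_source hxs) ?_
  rw [(chartAt E x).left_inv hxs]
  exact FiberBundle.mem_baseSet_trivializationAt' (F := ℂ) (E := L) x

theorem SmoothMetric.isSmoothForm_curvature : IsSmoothForm φ.curvature := by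
  refine isSmoothForm_of_local (F := E) fun x =>
    ⟨chartAt E x, isHolomorphicChart_chartAt x, mem_chart_source E x, ?_⟩
  exact ((contDiffAt_ddbar (φ.contDiffAt_localWeight_self x)).const_smul
    Complex.I).congr_of_eventuallyEq (φ.inChart_curvature_eventuallyEq x)

theorem SmoothMetric.dForm_curvature : dForm φ.curvature = 0 := by
  funext x
  have h := φ.contDiffAt_localWeight_self x
  rw [dForm, (φ.inChart_curvature_eventuallyEq x).extDeriv_eq,
    extDeriv_const_smul _ ((contDiffAt_ddbar h).differentiableAt (by simp)), extDeriv_ddbar h]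
  exact smul_zero (A := E [⋀^Fin (2 + 1)]→L[ℝ] ℂ) Complex.I

omit [ContMDiffVectorBundle ω ℂ L 𝓘(ℂ, E)] in
theorem SmoothMetric.isJInvariant_curvature (x : X) : IsJInvariant (φ.curvature x) := by
  intro u v
  exact congrArg (Complex.I * ·) (isJInvariant_ddbar (φ.contDiffAt_localWeight_self x) u v)

omit [IsManifold 𝓘(ℂ, E) ω X] [ContMDiffVectorBundle ω ℂ L 𝓘(ℂ, E)] in
omit [VectorBundle ℂ ℂ L] in
theorem SmoothMetric.IsPositive.isTamed_chernForm {φ : SmoothMetric E L} (h : φ.IsPositive)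
    (x : X) : IsTamed (φ.chernForm x) := by
  intro u hu
  obtain ⟨r, hr, h1⟩ := (h x).isTamed u hu
  refine ⟨(2 * Real.pi)⁻¹ * r, by have := Real.pi_pos; positivity, ?_⟩
  change (2 * Real.pi)⁻¹ • φ.curvature x ![u, Complex.I • u] = _
  rw [h1, Complex.real_smul, Complex.ofReal_mul]

omit [ContMDiffVectorBundle ω ℂ L 𝓘(ℂ, E)] in
theorem SmoothMetric.isJInvariant_chernForm (x : X) : IsJInvariant (φ.chernForm x) := by
  intro u v
  exact congrArg ((2 * Real.pi)⁻¹ • ·) (φ.isJInvariant_curvature x u v)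

theorem SmoothMetric.isSmoothForm_chernForm : IsSmoothForm φ.chernForm :=
  φ.isSmoothForm_curvature.smul (ρ := fun _ => (2 * Real.pi)⁻¹) contMDiff_const

theorem SmoothMetric.dForm_chernForm : dForm φ.chernForm = 0 := by
  funext x
  have h : inChart φ.chernForm (chartAt E x) =
      (2 * Real.pi)⁻¹ • inChart φ.curvature (chartAt E x) := rfl
  rw [dForm, h, extDeriv_smul]
  have h1 := congrFun φ.dForm_curvature x
  rw [dForm] at h1
  rw [h1]
  exact smul_zero (A := E [⋀^Fin (2 + 1)]→L[ℝ] ℂ) (2 * Real.pi)⁻¹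

end Curvature

/-! ### The local form of holomorphic submersions. -/

section LocalForm

variable {B : Type*} [NormedAddCommGroup B] [NormedSpace ℂ B] [FiniteDimensional ℂ B]
  {E : Type*} [NormedAddCommGroup E] [NormedSpace ℂ E] [FiniteDimensional ℂ E]

/-- A surjective linear map extends to an isomorphism onto a product with `ℂⁿ`. -/
theorem exists_equiv_fst_eq {n : ℕ} (hn : Module.finrank ℂ E = Module.finrank ℂ B + n)
    (A : E →L[ℂ] B) (hA : Function.Surjective A) :
    ∃ (K : E →L[ℂ] (Fin n → ℂ)) (Φ : E ≃L[ℂ] B × (Fin n → ℂ)),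
      (Φ : E →L[ℂ] B × (Fin n → ℂ)) = A.prod K := by
  have hker : Module.finrank ℂ (LinearMap.ker (A : E →ₗ[ℂ] B)) = n := by
    have h1 := (A : E →ₗ[ℂ] B).finrank_range_add_finrank_ker
    rw [LinearMap.range_eq_top.2 hA, finrank_top] at h1
    omega
  -- A linear retraction g onto the kernel of A complements A: the pair (A, g) is injective, and the
  -- dimensions agree.
  obtain ⟨g, hg⟩ := (LinearMap.ker (A : E →ₗ[ℂ] B)).subtype.exists_leftInverse_of_injective
    (Submodule.ker_subtype _)
  let κ := (Module.finBasisOfFinrankEq ℂ _ hker).equivFun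
  let K : E →L[ℂ] (Fin n → ℂ) := LinearMap.toContinuousLinearMap (κ.toLinearMap ∘ₗ g)
  have hinj : Function.Injective ((A.prod K : E →L[ℂ] B × (Fin n → ℂ)) :
      E →ₗ[ℂ] B × (Fin n → ℂ)) := by
    refine (injective_iff_map_eq_zero _).2 fun x hx => ?_
    have h1 : A x = 0 := congrArg Prod.fst hx
    have h2 : κ (g x) = 0 := congrArg Prod.snd hx
    have h3 : g x = 0 := by simpa using h2
    have h4 := LinearMap.congr_fun hg ⟨x, h1⟩
    have h5 : g x = ⟨x, h1⟩ := h4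
    exact congrArg Subtype.val (h5.symm.trans h3)
  refine ⟨K, (LinearEquiv.ofInjectiveOfFinrankEq _ hinj (by simp [hn])).toContinuousLinearEquiv, ?_⟩
  ext x <;> rfl

/-- A holomorphic function with surjective derivative is, in suitable local coordinates, the first
projection. -/
theorem exists_submersion_coordinates {n : ℕ} (hn : Module.finrank ℂ E = Module.finrank ℂ B + n)
    {f : E → B} {a : E} (hf : ContDiffAt ℂ ω f a) (hs : Function.Surjective (fderiv ℂ f a)) :
    ∃ g : OpenPartialHomeomorph E (B × (Fin n → ℂ)), a ∈ g.source ∧ (∀ x, (g x).1 = f x) ∧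
      (∀ x ∈ g.source, ContDiffAt ℂ ω g x) ∧ ∀ y ∈ g.target, ContDiffAt ℂ ω g.symm y := by
  obtain ⟨K, Φ, hΦ⟩ := exists_equiv_fst_eq hn (fderiv ℂ f a) hs
  have hF : ContDiffAt ℂ ω (fun x => (f x, K x)) a := hf.prodMk K.contDiff.contDiffAt
  have hF' : HasFDerivAt (fun x => (f x, K x)) (Φ : E →L[ℂ] B × (Fin n → ℂ)) a := by
    rw [hΦ]
    exact ((hf.differentiableAt (by simp)).hasFDerivAt).prodMk K.hasFDerivAt
  have : CompleteSpace E := FiniteDimensional.complete ℂ E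
  let g₀ := hF.toOpenPartialHomeomorph _ hF' (by simp)
  have hg₀ : ⇑g₀ = fun x => (f x, K x) := hF.toOpenPartialHomeomorph_coe hF' (by simp)
  have ha : a ∈ g₀.source := hF.mem_toOpenPartialHomeomorph_source hF' (by simp)
  have hinv : ContDiffAt ℂ ω g₀.symm (g₀ a) := by
    rw [hg₀]
    exact hF.to_localInverse hF' (by simp)
  -- The inverse function theorem gives analyticity of the inverse at the image of a only. The chart
  -- is shrunk to a neighbourhood on which the map and its inverse are analytic at every point.
  obtain ⟨U, hU, hUo, haU⟩ := eventually_nhds_iff.1 (hF.eventually (by simp))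
  obtain ⟨W, hW, hWo, haW⟩ := eventually_nhds_iff.1 (hinv.eventually (by simp))
  let g := g₀.restrOpen (U ∩ (g₀.source ∩ g₀ ⁻¹' W)) (hUo.inter (g₀.isOpen_inter_preimage hWo))
  have hsrc : g.source = g₀.source ∩ (U ∩ (g₀.source ∩ g₀ ⁻¹' W)) := rfl
  refine ⟨g, ?_, ?_, ?_, ?_⟩
  · rw [hsrc]
    exact ⟨ha, haU, ha, haW⟩
  · intro x
    change (g₀ x).1 = f x
    rw [hg₀]
  · intro x hx
    change ContDiffAt ℂ ω g₀ x
    rw [hg₀]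
    exact hU x hx.2.1
  · intro y hy
    have h1 := g.map_target hy
    rw [hsrc] at h1
    have h2 : g₀ (g.symm y) = y := g.right_inv hy
    have h3 : g₀ (g.symm y) ∈ W := h1.2.2.2
    rw [h2] at h3
    exact hW y h3

end LocalForm

/-! ### Existence of admissible charts and partitions. -/

section Existence

variable {B : Type*} [NormedAddCommGroup B] [NormedSpace ℂ B] [FiniteDimensional ℂ B]
  {E : Type*} [NormedAddCommGroup E] [NormedSpace ℂ E] [FiniteDimensional ℂ E]
  {M : Type*} [TopologicalSpace M] [ChartedSpace B M] [IsManifold 𝓘(ℂ, B) ω M]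
  {X : Type*} [TopologicalSpace X] [ChartedSpace E X] [IsManifold 𝓘(ℂ, E) ω X]

/-- A holomorphic submersion admits admissible charts around every point. -/
theorem exists_isAdmissible {n : ℕ} (hn : Module.finrank ℂ E = Module.finrank ℂ B + n)
    {π : X → M} (hπ : ContMDiff 𝓘(ℂ, E) 𝓘(ℂ, B) ω π) (x : X)
    (hs : Function.Surjective (mfderiv 𝓘(ℂ, E) 𝓘(ℂ, B) π x)) :
    ∃ (e : OpenPartialHomeomorph X (B × (Fin n → ℂ))) (b : OpenPartialHomeomorph M B),
      IsAdmissible B E π e b ∧ x ∈ e.source := by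
  set b := chartAt B (π x) with hb
  set c := chartAt E x with hc
  have hbh : IsHolomorphicChart B b := isHolomorphicChart_chartAt (π x)
  have hch : IsHolomorphicChart E c := isHolomorphicChart_chartAt x
  have hxc : x ∈ c.source := mem_chart_source E x
  have hf : ContDiffAt ℂ ω (fun z => b (π (c.symm z))) (c x) := by
    have h1 : ContMDiffAt 𝓘(ℂ, E) 𝓘(ℂ, E) ω c.symm (c x) :=
      hch.2.contMDiffAt (c.open_target.mem_nhds (c.map_source hxc))
    have h2 : ContMDiffAt 𝓘(ℂ, B) 𝓘(ℂ, B) ω b (π (c.symm (c x))) := by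
      rw [c.left_inv hxc]
      exact hbh.1.contMDiffAt (b.open_source.mem_nhds (mem_chart_source B (π x)))
    exact (h2.comp (c x) ((hπ _).comp (c x) h1)).contDiffAt
  have hs' : Function.Surjective (fderiv ℂ (fun z => b (π (c.symm z))) (c x)) := by
    have h1 := ((hπ x).mdifferentiableAt (by simp)).mfderiv
    rw [h1] at hs
    simp only [writtenInExtChartAt, Function.comp_def, extChartAt, mfld_simps, fderivWithin_univ] at hs
    exact hs
  obtain ⟨g, hag, hg1, hg, hgs⟩ := exists_submersion_coordinates hn hf hs'
  have hopen : IsOpen (π ⁻¹' b.source) := b.open_source.preimage hπ.continuous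
  let e := (c.restrOpen (π ⁻¹' b.source) hopen).trans g
  have hsrc : ∀ z, z ∈ e.source ↔ (z ∈ c.source ∧ π z ∈ b.source) ∧ c z ∈ g.source := by
    intro z
    simp only [e, OpenPartialHomeomorph.trans_source, Set.mem_inter_iff, Set.mem_preimage]
    rfl
  refine ⟨e, b, ⟨⟨fun z hz => ?_, fun y hy => ?_⟩, hbh, fun z hz => ((hsrc z).1 hz).1.2,
    fun z hz => ?_⟩, (hsrc x).2 ⟨⟨hxc, mem_chart_source B (π x)⟩, hag⟩⟩
  · obtain ⟨⟨h1, h2⟩, h3⟩ := (hsrc z).1 hz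
    have h4 : ContMDiffAt 𝓘(ℂ, E) 𝓘(ℂ, E) ω c z := hch.1.contMDiffAt (c.open_source.mem_nhds h1)
    exact ((hg _ h3).contMDiffAt.comp z h4).contMDiffWithinAt
  · obtain ⟨⟨h1, h2⟩, h3⟩ := (hsrc _).1 (e.map_target hy)
    have h5 : y ∈ g.target := by
      have := hy
      simp only [e, OpenPartialHomeomorph.trans_target, Set.mem_inter_iff] at this
      exact this.1
    have h6 : g.symm y ∈ c.target := by
      have : y ∈ e.target := hy
      simp only [e, OpenPartialHomeomorph.trans_target, Set.mem_inter_iff, Set.mem_preimage] at this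
      have h7 : g.symm y ∈ (c.restrOpen (π ⁻¹' b.source) hopen).target := this.2
      exact h7.1
    have h4 : ContMDiffAt 𝓘(ℂ, E) 𝓘(ℂ, E) ω c.symm (g.symm y) :=
      hch.2.contMDiffAt (c.open_target.mem_nhds h6)
    exact (h4.comp y (hgs y h5).contMDiffAt).contMDiffWithinAt
  · obtain ⟨⟨h1, h2⟩, h3⟩ := (hsrc z).1 hz
    change (g (c z)).1 = b (π z)
    rw [hg1, c.left_inv h1]

/-- This ensures that `fiberIntegral` is an actual integral and not its default value 0. -/
theorem nonempty_fiberPartition [CompactSpace X] [T2Space X] {n : ℕ}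
    (hn : Module.finrank ℂ E = Module.finrank ℂ B + n)
    {π : X → M} (hπ : ContMDiff 𝓘(ℂ, E) 𝓘(ℂ, B) ω π)
    (hs : ∀ x, Function.Surjective (mfderiv 𝓘(ℂ, E) 𝓘(ℂ, B) π x)) :
    Nonempty (FiberPartition B E n π) := by
  choose e b hadm hx using fun x => exists_isAdmissible hn hπ x (hs x)
  obtain ⟨t, ht⟩ := isCompact_univ.elim_finite_subcover (fun x => (e x).source)
    (fun x => (e x).open_source) fun x _ => Set.mem_iUnion.2 ⟨x, hx x⟩
  have := isManifold_real E X
  have : FiniteDimensional ℝ E := FiniteDimensional.complexToReal E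
  let p : Fin t.card → X := fun i => (t.equivFin.symm i : X)
  obtain ⟨ρ, hρ⟩ := SmoothPartitionOfUnity.exists_isSubordinate 𝓘(ℝ, E) (s := (Set.univ : Set X))
    isClosed_univ (fun i => (e (p i)).source) (fun i => (e (p i)).open_source) (by
      intro z hz
      obtain ⟨x, hxt, hzx⟩ := Set.mem_iUnion₂.1 (ht hz)
      refine Set.mem_iUnion.2 ⟨t.equivFin ⟨x, hxt⟩, ?_⟩
      simpa [p] using hzx)
  exact ⟨{
    N := t.card
    chart := fun i => e (p i)
    base := fun i => b (p i)
    admissible := fun i => hadm (p i)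
    ρ := fun i => ρ i
    smooth := fun i => (ρ i).contMDiff
    nonneg := fun i x => ρ.nonneg i x
    tsupport_subset := hρ
    sum_eq_one := fun x => by
      rw [← finsum_eq_sum_of_fintype]
      exact ρ.sum_eq_one (Set.mem_univ x) }⟩

end Existence
-- Second derivatives of log‖f‖².
section LogNorm

variable {E : Type*} [NormedAddCommGroup E] [NormedSpace ℂ E]
  {V : Type*} [NormedAddCommGroup V] [InnerProductSpace ℂ V]

theorem fderiv_norm_sq_apply {f : E → V} {z : E} (hf : DifferentiableAt ℂ f z) :
    HasFDerivAt (fun z => ‖f z‖ ^ 2) ((2 : ℝ) • (Complex.reCLM.comp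
      (((innerSL ℂ (f z)).restrictScalars ℝ).comp ((fderiv ℂ f z).restrictScalars ℝ)))) z := by
  let _ : InnerProductSpace ℝ V := InnerProductSpace.rclikeToReal ℂ V
  have h1 := (hf.hasFDerivAt.restrictScalars ℝ).norm_sq
  refine h1.congr_fderiv ?_
  ext u
  simp [real_inner_eq_re_inner]

theorem fderiv_log_norm_sq_apply {f : E → V} {z : E} (hf : DifferentiableAt ℂ f z) (h0 : f z ≠ 0)
    (u : E) : fderiv ℝ (fun z => Real.log (‖f z‖ ^ 2)) z u =
      (‖f z‖ ^ 2)⁻¹ * (2 * (inner ℂ (f z) (fderiv ℂ f z u)).re) := by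
  rw [((fderiv_norm_sq_apply hf).log (by positivity)).fderiv]
  rfl

theorem fderiv_fderiv_log_norm_sq {f : E → V} {y : E} (hf : ContDiffAt ℂ ω f y) (h0 : f y ≠ 0)
    (u : E) : fderiv ℝ (fun z => fderiv ℝ (fun z => Real.log (‖f z‖ ^ 2)) z u) y u =
      (‖f y‖ ^ 2)⁻¹ * (2 * (‖fderiv ℂ f y u‖ ^ 2 +
        (inner ℂ (f y) (fderiv ℂ (fderiv ℂ f) y u u)).re)) -
      (2 * (inner ℂ (f y) (fderiv ℂ f y u)).re) ^ 2 / (‖f y‖ ^ 2) ^ 2 := by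
  let _ : InnerProductSpace ℝ V := InnerProductSpace.rclikeToReal ℂ V
  have hd : ∀ᶠ z in 𝓝 y, DifferentiableAt ℂ f z :=
    ((hf.of_le (m := 1) (by exact_mod_cast le_top)).eventually (by simp)).mono fun _ hz =>
      hz.differentiableAt (by simp)
  have h1 : (fun z => fderiv ℝ (fun z => Real.log (‖f z‖ ^ 2)) z u) =ᶠ[𝓝 y] fun z =>
      (‖f z‖ ^ 2)⁻¹ * (2 * inner ℝ (f z) (fderiv ℂ f z u)) := by
    filter_upwards [hd, hf.continuousAt.eventually_ne h0] with z hz hz0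
    rw [fderiv_log_norm_sq_apply hz hz0]
    rfl
  have h2 : HasFDerivAt (fderiv ℂ f) (fderiv ℂ (fderiv ℂ f) y) y :=
    ((hf.fderiv_right (m := 1) (by exact_mod_cast le_top)).differentiableAt (by simp)).hasFDerivAt
  have h3 : HasFDerivAt (fun z => fderiv ℂ f z u)
      (((ContinuousLinearMap.apply ℂ V u).comp (fderiv ℂ (fderiv ℂ f) y)).restrictScalars ℝ) y :=
    ((ContinuousLinearMap.apply ℂ V u).hasFDerivAt.comp y h2).restrictScalars ℝ
  have h4 : HasFDerivAt f ((fderiv ℂ f y).restrictScalars ℝ) y :=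
    (hd.self_of_nhds.hasFDerivAt).restrictScalars ℝ
  have h5 := (h4.inner ℝ h3).const_mul (2 : ℝ)
  have h6 := (hasDerivAt_inv (x := ‖f y‖ ^ 2) (by positivity)).comp_hasFDerivAt y
    (fderiv_norm_sq_apply hd.self_of_nhds)
  have h7 := h6.mul h5
  rw [h1.fderiv_eq]
  refine (congrArg (fun A => A u) h7.fderiv).trans ?_
  simp [real_inner_eq_re_inner]
  field_simp

  ring

/-- The left side averages the second derivatives along u and iu. Those of f itself cancel because
the complex second derivative is bilinear over ℂ; what is left is the Gram determinant of f and
df(u) divided by ‖f‖⁴, up to the factor 2. -/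
theorem ddbar_log_norm_sq_apply_self {f : E → V} {y : E} (hf : ContDiffAt ℂ ω f y) (h0 : f y ≠ 0)
    (u : E) : ContDiffAt ℝ ∞ (fun z => ((Real.log (‖f z‖ ^ 2) : ℝ) : ℂ)) y ∧
    Complex.I * ddbar (fun z => ((Real.log (‖f z‖ ^ 2) : ℝ) : ℂ)) y ![u, Complex.I • u] =
      ((2 * (‖f y‖ ^ 2 * ‖fderiv ℂ f y u‖ ^ 2 - ‖inner ℂ (f y) (fderiv ℂ f y u)‖ ^ 2) /
        (‖f y‖ ^ 2) ^ 2 : ℝ) : ℂ) := by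
  have hs : ContDiffAt ℝ ∞ (fun z => Real.log (‖f z‖ ^ 2)) y := by
    refine ContDiffAt.log ?_ (by positivity)
    exact (contDiffAt_real_of_complex hf).norm_sq ℂ
  have hc : ContDiffAt ℝ ∞ (fun z => ((Real.log (‖f z‖ ^ 2) : ℝ) : ℂ)) y :=
    Complex.ofRealCLM.contDiff.contDiffAt.comp y hs
  refine ⟨hc, ?_⟩
  have key : ∀ v : E, fderiv ℝ (fderiv ℝ fun z => ((Real.log (‖f z‖ ^ 2) : ℝ) : ℂ)) y v v =
      ((fderiv ℝ (fun z => fderiv ℝ (fun z => Real.log (‖f z‖ ^ 2)) z v) y v : ℝ) : ℂ) := by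
    intro v
    have h1 : fderiv ℝ (fun z => ((Real.log (‖f z‖ ^ 2) : ℝ) : ℂ)) =ᶠ[𝓝 y] fun z =>
        Complex.ofRealCLM.comp (fderiv ℝ (fun z => Real.log (‖f z‖ ^ 2)) z) := by
      filter_upwards [contDiffAt_eventually hs] with z hz
      exact (Complex.ofRealCLM.hasFDerivAt.comp z hz.hasFDerivAt).fderiv
    have h2 : DifferentiableAt ℝ (fderiv ℝ (fun z => Real.log (‖f z‖ ^ 2))) y :=
      (hs.fderiv_right (m := ∞) (by simp)).differentiableAt (by simp)
    rw [h1.fderiv_eq]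
    have h3 := ((ContinuousLinearMap.compL ℝ E ℝ ℂ Complex.ofRealCLM).hasFDerivAt.comp y
      h2.hasFDerivAt).fderiv
    have h4 := ((ContinuousLinearMap.apply ℝ ℝ v).hasFDerivAt.comp y h2.hasFDerivAt).fderiv
    exact (congrArg (fun A => A v v) h3).trans (congrArg (fun A => ((A v : ℝ) : ℂ)) h4).symm
  have hI : fderiv ℂ (fderiv ℂ f) y (Complex.I • u) (Complex.I • u) =
      -fderiv ℂ (fderiv ℂ f) y u u := by
    rw [map_smul, map_smul, _root_.smul_apply, smul_smul, Complex.I_mul_I, neg_one_smul]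
  rw [ddbar_apply_self hc, key, key, fderiv_fderiv_log_norm_sq hf h0,
    fderiv_fderiv_log_norm_sq hf h0, hI, map_smul, inner_neg_right, inner_smul_right, norm_smul,
    Complex.norm_I, one_mul]
  rw [← Complex.normSq_eq_norm_sq (inner ℂ (f y) (fderiv ℂ f y u)), Complex.normSq_apply]
  have h0' : ‖f y‖ ≠ 0 := norm_ne_zero_iff.2 h0
  rw [← Complex.ofReal_add]
  have : (1 / 2 : ℂ) = ((1 / 2 : ℝ) : ℂ) := by push_cast; rfl
  rw [this, ← Complex.ofReal_mul]
  congr 1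
  simp only [Complex.neg_re, Complex.mul_re, Complex.I_re, Complex.I_im]
  field_simp
  ring

/-- Equality in the Cauchy–Schwarz inequality would force proportionality. -/
theorem norm_inner_sq_lt {a b : V} (ha : a ≠ 0) (h : ∀ c : ℂ, b ≠ c • a) :
    ‖inner ℂ a b‖ ^ 2 < ‖a‖ ^ 2 * ‖b‖ ^ 2 := by
  have hb : b ≠ 0 := fun hb => h 0 (by rw [hb, zero_smul])
  have h1 : ‖inner ℂ a b‖ < ‖a‖ * ‖b‖ := by
    refine lt_of_le_of_ne (norm_inner_le_norm a b) fun he => ?_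
    obtain ⟨r, -, hr⟩ := (norm_inner_eq_norm_iff ha hb).1 he
    exact h r hr
  rw [← mul_pow]
  exact pow_lt_pow_left₀ h1 (norm_nonneg _) two_ne_zero

end LogNorm
-- The Fubini–Study metric of an ample line bundle.
section FubiniStudy

variable {E : Type*} [NormedAddCommGroup E] [NormedSpace ℂ E]
  {X : Type*} [TopologicalSpace X] [ChartedSpace E X]

theorem contMDiffAt_real_of_complex {V : Type*} [NormedAddCommGroup V] [NormedSpace ℂ V]
    {f : X → V} {x : X} (hf : ContMDiffAt 𝓘(ℂ, E) 𝓘(ℂ, V) ω f x) :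
    ContMDiffAt 𝓘(ℝ, E) 𝓘(ℝ, V) ∞ f x := by
  rw [contMDiffAt_iff] at hf ⊢
  refine ⟨hf.1, ?_⟩
  have h := hf.2
  simp only [mfld_simps, extChartAt, contDiffWithinAt_univ] at h ⊢
  exact contDiffAt_real_of_complex h

variable {L : X → Type*} [∀ x, AddCommGroup (L x)] [∀ x, Module ℂ (L x)]
  [∀ x, TopologicalSpace (L x)] [TopologicalSpace (Bundle.TotalSpace ℂ L)]
  [FiberBundle ℂ L] [VectorBundle ℂ ℂ L] {N r : ℕ}
  (t t' : Triv L) [MemTrivializationAtlas t] [MemTrivializationAtlas t']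

theorem powCoord_tprod {x : X} (v : Fin N → L x) :
    powCoord N t x (PiTensorProduct.tprod ℂ v) = ∏ i, t.linearMapAt ℂ x (v i) := by
  rw [powCoord, PiTensorProduct.lift.tprod]
  simp [MultilinearMap.mkPiAlgebra_apply]

theorem eq_powCoord_smul {x : X} (hx : x ∈ t.baseSet) (ζ : ⨂[ℂ]^N (L x)) :
    ζ = powCoord N t x ζ • PiTensorProduct.tprod ℂ (fun _ : Fin N => t.symm x (1 : ℂ)) := by
  have h : (LinearMap.id : (⨂[ℂ]^N (L x)) →ₗ[ℂ] ⨂[ℂ]^N (L x)) = (powCoord N t x).smulRight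
      (PiTensorProduct.tprod ℂ (fun _ : Fin N => t.symm x (1 : ℂ))) := by
    refine PiTensorProduct.ext (MultilinearMap.ext fun v => ?_)
    simp only [LinearMap.compMultilinearMap_apply, LinearMap.id_apply, LinearMap.smulRight_apply]
    rw [powCoord_tprod, ← MultilinearMap.map_smul_univ]
    congr 1
    funext i
    exact triv_linearMapAt_eq t hx (v i)
  exact LinearMap.congr_fun h ζ

theorem powCoord_ne_zero {x : X} (hx : x ∈ t.baseSet) {ζ : ⨂[ℂ]^N (L x)} (hζ : ζ ≠ 0) :
    powCoord N t x ζ ≠ 0 := by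
  intro h
  have := eq_powCoord_smul t hx ζ
  rw [h, zero_smul] at this
  exact hζ this

theorem powCoord_change {x : X} (hx : x ∈ t.baseSet) (ζ : ⨂[ℂ]^N (L x)) :
    powCoord N t' x ζ = trivChange t t' x ^ N * powCoord N t x ζ := by
  conv_lhs => rw [eq_powCoord_smul t hx ζ, map_smul, powCoord_tprod]
  rw [Finset.prod_const, Finset.card_univ, Fintype.card_fin, smul_eq_mul, mul_comm]
  rfl

/-- The homogeneous coordinates `(s₁(x), …, s_r(x))` of a point, in a trivialization. -/
def sectionCoords (s : Fin r → ∀ x, ⨂[ℂ]^N (L x)) (x : X) : EuclideanSpace ℂ (Fin r) :=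
  WithLp.toLp 2 fun j => powCoord N t x (s j x)

variable (s : Fin r → ∀ x, ⨂[ℂ]^N (L x))

theorem sectionCoords_ne_zero {x : X} (hx : x ∈ t.baseSet) (h : ∃ j, s j x ≠ 0) :
    sectionCoords t s x ≠ 0 := by
  obtain ⟨j, hj⟩ := h
  intro h0
  exact powCoord_ne_zero t hx hj (congrFun (congrArg (WithLp.ofLp) h0) j)

theorem sectionCoords_change {x : X} (hx : x ∈ t.baseSet) :
    sectionCoords t' s x = trivChange t t' x ^ N • sectionCoords t s x := by
  ext j
  exact powCoord_change t t' hx (s j x)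

theorem contMDiffAt_sectionCoords (hs : ∀ j, IsHolomorphicSection E (s j)) {x : X}
    (hx : x ∈ t.baseSet) :
    ContMDiffAt 𝓘(ℂ, E) 𝓘(ℂ, EuclideanSpace ℂ (Fin r)) ω (sectionCoords t s) x := by
  have h1 : ContMDiffAt 𝓘(ℂ, E) 𝓘(ℂ, Fin r → ℂ) ω (fun x j => powCoord N t x (s j x)) x :=
    contMDiffAt_pi_space.2 fun j => (hs j t).contMDiffAt (t.open_baseSet.mem_nhds hx)
  exact (PiLp.continuousLinearEquiv 2 ℂ (fun _ : Fin r => ℂ)).symm.contDiff.contDiffAt.comp_contMDiffAt h1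

/-- The squared norm on a line bundle induced by finitely many sections of its `N`-th power:
`|ξ|² = (∑_j |s_j / ξ^N|²) ^ (-1 / N)`. -/
def fubiniStudyNormSq (x : X) (ξ : L x) : ℝ :=
  ‖(FiberBundle.trivializationAt ℂ L x).linearMapAt ℂ x ξ‖ ^ 2 *
    (‖sectionCoords (FiberBundle.trivializationAt ℂ L x) s x‖ ^ 2) ^ (-(N : ℝ)⁻¹)

/-- Changing the frame multiplies the coordinate of ξ by g and those of the sections by g^N; the
exponent -1/N makes the factors |g|² and |g|⁻² cancel. So the metric can be computed in every
trivialization, which gives its smoothness. -/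
theorem fubiniStudyNormSq_eq (hN : N ≠ 0) {x : X} (hx : x ∈ t.baseSet) (ξ : L x) :
    fubiniStudyNormSq s x ξ =
      ‖t.linearMapAt ℂ x ξ‖ ^ 2 * (‖sectionCoords t s x‖ ^ 2) ^ (-(N : ℝ)⁻¹) := by
  have hx' := FiberBundle.mem_baseSet_trivializationAt' (F := ℂ) (E := L) x
  have hg := norm_ne_zero_iff.2
    (trivChange_ne_zero t (FiberBundle.trivializationAt ℂ L x) hx hx')
  rw [fubiniStudyNormSq, linearMapAt_change t (FiberBundle.trivializationAt ℂ L x) hx,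
    sectionCoords_change t (FiberBundle.trivializationAt ℂ L x) s hx, norm_mul, norm_smul, norm_pow]
  generalize ‖trivChange t (FiberBundle.trivializationAt ℂ L x) x‖ = g at hg
  rw [show (g ^ N * ‖sectionCoords t s x‖) ^ 2 = (g ^ 2) ^ N * ‖sectionCoords t s x‖ ^ 2 by ring,
    Real.mul_rpow (by positivity) (by positivity), Real.rpow_neg (by positivity),
    Real.pow_rpow_inv_natCast (by positivity) hN]
  field_simp

/-- The Fubini–Study metric. -/
def fubiniStudy (hN : N ≠ 0) (hs : ∀ j, IsHolomorphicSection E (s j))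
    (h0 : ∀ x, ∃ j, s j x ≠ 0) : SmoothMetric E L where
  normSq := fubiniStudyNormSq s
  normSq_smul x c ξ := by
    rw [fubiniStudyNormSq, fubiniStudyNormSq, map_smul, norm_smul]
    ring
  normSq_pos x ξ hξ := by
    have hx := FiberBundle.mem_baseSet_trivializationAt' (F := ℂ) (E := L) x
    have h1 := norm_pos_iff.2 (sectionCoords_ne_zero (FiberBundle.trivializationAt ℂ L x) s hx (h0 x))
    have h2 : (FiberBundle.trivializationAt ℂ L x).linearMapAt ℂ x ξ ≠ 0 := by
      intro h
      have := triv_linearMapAt_eq (FiberBundle.trivializationAt ℂ L x) hx ξ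
      rw [h, zero_smul] at this
      exact hξ this
    have := norm_pos_iff.2 h2
    rw [fubiniStudyNormSq]
    positivity
  smooth t _ := by
    intro x hx
    have h1 := norm_pos_iff.2 (sectionCoords_ne_zero t s hx (h0 x))
    have h2 := contMDiffAt_real_of_complex (contMDiffAt_sectionCoords t s hs hx)
    have h3 : ContDiffAt ℝ ∞ (fun w : EuclideanSpace ℂ (Fin r) => (‖w‖ ^ 2) ^ (-(N : ℝ)⁻¹))
        (sectionCoords t s x) :=
      (contDiff_id.norm_sq ℂ).contDiffAt.rpow_const_of_ne (pow_pos h1 2).ne'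
    have h4 := h3.comp_contMDiffAt h2
    refine ContMDiffWithinAt.congr h4.contMDiffWithinAt (fun z hz => ?_) ?_
    · rw [fubiniStudyNormSq_eq t s hN hz, triv_linearMapAt_symm t hz, norm_one, one_pow, one_mul]
      rfl
    · rw [fubiniStudyNormSq_eq t s hN hx, triv_linearMapAt_symm t hx, norm_one, one_pow, one_mul]
      rfl

theorem fubiniStudy_weight (hN : N ≠ 0) (hs : ∀ j, IsHolomorphicSection E (s j))
    (h0 : ∀ x, ∃ j, s j x ≠ 0) {x : X} (hx : x ∈ t.baseSet) :
    (fubiniStudy s hN hs h0).weight t x = (N : ℝ)⁻¹ * Real.log (‖sectionCoords t s x‖ ^ 2) := by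
  have h1 := norm_pos_iff.2 (sectionCoords_ne_zero t s hx (h0 x))
  change -Real.log (fubiniStudyNormSq s x _) = _
  rw [fubiniStudyNormSq_eq t s hN hx, triv_linearMapAt_symm t hx, norm_one, one_pow, one_mul,
    Real.log_rpow (by positivity)]
  ring

theorem ddbar_const_mul {f : E → ℂ} {y : E} (c : ℂ) (hf : ContDiffAt ℝ ∞ f y) :
    ddbar (fun z => c * f z) y = c • ddbar f y := by
  have h : dbar (fun z => c * f z) =ᶠ[𝓝 y] fun z => c • dbar f z := by
    filter_upwards [contDiffAt_eventually hf] with z hz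
    ext w
    change _ = c * dbar f z w
    rw [dbar_apply, dbar_apply, fderiv_const_mul hz]
    simp only [_root_.smul_apply, smul_eq_mul]
    ring
  rw [ddbar, h.extDeriv_eq, extDeriv_const_smul c ((contDiffAt_dbar hf).differentiableAt (by simp))]
  rfl

/-- Proportionality of ds(u) and s is exactly what the immersion hypothesis excludes, so the Gram
determinant in the curvature is strictly positive. -/
theorem fubiniStudy_isPositive [IsManifold 𝓘(ℂ, E) ω X] (hN : N ≠ 0)
    (hs : ∀ j, IsHolomorphicSection E (s j)) (h0 : ∀ x, ∃ j, s j x ≠ 0)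
    (himm : ∀ x, ∀ u : TangentSpace 𝓘(ℂ, E) x, u ≠ 0 → ¬ ∃ c : ℂ, ∀ j,
      mfderiv 𝓘(ℂ, E) 𝓘(ℂ, ℂ)
        (fun y => powCoord N (FiberBundle.trivializationAt ℂ L x) y (s j y)) x u =
        c * powCoord N (FiberBundle.trivializationAt ℂ L x) x (s j x)) :
    (fubiniStudy s hN hs h0).IsPositive := by
  intro x
  set t := FiberBundle.trivializationAt ℂ L x with ht
  set e := chartAt E x with he
  have hxt : x ∈ t.baseSet := FiberBundle.mem_baseSet_trivializationAt' (F := ℂ) (E := L) x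
  have hxe : x ∈ e.source := mem_chart_source E x
  have hy : e x ∈ e.target := e.map_source hxe
  have hex : e.symm (e x) = x := e.left_inv hxe
  have hne : sectionCoords t s (e.symm (e x)) ≠ 0 := by
    rw [hex]
    exact sectionCoords_ne_zero t s hxt (h0 x)
  have hf : ContDiffAt ℂ ω (fun z => sectionCoords t s (e.symm z)) (e x) := by
    have h1 := contMDiffAt_sectionCoords t s hs (by rwa [hex] : e.symm (e x) ∈ t.baseSet)
    exact (h1.comp (e x) ((isHolomorphicChart_chartAt x).2.contMDiffAt
      (e.open_target.mem_nhds hy))).contDiffAt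
  have hloc : (fun z => (((fubiniStudy s hN hs h0).weight t (e.symm z) : ℝ) : ℂ)) =ᶠ[𝓝 (e x)]
      fun z => ((N : ℂ)⁻¹) * ((Real.log (‖sectionCoords t s (e.symm z)‖ ^ 2) : ℝ) : ℂ) := by
    filter_upwards [(e.continuousAt_symm hy).preimage_mem_nhds (t.open_baseSet.mem_nhds
      (by rwa [hex] : e.symm (e x) ∈ t.baseSet))] with z hz
    rw [fubiniStudy_weight t s hN hs h0 hz]
    push_cast
    rfl
  refine isPositiveAt_of_pairFrame (k := 1) fun u hu => ?_
  have hu0 : u 0 ≠ 0 := hu.ne_zero 0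
  obtain ⟨h1, h2⟩ := ddbar_log_norm_sq_apply_self hf hne (u 0)
  have hpf : pairFrame u = ![u 0, Complex.I • u 0] := by
    funext j
    fin_cases j <;> simp [pairFrame]
  have hlt : ∀ c : ℂ, fderiv ℂ (fun z => sectionCoords t s (e.symm z)) (e x) (u 0) ≠
      c • sectionCoords t s (e.symm (e x)) := by
    intro c hc
    refine himm x (u 0) hu0 ⟨c, fun j => ?_⟩
    have h3 := ((hs j t).contMDiffAt (t.open_baseSet.mem_nhds hxt)).mdifferentiableAt
      (by simp) |>.mfderiv
    have h4 := congrArg (fun w : EuclideanSpace ℂ (Fin r) => w j) hc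
    rw [hex] at h4
    have h5 := ((EuclideanSpace.proj (𝕜 := ℂ) j).hasFDerivAt.comp (e x)
      (hf.differentiableAt (by simp)).hasFDerivAt).fderiv
    refine Eq.trans ?_ h4
    rw [h3]
    simp only [writtenInExtChartAt, Function.comp_def, extChartAt, mfld_simps, fderivWithin_univ]
    exact congrArg (fun A : E →L[ℂ] ℂ => A (u 0)) h5
  have hpos := norm_inner_sq_lt hne hlt
  have hn := norm_pos_iff.2 hne
  have hNpos : (0 : ℝ) < N := by exact_mod_cast Nat.pos_of_ne_zero hN
  refine ⟨(N : ℝ)⁻¹ * (2 * (‖sectionCoords t s (e.symm (e x))‖ ^ 2 *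
    ‖fderiv ℂ (fun z => sectionCoords t s (e.symm z)) (e x) (u 0)‖ ^ 2 -
    ‖inner ℂ (sectionCoords t s (e.symm (e x)))
      (fderiv ℂ (fun z => sectionCoords t s (e.symm z)) (e x) (u 0))‖ ^ 2) /
      (‖sectionCoords t s (e.symm (e x))‖ ^ 2) ^ 2), ?_, ?_⟩
  · have := sub_pos.2 hpos
    positivity
  · rw [Complex.ofReal_mul, ← h2, hpf]
    change Complex.I * ddbar _ (e x) _ = _
    rw [ddbar_congr hloc, ddbar_const_mul _ h1]
    change Complex.I * ((N : ℂ)⁻¹ * ddbar _ (e x) _) = _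
    push_cast
    ring

end FubiniStudy

theorem IsAmple.exists_isPositive {E : Type*} [NormedAddCommGroup E] [NormedSpace ℂ E]
    {X : Type*} [TopologicalSpace X] [ChartedSpace E X] [IsManifold 𝓘(ℂ, E) ω X]
    {L : X → Type*} [∀ x, AddCommGroup (L x)] [∀ x, Module ℂ (L x)]
    [∀ x, TopologicalSpace (L x)] [TopologicalSpace (Bundle.TotalSpace ℂ L)]
    [FiberBundle ℂ L] [VectorBundle ℂ ℂ L] (h : IsAmple E L) :
    ∃ φ : SmoothMetric E L, φ.IsPositive := by
  obtain ⟨N, hN, r, s, hs, h0, -, himm⟩ := h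
  exact ⟨_, fubiniStudy_isPositive s (by omega) hs h0 himm⟩

theorem castDegree_castDegree {E : Type*} [NormedAddCommGroup E] [NormedSpace ℂ E] {p q s : ℕ}
    (h : p = q) (h' : q = s) (α : E [⋀^Fin p]→L[ℝ] ℂ) :
    castDegree h' (castDegree h α) = castDegree (h.trans h') α := by
  subst h; subst h'; rfl

/-! ### Direct images of powers of the Chern form. -/

section DirectImage

variable {B : Type*} [NormedAddCommGroup B] [NormedSpace ℂ B] [FiniteDimensional ℂ B]
  {E : Type*} [NormedAddCommGroup E] [NormedSpace ℂ E] [FiniteDimensional ℂ E]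
  {M : Type*} [TopologicalSpace M] [ChartedSpace B M] [IsManifold 𝓘(ℂ, B) ω M] [T2Space M]
  {X : Type*} [TopologicalSpace X] [ChartedSpace E X] [IsManifold 𝓘(ℂ, E) ω X] [CompactSpace X]
  {n r : ℕ} {π : X → M} (P : FiberPartition B E n π)

omit [FiniteDimensional ℂ B] [FiniteDimensional ℂ E] [IsManifold 𝓘(ℂ, B) ω M] [T2Space M] in
theorem FiberPartition.integrate_sub {α β : DForm E X (r + 2 * n)}
    (hα : IsSmoothForm α) (hβ : IsSmoothForm β) :
    P.integrate (α - β) = P.integrate α - P.integrate β := by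
  refine eq_sub_of_add_eq ?_
  rw [P.integrate_eq, P.integrate_eq, P.integrate_eq, ← Finset.sum_add_distrib]
  refine Finset.sum_congr rfl fun i _ => ?_
  rw [← pushChart_add (P.admissible i).holo ((hα.sub hβ).smul (P.smooth i))
    (P.tsupport_smul_subset i (α - β)) (hβ.smul (P.smooth i)) (P.tsupport_smul_subset i β)]
  congr 1
  funext x
  ext w
  change P.ρ i x • (α x w - β x w) + P.ρ i x • β x w = P.ρ i x • α x w
  rw [← smul_add, sub_add_cancel]

omit [FiniteDimensional ℂ B] [FiniteDimensional ℂ E] [IsManifold 𝓘(ℂ, B) ω M] [T2Space M] in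
theorem FiberPartition.integrate_zero : P.integrate (0 : DForm E X (r + 2 * n)) = 0 := by
  have := P.integrate_sub (r := r) (isSmoothForm_zero (E := E) (X := X)) isSmoothForm_zero
  rwa [sub_zero, sub_self] at this

omit [FiniteDimensional ℂ B] [FiniteDimensional ℂ E] in
theorem FiberPartition.dForm_integrate_wedgePow (hπ : Continuous π) {γ : DForm E X 2}
    (hγ : IsSmoothForm γ) (hc : dForm γ = 0) {k : ℕ} (h : 2 * (n + k) = 2 * k + 2 * n) :
    dForm (P.integrate fun x => castDegree h (wedgePow (γ x) (n + k))) = 0 := by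
  rw [P.dForm_integrate (by omega) hπ (IsSmoothForm.castDegree h (hγ.wedgePow (n + k))),
    dForm_castDegree h, dForm_wedgePow hγ hc]
  refine Eq.trans (congrArg P.integrate ?_) P.integrate_zero
  funext x
  exact (congrArg (castDegree _) (castDegree_zero _)).trans (castDegree_zero _)

omit [FiniteDimensional ℂ B] [FiniteDimensional ℂ E] in
/-- The direct images of the powers of two cohomologous closed forms are cohomologous. -/
theorem FiberPartition.isExactForm_integrate_wedgePow_sub (hπ : Continuous π) {γ₀ γ₁ : DForm E X 2}
    {η : DForm E X 1} (h₀ : IsSmoothForm γ₀) (h₁ : IsSmoothForm γ₁) (hη : IsSmoothForm η)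
    (hc₀ : dForm γ₀ = 0) (hc₁ : dForm γ₁ = 0) (hd : dForm η = γ₁ - γ₀) {k : ℕ}
    (h : 2 * (n + k) = 2 * k + 2 * n) :
    IsExactForm ((P.integrate fun x => castDegree h (wedgePow (γ₁ x) (n + k))) -
      P.integrate fun x => castDegree h (wedgePow (γ₀ x) (n + k))) := by
  rw [← P.integrate_sub (IsSmoothForm.castDegree h (h₁.wedgePow (n + k)))
    (IsSmoothForm.castDegree h (h₀.wedgePow (n + k)))]
  have hsub : ((fun x => castDegree h (wedgePow (γ₁ x) (n + k))) -
      fun x => castDegree h (wedgePow (γ₀ x) (n + k))) =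
      fun x => castDegree h (wedgePow (γ₁ x) (n + k) - wedgePow (γ₀ x) (n + k)) := by
    funext x
    exact (castDegree_sub h _ _).symm
  rw [hsub]
  -- In base degree zero exactness means vanishing. For n = 0 both powers are the constant 1;
  -- otherwise the difference of the powers is exact on X and its fibre integral is zero. For k > 0
  -- the push-forward of ζ is a primitive.
  cases k with
  | zero =>
    change P.integrate (r := 2 * 0) _ = 0
    cases n with
    | zero =>
      refine Eq.trans (congrArg P.integrate ?_) P.integrate_zero
      funext x
      exact (congrArg (castDegree h) (sub_self _)).trans (castDegree_zero h)
    | succ n =>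
      obtain ⟨ζ, hζ, hdζ⟩ := exists_dForm_eq_wedgePow_sub h₀ h₁ hη hc₀ hc₁ hd n
      have := P.integrate_dForm_eq_zero (q := 2 * n + 1) (by omega) hζ
      rw [hdζ] at this
      exact this
  | succ k =>
    change ∃ θ : DForm B M (2 * k + 1), IsSmoothForm θ ∧ IsExtDeriv θ _
    obtain ⟨ζ, hζ, hdζ⟩ := exists_dForm_eq_wedgePow_sub h₀ h₁ hη hc₀ hc₁ hd (n + k)
    have hs : 2 * (n + k) + 1 = (2 * k + 1) + 2 * n := by omega
    have hζ' := IsSmoothForm.castDegree hs hζ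
    have hP := P.isSmoothForm_integrate hπ hζ'
    refine ⟨_, hP, ?_⟩
    have h1 := hP.isExtDeriv_dForm
    rw [P.dForm_integrate (by omega) hπ hζ', dForm_castDegree hs, hdζ] at h1
    refine Eq.mp (congrArg (IsExtDeriv _) (congrArg P.integrate ?_)) h1
    funext x
    exact castDegree_castDegree _ _ _

omit [FiniteDimensional ℂ B] [FiniteDimensional ℂ E] [IsManifold 𝓘(ℂ, B) ω M] [T2Space M]
  [IsManifold 𝓘(ℂ, E) ω X] [CompactSpace X] in
theorem pushPow_eq (h : Nonempty (FiberPartition B E n π)) (k : ℕ) (γ : DForm E X 2) :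
    pushPow B E n k π γ = h.some.integrate (r := 2 * k) fun x =>
      castDegree (by omega : 2 * (n + k) = 2 * k + 2 * n) (wedgePow (γ x) (n + k)) := dif_pos h

variable {L : X → Type*} [∀ x, AddCommGroup (L x)] [∀ x, Module ℂ (L x)]
  [∀ x, TopologicalSpace (L x)] [TopologicalSpace (Bundle.TotalSpace ℂ L)]
  [FiberBundle ℂ L] [VectorBundle ℂ ℂ L] [ContMDiffVectorBundle ω ℂ L 𝓘(ℂ, E)]

omit [FiniteDimensional ℂ B] [FiniteDimensional ℂ E] in
theorem isPositiveForm_SForm (h : Nonempty (FiberPartition B E n π)) (hπ : Continuous π)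
    (hsurj : Function.Surjective π) {φ : SmoothMetric E L} (hφ : φ.IsPositive) (k : ℕ) :
    IsPositiveForm k (SForm B n k π φ) := by
  have hγ := φ.isSmoothForm_chernForm
  rw [SForm, pushPow_eq h]
  exact ⟨h.some.isSmoothForm_integrate hπ (IsSmoothForm.castDegree _ (hγ.wedgePow (n + k))),
    fun y => ⟨h.some.isType_integrate_wedgePow hγ φ.isJInvariant_chernForm _ y,
      h.some.isPositiveAt_integrate_wedgePow hsurj hγ φ.isJInvariant_chernForm
        hφ.isTamed_chernForm _ y⟩⟩

omit [FiniteDimensional ℂ B] [FiniteDimensional ℂ E] in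
-- All the direct images are computed with the same chosen partition, so they can be compared
-- without proving independence of that choice.
theorem representsSClass_SForm (h : Nonempty (FiberPartition B E n π)) (hπ : Continuous π)
    (φ : SmoothMetric E L) (k : ℕ) : RepresentsSClass B E L n k π (SForm B n k π φ) := by
  have hγ := φ.isSmoothForm_chernForm
  have hc := φ.dForm_chernForm
  have hs : IsSmoothForm (SForm B n k π φ) := by
    rw [SForm, pushPow_eq h]
    exact h.some.isSmoothForm_integrate hπ (IsSmoothForm.castDegree _ (hγ.wedgePow (n + k)))
  refine ⟨hs, isClosedForm_of_dForm_eq_zero hs ?_, fun γ ⟨hγ', hc', hex⟩ => ?_⟩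
  · rw [SForm, pushPow_eq h]
    exact h.some.dForm_integrate_wedgePow hπ hγ hc _
  · obtain ⟨η, hη, hd⟩ := hex φ
    have hd' : dForm (0 - η) = φ.chernForm - γ := by
      rw [dForm_sub isSmoothForm_zero hη, dForm_zero, zero_sub, ← hd.eq_dForm, neg_sub]
    rw [SForm, pushPow_eq h, pushPow_eq h]
    exact h.some.isExactForm_integrate_wedgePow_sub hπ hγ' hγ (isSmoothForm_zero.sub hη)
      hc'.dForm_eq_zero hc hd' _

end DirectImage
end
end CplxFib

theorem proposition4p4 (m n : ℕ)
    {B : Type*} [NormedAddCommGroup B] [NormedSpace ℂ B] [FiniteDimensional ℂ B]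
    (hB : Module.finrank ℂ B = m)
    {E : Type*} [NormedAddCommGroup E] [NormedSpace ℂ E] [FiniteDimensional ℂ E]
    (hE : Module.finrank ℂ E = m + n)
    {M : Type*} [TopologicalSpace M] [T2Space M] [CompactSpace M]
    [ChartedSpace B M] [IsManifold 𝓘(ℂ, B) ω M]
    {X : Type*} [TopologicalSpace X] [T2Space X]
    [ChartedSpace E X] [IsManifold 𝓘(ℂ, E) ω X]
    (π : X → M) (hπ_holo : ContMDiff 𝓘(ℂ, E) 𝓘(ℂ, B) ω π)
    (hπ_proper : IsProperMap π) (hπ_surj : Function.Surjective π)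
    (hπ_subm : ∀ x, Function.Surjective (mfderiv 𝓘(ℂ, E) 𝓘(ℂ, B) π x))
    {L : X → Type*} [∀ x, AddCommGroup (L x)] [∀ x, Module ℂ (L x)]
    [∀ x, TopologicalSpace (L x)] [TopologicalSpace (Bundle.TotalSpace ℂ L)]
    [FiberBundle ℂ L] [VectorBundle ℂ ℂ L] [ContMDiffVectorBundle ω ℂ L 𝓘(ℂ, E)] :
    (∀ φ : CplxFib.SmoothMetric E L, φ.IsPositive → ∀ k ≤ m,
      CplxFib.IsPositiveForm k (CplxFib.SForm B n k π φ) ∧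
      CplxFib.RepresentsSClass B E L n k π (CplxFib.SForm B n k π φ)) ∧
    (CplxFib.IsAmple E L → ∀ k ≤ m, ∃ Φ : CplxFib.DForm B M (2 * k),
      CplxFib.IsPositiveForm k Φ ∧ CplxFib.RepresentsSClass B E L n k π Φ) := by
  -- Properness over the compact base makes X compact, which yields finite covers and closed
  -- supports.
  have : CompactSpace X :=
    ⟨by simpa using hπ_proper.isCompact_preimage isCompact_univ⟩
  have hP : Nonempty (CplxFib.FiberPartition B E n π) :=
    CplxFib.nonempty_fiberPartition (by rw [hE, hB]) hπ_holo hπ_subm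
  have hπ := hπ_holo.continuous
  have key : ∀ φ : CplxFib.SmoothMetric E L, φ.IsPositive → ∀ k ≤ m,
      CplxFib.IsPositiveForm k (CplxFib.SForm B n k π φ) ∧
      CplxFib.RepresentsSClass B E L n k π (CplxFib.SForm B n k π φ) := fun φ hφ k _ =>
    ⟨CplxFib.isPositiveForm_SForm hP hπ hπ_surj hφ k, CplxFib.representsSClass_SForm hP hπ φ k⟩
  refine ⟨key, fun hL k hk => ?_⟩
  obtain ⟨φ, hφ⟩ := hL.exists_isPositive
  exact ⟨_, key φ hφ k hk⟩
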